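/- Model: a real RAM in which every operation, cell access and test costs one step; words (indices) have $O(\log n)$ bits, real numbers are added, subtracted, multiplied, divided and compared exactly, program constants are integers or rationals, and nothing is assumed about memory cells that do not hold the input. Let $\omega$ be the exponent of matrix multiplication, i.e. the infimum of the $\tau$ such that two real $n\times n$ matrices can be multiplied in $O(n^{\tau})$ steps. Below, $n^{\omega}$ means $n^{\tau}$, where $\tau$ is any fixed exponent for which such a multiplication program exists or any fixed real number greater than $\omega$. Let $G=(V,E)$ be a directed acyclic graph with $n$ vertices, $m$ edges (at most one from any vertex to any other) and arbitrary real edge weights. The length of a path is the sum of its edge weights. A numbering $v_1,\dots,v_n$ of $V$ is admissible if $i<j$ for every edge $(v_i,v_j)$, and every vertex of indegree $0$ has a lower number than every other vertex. The trivial path from a vertex to itself is lexicographically first. A shortest path $P$ with at least one edge, from $v_k$ to $v_i$, is lexicographically first if its last but one vertex $v_j$ has the lowest number among the last but one vertices of all shortest paths from $v_k$ to $v_i$, and the part of $P$ from $v_k$ to $v_j$ is the lexicographically-first shortest path from $v_k$ to $v_j$. $T_v$ is the union of the lexicographically-first shortest paths to $v$ from all its ancestors, i.e. from all $u$ from which a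 path with at least one edge leads to $v$ (just $v$ itself if it has none). It is a tree with root $v$ and edges directed towards $v$; $\mathrm{leaf}(T_v)$ is the set of its leaves. Algorithm: (1) compute an admissible numbering of $V$ and, for each vertex, the list of its incoming edges; (2) compute, for each vertex, the list of its ancestors in increasing order; (3) set $dist(u,u)=0$ and $dist(u,v)=\infty$ for $u\ne v$; (4) for every $v_i$ of positive indegree, in increasing order of $i$: set $NEXT_{v_i}(u)=0$ for all ancestors $u$ of $v_i$; then for every ancestor $v_k$ of $v_i$ in increasing order of $k$ with still $NEXT_{v_i}(v_k)=0$: choose the direct ancestor $v_j$ of $v_i$ minimizing $dist(v_k,v_j)+weight(v_j,v_i)$, with the least $j$ in case of ties; starting from $x=v_k$, while $x\neq v_j$ and $NEXT_{v_i}(x)=0$, set $dist(x,v_i)=dist(x,v_j)+weight(v_j,v_i)$ and $NEXT_{v_i}(x)=NEXT_{v_j}(x)$ and replace $x$ by $NEXT_{v_i}(x)$; finally, if $NEXT_{v_i}(v_j)=0$, set $dist(v_j,v_i)=weight(v_j,v_i)$ and $NEXT_{v_i}(v_j)=v_i$. Theorem. With suitable programs for (1) and (2), which take $O(1+n+m)$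 and $O(1+\min\{n^{\omega},\,nm+n^2\log n\})$ steps respectively, this algorithm solves the all-pairs shortest paths problem in every such $G$, given as a list of edges in arbitrary order. It outputs an admissible numbering, the distance $dist(u,v)$ for all pairs of vertices ($\infty$ if $v$ is not reachable from $u$), and for every vertex $v$ the tree $T_v$ with respect to that numbering, given by the table $NEXT_v$: for each ancestor $u$ of $v$, $NEXT_v(u)$ is the head of the unique edge of $T_v$ with tail $u$. Its running time is $$O\Bigl(1+\min\{n^{\omega},\,nm+n^2\log n\}+\sum_{v\in V}\mathrm{indeg}(v)\,|\mathrm{leaf}(T_v)|\Bigr).$$ The constants do not depend on the graph. Steps (2)–(4) have the same correctness and running time when they are started from an arbitrary admissible numbering instead of the one computed in (1). -/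

import Mathlib

/-! ## A real random access machine

Programs are written in a small imperative language.  Index registers and index arrays hold natural
numbers (machine words), real registers and real arrays hold real numbers.  Every operation, every
read or write of a cell and every test costs one time unit.  Words are bounded: an addition or a
multiplication of words whose result reaches the word bound `W` is not defined, so that a program
which performs it has no execution.  There is no rounding and no other conversion from real numbers
to words; only comparisons lead from real numbers to the control flow. -/

namespace RealRAM

/-- Word-valued expressions.  `sub` is truncated subtraction, `div` is the integer quotient. -/
inductive IExp : Type
  | const (k : ℕ)
  | reg (x : ℕ)
  | arr (a : ℕ) (i : IExp)
  | add (e f : IExp)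
  | sub (e f : IExp)
  | mul (e f : IExp)
  | div (e f : IExp)

/-- Real-valued expressions.  Only rational constants may be written in a program. -/
inductive RExp : Type
  | const (q : ℚ)
  | reg (x : ℕ)
  | arr (a : ℕ) (i : IExp)
  | add (e f : RExp)
  | sub (e f : RExp)
  | mul (e f : RExp)
  | div (e f : RExp)

/-- Tests. -/
inductive BExp : Type
  | ieq (e f : IExp)
  | ilt (e f : IExp)
  | req (e f : RExp)
  | rlt (e f : RExp)
  | not (b : BExp)
  | and (b c : BExp)
  | or (b c : BExp)

/-- Programs. -/
inductive Cmd : Type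
  | skip
  | iset (x : ℕ) (e : IExp)
  | rset (x : ℕ) (e : RExp)
  | istore (a : ℕ) (i : IExp) (e : IExp)
  | rstore (a : ℕ) (i : IExp) (e : RExp)
  | seq (c d : Cmd)
  | ite (b : BExp) (c d : Cmd)
  | while (b : BExp) (c : Cmd)

/-- Sequential composition of a list of programs. -/
def block : List Cmd → Cmd
  | [] => Cmd.skip
  | [c] => c
  | c :: d :: cs => Cmd.seq c (block (d :: cs))

/-- The memory: registers and arrays of words, registers and arrays of real numbers. -/
structure Mem : Type where
  ireg : ℕ → ℕ
  rreg : ℕ → ℝ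
  iarr : ℕ → ℕ → ℕ
  rarr : ℕ → ℕ → ℝ

/-- The value of a word-valued expression. -/
def IExp.eval (σ : Mem) : IExp → ℕ
  | .const k => k
  | .reg x => σ.ireg x
  | .arr a i => σ.iarr a (i.eval σ)
  | .add e f => e.eval σ + f.eval σ
  | .sub e f => e.eval σ - f.eval σ
  | .mul e f => e.eval σ * f.eval σ
  | .div e f => e.eval σ / f.eval σ

/-- No overflow occurs in the evaluation of the expression. -/
def IExp.Fits (W : ℕ) (σ : Mem) : IExp → Prop
  | .const _ => True
  | .reg _ => True
  | .arr _ i => i.Fits W σ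
  | .add e f => e.Fits W σ ∧ f.Fits W σ ∧ e.eval σ + f.eval σ < W
  | .sub e f => e.Fits W σ ∧ f.Fits W σ
  | .mul e f => e.Fits W σ ∧ f.Fits W σ ∧ e.eval σ * f.eval σ < W
  | .div e f => e.Fits W σ ∧ f.Fits W σ

/-- The number of operations in an expression. -/
def IExp.cost : IExp → ℕ
  | .const _ => 1
  | .reg _ => 1
  | .arr _ i => i.cost + 1
  | .add e f => e.cost + f.cost + 1
  | .sub e f => e.cost + f.cost + 1
  | .mul e f => e.cost + f.cost + 1
  | .div e f => e.cost + f.cost + 1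

/-- The value of a real-valued expression. -/
noncomputable def RExp.eval (σ : Mem) : RExp → ℝ
  | .const q => (q : ℝ)
  | .reg x => σ.rreg x
  | .arr a i => σ.rarr a (i.eval σ)
  | .add e f => e.eval σ + f.eval σ
  | .sub e f => e.eval σ - f.eval σ
  | .mul e f => e.eval σ * f.eval σ
  | .div e f => e.eval σ / f.eval σ

/-- No overflow occurs in the address computations of the expression. -/
def RExp.Fits (W : ℕ) (σ : Mem) : RExp → Prop
  | .const _ => True
  | .reg _ => True
  | .arr _ i => i.Fits W σ
  | .add e f => e.Fits W σ ∧ f.Fits W σ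
  | .sub e f => e.Fits W σ ∧ f.Fits W σ
  | .mul e f => e.Fits W σ ∧ f.Fits W σ
  | .div e f => e.Fits W σ ∧ f.Fits W σ

/-- The number of operations in an expression. -/
def RExp.cost : RExp → ℕ
  | .const _ => 1
  | .reg _ => 1
  | .arr _ i => i.cost + 1
  | .add e f => e.cost + f.cost + 1
  | .sub e f => e.cost + f.cost + 1
  | .mul e f => e.cost + f.cost + 1
  | .div e f => e.cost + f.cost + 1

/-- The truth value of a test. -/
def BExp.Holds (σ : Mem) : BExp → Prop
  | .ieq e f => e.eval σ = f.eval σ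
  | .ilt e f => e.eval σ < f.eval σ
  | .req e f => e.eval σ = f.eval σ
  | .rlt e f => e.eval σ < f.eval σ
  | .not b => ¬ b.Holds σ
  | .and b c => b.Holds σ ∧ c.Holds σ
  | .or b c => b.Holds σ ∨ c.Holds σ

/-- No overflow occurs in the evaluation of the test. -/
def BExp.Fits (W : ℕ) (σ : Mem) : BExp → Prop
  | .ieq e f => e.Fits W σ ∧ f.Fits W σ
  | .ilt e f => e.Fits W σ ∧ f.Fits W σ
  | .req e f => e.Fits W σ ∧ f.Fits W σ
  | .rlt e f => e.Fits W σ ∧ f.Fits W σ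
  | .not b => b.Fits W σ
  | .and b c => b.Fits W σ ∧ c.Fits W σ
  | .or b c => b.Fits W σ ∧ c.Fits W σ

/-- The number of operations in a test. -/
def BExp.cost : BExp → ℕ
  | .ieq e f => e.cost + f.cost + 1
  | .ilt e f => e.cost + f.cost + 1
  | .req e f => e.cost + f.cost + 1
  | .rlt e f => e.cost + f.cost + 1
  | .not b => b.cost + 1
  | .and b c => b.cost + c.cost + 1
  | .or b c => b.cost + c.cost + 1

/-- Write a word into an index register. -/
def Mem.setIReg (σ : Mem) (x v : ℕ) : Mem :=
  { σ with ireg := Function.update σ.ireg x v }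

/-- Write a real number into a real register. -/
def Mem.setRReg (σ : Mem) (x : ℕ) (v : ℝ) : Mem :=
  { σ with rreg := Function.update σ.rreg x v }

/-- Write a word into cell `i` of the index array `a`. -/
def Mem.setIArr (σ : Mem) (a i v : ℕ) : Mem :=
  { σ with iarr := Function.update σ.iarr a (Function.update (σ.iarr a) i v) }

/-- Write a real number into cell `i` of the real array `a`. -/
def Mem.setRArr (σ : Mem) (a i : ℕ) (v : ℝ) : Mem :=
  { σ with rarr := Function.update σ.rarr a (Function.update (σ.rarr a) i v) }

/-- `Exec W c σ σ' t`: with word bound `W`, the program `c`, started in the memory `σ`, halts in the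
memory `σ'` after exactly `t` steps, without an overflow. -/
inductive Exec (W : ℕ) : Cmd → Mem → Mem → ℕ → Prop
  | skip (σ : Mem) : Exec W Cmd.skip σ σ 1
  | iset (σ : Mem) (x : ℕ) (e : IExp) (he : e.Fits W σ) :
      Exec W (Cmd.iset x e) σ (σ.setIReg x (e.eval σ)) (e.cost + 1)
  | rset (σ : Mem) (x : ℕ) (e : RExp) (he : e.Fits W σ) :
      Exec W (Cmd.rset x e) σ (σ.setRReg x (e.eval σ)) (e.cost + 1)
  | istore (σ : Mem) (a : ℕ) (i e : IExp) (hi : i.Fits W σ) (he : e.Fits W σ) :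
      Exec W (Cmd.istore a i e) σ (σ.setIArr a (i.eval σ) (e.eval σ)) (i.cost + e.cost + 1)
  | rstore (σ : Mem) (a : ℕ) (i : IExp) (e : RExp) (hi : i.Fits W σ) (he : e.Fits W σ) :
      Exec W (Cmd.rstore a i e) σ (σ.setRArr a (i.eval σ) (e.eval σ)) (i.cost + e.cost + 1)
  | seq {c d : Cmd} {σ σ' σ'' : Mem} {s t : ℕ}
      (hc : Exec W c σ σ' s) (hd : Exec W d σ' σ'' t) :
      Exec W (Cmd.seq c d) σ σ'' (s + t)
  | iteTrue {b : BExp} {c d : Cmd} {σ σ' : Mem} {t : ℕ}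
      (hf : b.Fits W σ) (hb : b.Holds σ) (hc : Exec W c σ σ' t) :
      Exec W (Cmd.ite b c d) σ σ' (b.cost + 1 + t)
  | iteFalse {b : BExp} {c d : Cmd} {σ σ' : Mem} {t : ℕ}
      (hf : b.Fits W σ) (hb : ¬ b.Holds σ) (hd : Exec W d σ σ' t) :
      Exec W (Cmd.ite b c d) σ σ' (b.cost + 1 + t)
  | whileTrue {b : BExp} {c : Cmd} {σ σ' σ'' : Mem} {s t : ℕ}
      (hf : b.Fits W σ) (hb : b.Holds σ) (hc : Exec W c σ σ' s)
      (hw : Exec W (Cmd.while b c) σ' σ'' t) :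
      Exec W (Cmd.while b c) σ σ'' (b.cost + 1 + s + t)
  | whileFalse {b : BExp} {c : Cmd} {σ : Mem}
      (hf : b.Fits W σ) (hb : ¬ b.Holds σ) :
      Exec W (Cmd.while b c) σ σ (b.cost + 1)

/-- `τ` is an exponent of matrix multiplication: some program multiplies any two real `n × n`
matrices in `O(n ^ τ)` steps, with words of `O(log n)` bits.  The program finds `n` in index
register `0` and the factors, row by row, in the real arrays `0` and `1`; it leaves the product in
the real array `2`.  Nothing is assumed about the other cells of the initial memory. -/
def IsMatMulExponent (τ : ℝ) : Prop :=
  ∃ (P : Cmd) (c C : ℕ), ∀ (n : ℕ), 1 ≤ n → ∀ (A B : Matrix (Fin n) (Fin n) ℝ) (σ : Mem),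
    σ.ireg 0 = n →
    (∀ i j : Fin n, σ.rarr 0 (i * n + j) = A i j) →
    (∀ i j : Fin n, σ.rarr 1 (i * n + j) = B i j) →
    ∃ (σ' : Mem) (t : ℕ), Exec ((n + 2) ^ c) P σ σ' t ∧
      (∀ i j : Fin n, σ'.rarr 2 (i * n + j) = (A * B) i j) ∧
      (t : ℝ) ≤ C * (n : ℝ) ^ τ

/-- The exponent `ω` of fast matrix multiplication. -/
noncomputable def omega : ℝ := sInf {τ : ℝ | IsMatMulExponent τ}

end RealRAM

/-! ## Weighted directed graphs, shortest paths and their trees -/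

/-- A directed graph with vertices `0, …, n - 1`, with `m` edges (no two of them with the same tail
and the same head) and with real edge weights. -/
structure WDigraph (n m : ℕ) : Type where
  src : Fin m → Fin n
  tgt : Fin m → Fin n
  weight : Fin m → ℝ
  simple : Function.Injective fun e => (src e, tgt e)

namespace WDigraph

variable {n m : ℕ}

/-- There is an edge from `u` to `v`: `u` is a direct ancestor of `v`. -/
def Adj (G : WDigraph n m) (u v : Fin n) : Prop :=
  ∃ e, G.src e = u ∧ G.tgt e = v

/-- `u` is an ancestor of `v`: a directed path with at least one edge leads from `u` to `v`. -/
def Ancestor (G : WDigraph n m) (u v : Fin n) : Prop :=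
  Relation.TransGen G.Adj u v

/-- The graph has no directed cycle. -/
def IsAcyclic (G : WDigraph n m) : Prop :=
  ∀ v, ¬ G.Ancestor v v

/-- A source is a vertex without incoming edges. -/
def IsSource (G : WDigraph n m) (v : Fin n) : Prop :=
  ∀ e, G.tgt e ≠ v

/-- The number of edges into `v`. -/
def indeg (G : WDigraph n m) (v : Fin n) : ℕ :=
  (Finset.univ.filter fun e => G.tgt e = v).card

/-- Directed paths from `u` to `v`, extended at their last vertex. -/
inductive DiPath (G : WDigraph n m) (u : Fin n) : Fin n → Type
  | nil : DiPath G u u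
  | snoc {v w : Fin n} (p : DiPath G u v) (e : Fin m) (hs : G.src e = v) (ht : G.tgt e = w) :
      DiPath G u w

namespace DiPath

variable {G : WDigraph n m} {u v : Fin n}

/-- The length of a path is the sum of the weights of its edges. -/
def length {u : Fin n} : {v : Fin n} → DiPath G u v → ℝ
  | _, nil => 0
  | _, snoc p e _ _ => p.length + G.weight e

/-- The edges of a path. -/
def edges {u : Fin n} : {v : Fin n} → DiPath G u v → Set (Fin m)
  | _, nil => ∅
  | _, snoc p e _ _ => insert e p.edges

/-- The vertices of a path. -/
def vertices {u : Fin n} : {v : Fin n} → DiPath G u v → Set (Fin n)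
  | _, nil => {u}
  | w, snoc p _ _ _ => insert w p.vertices

/-- A path is shortest if no path with the same endpoints has smaller length. -/
def IsShortest (p : DiPath G u v) : Prop :=
  ∀ q : DiPath G u v, p.length ≤ q.length

/-- The path is the lexicographically-first shortest path between its endpoints, for the numbering
`π` of the vertices: it is a shortest path, its last but one vertex has the lowest number among the
last but one vertices of all shortest paths with the same endpoints, and its part up to that
vertex is again a lexicographically-first shortest path. -/
def IsLexFirst (π : Fin n ≃ Fin n) {u : Fin n} : {v : Fin n} → DiPath G u v → Prop
  | _, nil => (nil : DiPath G u u).IsShortest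
  | w, snoc p e hs ht =>
      (snoc p e hs ht).IsShortest ∧
      (∀ (x : Fin n) (q : DiPath G u x) (f : Fin m) (hs' : G.src f = x) (ht' : G.tgt f = w),
        (snoc q f hs' ht').IsShortest → π (G.src e) ≤ π (G.src f)) ∧
      p.IsLexFirst π

end DiPath

/-- The edges of the tree `T_v`, the union of the lexicographically-first shortest paths to `v`. -/
def treeEdges (G : WDigraph n m) (π : Fin n ≃ Fin n) (v : Fin n) : Set (Fin m) :=
  {e | ∃ (u : Fin n) (p : DiPath G u v), p.IsLexFirst π ∧ e ∈ p.edges}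

/-- The vertices of the tree `T_v`. -/
def treeVertices (G : WDigraph n m) (π : Fin n ≃ Fin n) (v : Fin n) : Set (Fin n) :=
  {x | ∃ (u : Fin n) (p : DiPath G u v), p.IsLexFirst π ∧ x ∈ p.vertices}

/-- The leaves of `T_v`.  The edges of the tree lead towards the root `v`, so the leaves are the
vertices of the tree into which no edge of the tree leads. -/
def leaves (G : WDigraph n m) (π : Fin n ≃ Fin n) (v : Fin n) : Set (Fin n) :=
  {x | x ∈ G.treeVertices π v ∧ ∀ e ∈ G.treeEdges π v, G.tgt e ≠ x}

/-- `∑ v, indeg(v) * |leaf(T_v)|`. -/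
noncomputable def leafSum (G : WDigraph n m) (π : Fin n ≃ Fin n) : ℕ :=
  ∑ v, G.indeg v * (G.leaves π v).ncard

/-- A numbering of the vertices that extends the topological partial order and gives the lowest
numbers to the sources. -/
structure IsNumbering (G : WDigraph n m) (π : Fin n ≃ Fin n) : Prop where
  topological : ∀ u v, G.Adj u v → π u < π v
  sources_first : ∀ u v, G.IsSource u → ¬ G.IsSource v → π u < π v

end WDigraph

/-! ## The algorithm

In memory the vertex `u` is represented by its name `u` in the input, and by its number `π u + 1`,
in the range `1, …, n`, in all other tables.  The number `0` stands for an empty entry.  The entry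
with indices `i` and `k` of a two-dimensional table is cell `i * (n + 1) + k` of an array. -/

namespace APSP

open RealRAM

/- Index registers. -/
abbrev rN : ℕ := 0
abbrev rM : ℕ := 1
abbrev rR : ℕ := 2
abbrev rI : ℕ := 3
abbrev rK : ℕ := 4
abbrev rJ : ℕ := 5
abbrev rT : ℕ := 6
abbrev rS : ℕ := 7
abbrev rQ : ℕ := 8
abbrev rCur : ℕ := 9

/- Real registers. -/
abbrev rX : ℕ := 0
abbrev rBest : ℕ := 1
abbrev rW : ℕ := 2

/- Index arrays. -/
abbrev aSrc : ℕ := 0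
abbrev aTgt : ℕ := 1
abbrev aNum : ℕ := 2
abbrev aInDeg : ℕ := 3
abbrev aInTail : ℕ := 4
abbrev aAncCount : ℕ := 5
abbrev aAnc : ℕ := 6
abbrev aNext : ℕ := 7
abbrev aFinite : ℕ := 8

/- Real arrays. -/
abbrev aWeight : ℕ := 0
abbrev aInWeight : ℕ := 1
abbrev aDist : ℕ := 2

/-- The address of the entry `(i, k)` of a two-dimensional table. -/
def cell (n i k : ℕ) : ℕ := i * (n + 1) + k

/-- The expression for the address of the entry `(i, k)` of a two-dimensional table. -/
def cellE (i k : IExp) : IExp :=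
  .add (.mul i (.add (.reg rN) (.const 1))) k

/-- Increment an index register. -/
def incr (x : ℕ) : Cmd := .iset x (.add (.reg x) (.const 1))

/-- The test `e ≤ f`. -/
def ile (e f : IExp) : BExp := .not (.ilt f e)

/-- Initialize the table of distances: `dist(u, u) = 0`, and `dist(u, v) = ∞` for `u ≠ v`.
A distance is finite if the entry in the array `aFinite` is `1`, and is then found in the
array `aDist`; it is infinite if that entry is `0`. -/
def initDist : Cmd :=
  block [
    .iset rI (.const 1),
    .while (ile (.reg rI) (.reg rN)) (block [
      .iset rK (.const 1),
      .while (ile (.reg rK) (.reg rN)) (block [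
        .istore aFinite (cellE (.reg rI) (.reg rK)) (.const 0),
        incr rK]),
      .istore aFinite (cellE (.reg rI) (.reg rI)) (.const 1),
      .rstore aDist (cellE (.reg rI) (.reg rI)) (.const 0),
      incr rI])]

/-- Set `NEXT_i(k)` to `0` for all ancestors `k` of the vertex `i`. -/
def initNext : Cmd :=
  block [
    .iset rT (.const 1),
    .while (ile (.reg rT) (.arr aAncCount (.reg rI))) (block [
      .istore aNext (cellE (.reg rI) (.arr aAnc (cellE (.reg rI) (.reg rT)))) (.const 0),
      incr rT])]

/-- Determine the direct ancestor `j` of the vertex `i` that minimizes `dist(k, j) + weight(j, i)`,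
the smallest one in case of ties; put `weight(j, i)` into the register `rW`. -/
def chooseLast : Cmd :=
  block [
    .iset rJ (.const 0),
    .iset rS (.const 1),
    .while (ile (.reg rS) (.arr aInDeg (.reg rI))) (block [
      .iset rQ (.arr aInTail (cellE (.reg rI) (.reg rS))),
      .ite (.ieq (.arr aFinite (cellE (.reg rK) (.reg rQ))) (.const 1))
        (block [
          .rset rX (.add (.arr aDist (cellE (.reg rK) (.reg rQ)))
            (.arr aInWeight (cellE (.reg rI) (.reg rS)))),
          .ite (.or (.ieq (.reg rJ) (.const 0))
                (.or (.rlt (.reg rX) (.reg rBest))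
                  (.and (.req (.reg rX) (.reg rBest)) (.ilt (.reg rQ) (.reg rJ)))))
            (block [
              .iset rJ (.reg rQ),
              .rset rBest (.reg rX),
              .rset rW (.arr aInWeight (cellE (.reg rI) (.reg rS)))])
            .skip])
        .skip,
      incr rS])]

/-- Follow the path from `k` to `j` in the tree of `j`, and add it to the tree of `i` until a vertex
of that tree or `j` is met; then add the edge from `j` to `i` if it is missing. -/
def addPath : Cmd :=
  block [
    .iset rCur (.reg rK),
    .while (.and (.not (.ieq (.reg rCur) (.reg rJ)))
        (.ieq (.arr aNext (cellE (.reg rI) (.reg rCur))) (.const 0))) (block [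
      .rstore aDist (cellE (.reg rCur) (.reg rI))
        (.add (.arr aDist (cellE (.reg rCur) (.reg rJ))) (.reg rW)),
      .istore aFinite (cellE (.reg rCur) (.reg rI)) (.const 1),
      .istore aNext (cellE (.reg rI) (.reg rCur)) (.arr aNext (cellE (.reg rJ) (.reg rCur))),
      .iset rCur (.arr aNext (cellE (.reg rI) (.reg rCur)))]),
    .ite (.ieq (.arr aNext (cellE (.reg rI) (.reg rJ))) (.const 0))
      (block [
        .rstore aDist (cellE (.reg rJ) (.reg rI)) (.reg rW),
        .istore aFinite (cellE (.reg rJ) (.reg rI)) (.const 1),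
        .istore aNext (cellE (.reg rI) (.reg rJ)) (.reg rI)])
      .skip]

/-- The main loop, over the vertices `i` that are not sources and, for each of them, over its
ancestors `k` in increasing order. -/
def mainLoop : Cmd :=
  block [
    .iset rI (.add (.reg rR) (.const 1)),
    .while (ile (.reg rI) (.reg rN)) (block [
      initNext,
      .iset rT (.const 1),
      .while (ile (.reg rT) (.arr aAncCount (.reg rI))) (block [
        .iset rK (.arr aAnc (cellE (.reg rI) (.reg rT))),
        .ite (.ieq (.arr aNext (cellE (.reg rI) (.reg rK))) (.const 0))
          (block [chooseLast, addPath])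
          .skip,
        incr rT]),
      incr rI])]

/-- The algorithm after the numbering of the vertices.  The program `ancestors` computes the sets of
ancestors of all vertices. -/
def afterNumbering (ancestors : Cmd) : Cmd :=
  block [ancestors, initDist, mainLoop]

/-- The whole algorithm.  The program `numbering` sorts the vertices topologically. -/
def algorithm (numbering ancestors : Cmd) : Cmd :=
  block [numbering, afterNumbering ancestors]

variable {n m : ℕ}

/-- The memory holds the input, as a list of edges in arbitrary order.  Nothing is assumed about the
other cells. -/
structure Loaded (G : WDigraph n m) (σ : Mem) : Prop where
  n_eq : σ.ireg rN = n
  m_eq : σ.ireg rM = m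
  src_eq : ∀ e : Fin m, σ.iarr aSrc e = G.src e
  tgt_eq : ∀ e : Fin m, σ.iarr aTgt e = G.tgt e
  weight_eq : ∀ e : Fin m, σ.rarr aWeight e = G.weight e

/-- The memory holds the input, the numbering `π`, the number of sources and, for every vertex `v`,
the list of the edges into `v`, in some order. -/
structure Numbered (G : WDigraph n m) (π : Fin n ≃ Fin n) (σ : Mem) : Prop where
  loaded : Loaded G σ
  num_eq : ∀ u : Fin n, σ.iarr aNum u = π u + 1
  sources_eq : σ.ireg rR = {v | G.IsSource v}.ncard
  inEdges_eq : ∀ v : Fin n, ∃ (d : ℕ) (f : Fin d → Fin m),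
    Function.Injective f ∧ Set.range f = {e | G.tgt e = v} ∧
    σ.iarr aInDeg (π v + 1) = d ∧
    (∀ s : Fin d, σ.iarr aInTail (cell n (π v + 1) (s + 1)) = π (G.src (f s)) + 1) ∧
    (∀ s : Fin d, σ.rarr aInWeight (cell n (π v + 1) (s + 1)) = G.weight (f s))

/-- The memory holds in addition, for every vertex `v`, the list of the ancestors of `v`, in
increasing order of their numbers. -/
structure AncestorsListed (G : WDigraph n m) (π : Fin n ≃ Fin n) (σ : Mem) : Prop where
  numbered : Numbered G π σ
  anc_eq : ∀ v : Fin n, ∃ (a : ℕ) (f : Fin a → Fin n),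
    StrictMono (fun s => π (f s)) ∧ Set.range f = {u | G.Ancestor u v} ∧
    σ.iarr aAncCount (π v + 1) = a ∧
    (∀ s : Fin a, σ.iarr aAnc (cell n (π v + 1) (s + 1)) = π (f s) + 1)

/-- The memory holds the output: the numbering `π`, the distances of all pairs of vertices, and the
trees `T_v`.  For every ancestor `u` of `v` there is exactly one edge of `T_v` with tail `u`, and
`NEXT_v(u)` is the head of that edge. -/
structure Output (G : WDigraph n m) (π : Fin n ≃ Fin n) (σ : Mem) : Prop where
  num_eq : ∀ u : Fin n, σ.iarr aNum u = π u + 1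
  dist_finite : ∀ u v : Fin n, u = v ∨ G.Ancestor u v →
    σ.iarr aFinite (cell n (π u + 1) (π v + 1)) = 1 ∧
    ∃ p : G.DiPath u v, p.IsShortest ∧ p.IsLexFirst π ∧
      σ.rarr aDist (cell n (π u + 1) (π v + 1)) = p.length
  dist_infinite : ∀ u v : Fin n, ¬ (u = v ∨ G.Ancestor u v) →
    σ.iarr aFinite (cell n (π u + 1) (π v + 1)) = 0
  next_eq : ∀ u v : Fin n, G.Ancestor u v →
    ∃ e : Fin m, (∀ f : Fin m, f ∈ G.treeEdges π v ∧ G.src f = u ↔ f = e) ∧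
      σ.iarr aNext (cell n (π v + 1) (π u + 1)) = π (G.tgt e) + 1

/-- `1 + min {n ^ τ, n * m + n ^ 2 * log n} + ∑ v, indeg(v) * |leaf(T_v)|`. -/
noncomputable def timeBound (G : WDigraph n m) (π : Fin n ≃ Fin n) (τ : ℝ) : ℝ :=
  1 + min ((n : ℝ) ^ τ) ((n : ℝ) * m + (n : ℝ) ^ 2 * Real.log n) + (G.leafSum π : ℝ)

end APSP

/-! ## Reasoning about programs -/

namespace RealRAM

/-! Correctness. In an acyclic graph every ancestor `u` of `v` has exactly one
lexicographically-first shortest path to `v` (`exists_isLexFirst`, `isLexFirst_unique`). A final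
part of such a path is again such a path (`of_comp`), because a better final part would improve the
whole. So the paths to `v` fit together into a tree, in which the edge out of `u` is the first edge
of the path from `u` (`mem_treeEdges_iff`). By definition, the part of the path before its last edge
belongs to the tree of the last but one vertex. When the vertices are treated in topological order,
that tree is already complete. It therefore suffices to choose the last edge by least length and
then least number of its tail (`snoc_isLexFirst`, `runs_chooseLast`) and to copy successors from the
tree of its tail, until a vertex is met that has been entered before (`runs_addPath`).

Running time. The search for a last edge into `v` costs a multiple of `indeg v` plus a constant and
is made only for ancestors `k` that are not yet in the tree. Such a `k` is a leaf of `T_v`: a tree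
edge into `k` would start at an ancestor with a lower number, which has already been treated; its
successor `k` would have been entered together with it. This yields the sum over `indeg v * |leaf
(T_v)|` (`runs_treeLoop`). All copying steps together are paid for by the entries of the tables, of
which there are at most `n ^ 2`. A term `n ^ 2` is absorbed by the bound: an exponent of matrix
multiplication is at least `2`, since a program writes at most one cell per step
(`IsMatMulExponent.two_le`), and `n ^ 2` is at most twice `1 + n ^ 2 * log n`.

Ancestors. Ordered topologically, the relation of adjacency is strictly upper triangular. The
closure of a diagonal block consisting of two halves with closures `A` and `D`, and with the edges
`B` between them, has `A * B * D` in its upper corner, because a path crosses the border exactly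
once (`exists_crossing`, `Merged.step`). Merging blocks of size `1`, `2`, `4`, … costs a geometric
series, dominated by its last term (`runs_closure`). Positive reals stand for true, so that real
matrix products compute the closure. To obtain the minimum of two bounds, the closure program is run
with `n * (n + m) + 1` units of fuel (`Exec.limit`); if they do not suffice, the closure is computed
again column by column in `O(n * (n + m))` steps up to an additive constant (`runs_propagate`). The
program for multiplication is arbitrary, hence it is moved to another part of the memory
(`Exec.shift`). An exponent `τ > ω` is reduced to an actual exponent below it
(`exists_isMatMulExponent_le`). -/

@[simp] theorem Mem.setIReg_ireg (σ : Mem) (x v y : ℕ) :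
    (σ.setIReg x v).ireg y = if y = x then v else σ.ireg y := by
  simp [Mem.setIReg, Function.update_apply]
@[simp] theorem Mem.setIReg_rreg (σ : Mem) (x v : ℕ) : (σ.setIReg x v).rreg = σ.rreg := rfl
@[simp] theorem Mem.setIReg_iarr (σ : Mem) (x v : ℕ) : (σ.setIReg x v).iarr = σ.iarr := rfl
@[simp] theorem Mem.setIReg_rarr (σ : Mem) (x v : ℕ) : (σ.setIReg x v).rarr = σ.rarr := rfl
@[simp] theorem Mem.setRReg_rreg (σ : Mem) (x : ℕ) (v : ℝ) (y : ℕ) :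
    (σ.setRReg x v).rreg y = if y = x then v else σ.rreg y := by
  simp [Mem.setRReg, Function.update_apply]
@[simp] theorem Mem.setRReg_ireg (σ : Mem) (x : ℕ) (v : ℝ) : (σ.setRReg x v).ireg = σ.ireg := rfl
@[simp] theorem Mem.setRReg_iarr (σ : Mem) (x : ℕ) (v : ℝ) : (σ.setRReg x v).iarr = σ.iarr := rfl
@[simp] theorem Mem.setRReg_rarr (σ : Mem) (x : ℕ) (v : ℝ) : (σ.setRReg x v).rarr = σ.rarr := rfl
@[simp] theorem Mem.setIArr_iarr (σ : Mem) (a i v b j : ℕ) :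
    (σ.setIArr a i v).iarr b j = if b = a ∧ j = i then v else σ.iarr b j := by
  by_cases h : b = a
  · subst h; simp [Mem.setIArr, Function.update_apply]
  · simp [Mem.setIArr, h]
@[simp] theorem Mem.setIArr_ireg (σ : Mem) (a i v : ℕ) : (σ.setIArr a i v).ireg = σ.ireg := rfl
@[simp] theorem Mem.setIArr_rreg (σ : Mem) (a i v : ℕ) : (σ.setIArr a i v).rreg = σ.rreg := rfl
@[simp] theorem Mem.setIArr_rarr (σ : Mem) (a i v : ℕ) : (σ.setIArr a i v).rarr = σ.rarr := rfl
@[simp] theorem Mem.setRArr_rarr (σ : Mem) (a i : ℕ) (v : ℝ) (b j : ℕ) :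
    (σ.setRArr a i v).rarr b j = if b = a ∧ j = i then v else σ.rarr b j := by
  by_cases h : b = a
  · subst h; simp [Mem.setRArr, Function.update_apply]
  · simp [Mem.setRArr, h]
@[simp] theorem Mem.setRArr_ireg (σ : Mem) (a i : ℕ) (v : ℝ) :
    (σ.setRArr a i v).ireg = σ.ireg := rfl
@[simp] theorem Mem.setRArr_rreg (σ : Mem) (a i : ℕ) (v : ℝ) :
    (σ.setRArr a i v).rreg = σ.rreg := rfl
@[simp] theorem Mem.setRArr_iarr (σ : Mem) (a i : ℕ) (v : ℝ) :
    (σ.setRArr a i v).iarr = σ.iarr := rfl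

attribute [simp] IExp.eval IExp.Fits IExp.cost RExp.eval RExp.Fits RExp.cost BExp.Holds BExp.Fits
  BExp.cost

/-! ### The cells a program may write -/

/-- The registers and arrays of the machine. -/
inductive Loc : Type
  | ireg (x : ℕ)
  | rreg (x : ℕ)
  | iarr (a : ℕ)
  | rarr (a : ℕ)
  deriving DecidableEq

/-- Two memories agree in a register or in a whole array. -/
def Same (σ τ : Mem) : Loc → Prop
  | .ireg x => τ.ireg x = σ.ireg x
  | .rreg x => τ.rreg x = σ.rreg x
  | .iarr a => τ.iarr a = σ.iarr a
  | .rarr a => τ.rarr a = σ.rarr a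

theorem Same.refl (σ : Mem) (l : Loc) : Same σ σ l := by cases l <;> rfl

theorem Same.trans {σ τ ρ : Mem} {l : Loc} (h : Same σ τ l) (h' : Same τ ρ l) : Same σ ρ l := by
  cases l <;> simp only [Same] at * <;> simp [*]

/-- Does the program contain an assignment to the given register or array? -/
def Cmd.writes : Cmd → Loc → Bool
  | .skip, _ => false
  | .iset x _, l => decide (l = .ireg x)
  | .rset x _, l => decide (l = .rreg x)
  | .istore a _ _, l => decide (l = .iarr a)
  | .rstore a _ _, l => decide (l = .rarr a)
  | .seq c d, l => c.writes l || d.writes l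
  | .ite _ c d, l => c.writes l || d.writes l
  | .while _ c, l => c.writes l

/-- Two memories agree outside the cells that the program may write. -/
def Cmd.Frame (c : Cmd) (σ τ : Mem) : Prop := ∀ l, c.writes l = false → Same σ τ l

theorem Cmd.Frame.refl (c : Cmd) (σ : Mem) : c.Frame σ σ := fun _ _ => Same.refl _ _

theorem Cmd.Frame.trans {c : Cmd} {σ τ ρ : Mem} (h : c.Frame σ τ) (h' : c.Frame τ ρ) :
    c.Frame σ ρ := fun l hl => (h l hl).trans (h' l hl)

theorem Cmd.Frame.ireg {c : Cmd} {σ τ : Mem} (h : c.Frame σ τ) (x : ℕ)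
    (hx : c.writes (.ireg x) = false) : τ.ireg x = σ.ireg x := h _ hx
theorem Cmd.Frame.rreg {c : Cmd} {σ τ : Mem} (h : c.Frame σ τ) (x : ℕ)
    (hx : c.writes (.rreg x) = false) : τ.rreg x = σ.rreg x := h _ hx
theorem Cmd.Frame.iarr {c : Cmd} {σ τ : Mem} (h : c.Frame σ τ) (x : ℕ)
    (hx : c.writes (.iarr x) = false) : τ.iarr x = σ.iarr x := h _ hx
theorem Cmd.Frame.rarr {c : Cmd} {σ τ : Mem} (h : c.Frame σ τ) (x : ℕ)
    (hx : c.writes (.rarr x) = false) : τ.rarr x = σ.rarr x := h _ hx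

/-- Loop invariants need not list what a loop leaves alone: for a concrete program `writes`
evaluates, and a fact about an unchanged register or array is then closed by `rfl`. -/
theorem Exec.frame {W : ℕ} {c : Cmd} {σ τ : Mem} {t : ℕ} (h : Exec W c σ τ t) : c.Frame σ τ := by
  induction h with
  | skip => exact Cmd.Frame.refl _ _
  | iset σ x e he =>
    intro l hl
    cases l <;> simp_all [Cmd.writes, Same]
  | rset σ x e he =>
    intro l hl
    cases l <;> simp_all [Cmd.writes, Same]
  | istore σ a i e hi he =>
    intro l hl
    cases l <;> simp_all [Cmd.writes, Same]
    funext j; simp [hl]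
  | rstore σ a i e hi he =>
    intro l hl
    cases l <;> simp_all [Cmd.writes, Same]
    funext j; simp [hl]
  | seq _ _ h1 h2 =>
    intro l hl
    simp only [Cmd.writes, Bool.or_eq_false_iff] at hl
    exact (h1 l hl.1).trans (h2 l hl.2)
  | iteTrue _ _ _ h1 =>
    intro l hl
    simp only [Cmd.writes, Bool.or_eq_false_iff] at hl
    exact h1 l hl.1
  | iteFalse _ _ _ h1 =>
    intro l hl
    simp only [Cmd.writes, Bool.or_eq_false_iff] at hl
    exact h1 l hl.2
  | whileTrue _ _ _ _ h1 h2 => exact fun l hl => (h1 l hl).trans (h2 l hl)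
  | whileFalse _ _ => exact Cmd.Frame.refl _ _

/-! ### Larger word bounds -/

theorem IExp.Fits.mono {W W' : ℕ} (hW : W ≤ W') {σ : Mem} {e : IExp} (h : e.Fits W σ) :
    e.Fits W' σ := by
  induction e with
  | const | reg => trivial
  | arr a i ih => exact ih h
  | add e f ihe ihf => exact ⟨ihe h.1, ihf h.2.1, h.2.2.trans_le hW⟩
  | sub e f ihe ihf => exact ⟨ihe h.1, ihf h.2⟩
  | mul e f ihe ihf => exact ⟨ihe h.1, ihf h.2.1, h.2.2.trans_le hW⟩
  | div e f ihe ihf => exact ⟨ihe h.1, ihf h.2⟩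

theorem RExp.Fits.mono {W W' : ℕ} (hW : W ≤ W') {σ : Mem} {e : RExp} (h : e.Fits W σ) :
    e.Fits W' σ := by
  induction e with
  | const | reg => trivial
  | arr a i => exact IExp.Fits.mono hW h
  | add e f ihe ihf | sub e f ihe ihf | mul e f ihe ihf | div e f ihe ihf =>
    exact ⟨ihe h.1, ihf h.2⟩

theorem BExp.Fits.mono {W W' : ℕ} (hW : W ≤ W') {σ : Mem} {e : BExp} (h : e.Fits W σ) :
    e.Fits W' σ := by
  induction e with
  | ieq e f | ilt e f => exact ⟨h.1.mono hW, h.2.mono hW⟩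
  | req e f | rlt e f => exact ⟨h.1.mono hW, h.2.mono hW⟩
  | not b ih => exact ih h
  | and b c ihb ihc | or b c ihb ihc => exact ⟨ihb h.1, ihc h.2⟩

/-- The word bound enters only through upper bounds in `Fits`. This is needed because the
multiplication program is specified for the bound that belongs to the size of its own factors, and
runs inside a program with a larger bound. -/
theorem Exec.mono {W W' : ℕ} (hW : W ≤ W') {c : Cmd} {σ τ : Mem} {t : ℕ} (h : Exec W c σ τ t) :
    Exec W' c σ τ t := by
  induction h with
  | skip => exact .skip _
  | iset σ x e he => exact .iset _ _ _ (he.mono hW)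
  | rset σ x e he => exact .rset _ _ _ (he.mono hW)
  | istore σ a i e hi he => exact .istore _ _ _ _ (hi.mono hW) (he.mono hW)
  | rstore σ a i e hi he => exact .rstore _ _ _ _ (hi.mono hW) (he.mono hW)
  | seq _ _ h1 h2 => exact .seq h1 h2
  | iteTrue hf hb _ h1 => exact .iteTrue (hf.mono hW) hb h1
  | iteFalse hf hb _ h1 => exact .iteFalse (hf.mono hW) hb h1
  | whileTrue hf hb _ _ h1 h2 => exact .whileTrue (hf.mono hW) hb h1 h2
  | whileFalse hf hb => exact .whileFalse (hf.mono hW) hb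

/-! ### Total correctness with running times -/

/-- The program halts without an overflow, and its final memory and its running time satisfy `Q`. -/
def Runs (W : ℕ) (c : Cmd) (σ : Mem) (Q : Mem → ℕ → Prop) : Prop :=
  ∃ τ t, Exec W c σ τ t ∧ Q τ t

section Rules

variable {W : ℕ} {σ : Mem} {Q : Mem → ℕ → Prop}

/-- The frame is supplied along with the postcondition, so that specifications only have to speak of
the cells that change. -/
theorem Runs.imp {c : Cmd} {Q' : Mem → ℕ → Prop} (h : Runs W c σ Q)
    (hQ : ∀ τ t, c.Frame σ τ → Q τ t → Q' τ t) : Runs W c σ Q' := by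
  obtain ⟨τ, t, he, hq⟩ := h
  exact ⟨τ, t, he, hQ τ t he.frame hq⟩

theorem Runs.mono {W' : ℕ} {c : Cmd} (h : Runs W c σ Q) (hW : W ≤ W') : Runs W' c σ Q := by
  obtain ⟨τ, t, he, hq⟩ := h
  exact ⟨τ, t, he.mono hW, hq⟩

theorem runs_skip : Runs W .skip σ Q ↔ Q σ 1 :=
  ⟨by rintro ⟨_, _, ⟨⟩, h⟩; exact h, fun h => ⟨_, _, .skip _, h⟩⟩

theorem runs_iset {x : ℕ} {e : IExp} :
    Runs W (.iset x e) σ Q ↔ e.Fits W σ ∧ Q (σ.setIReg x (e.eval σ)) (e.cost + 1) :=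
  ⟨by rintro ⟨_, _, ⟨⟩, h⟩; exact ⟨‹_›, h⟩, fun h => ⟨_, _, .iset _ _ _ h.1, h.2⟩⟩

theorem runs_rset {x : ℕ} {e : RExp} :
    Runs W (.rset x e) σ Q ↔ e.Fits W σ ∧ Q (σ.setRReg x (e.eval σ)) (e.cost + 1) :=
  ⟨by rintro ⟨_, _, ⟨⟩, h⟩; exact ⟨‹_›, h⟩, fun h => ⟨_, _, .rset _ _ _ h.1, h.2⟩⟩

theorem runs_istore {a : ℕ} {i e : IExp} :
    Runs W (.istore a i e) σ Q ↔ i.Fits W σ ∧ e.Fits W σ ∧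
      Q (σ.setIArr a (i.eval σ) (e.eval σ)) (i.cost + e.cost + 1) :=
  ⟨by rintro ⟨_, _, ⟨⟩, h⟩; exact ⟨‹_›, ‹_›, h⟩, fun h => ⟨_, _, .istore _ _ _ _ h.1 h.2.1, h.2.2⟩⟩

theorem runs_rstore {a : ℕ} {i : IExp} {e : RExp} :
    Runs W (.rstore a i e) σ Q ↔ i.Fits W σ ∧ e.Fits W σ ∧
      Q (σ.setRArr a (i.eval σ) (e.eval σ)) (i.cost + e.cost + 1) :=
  ⟨by rintro ⟨_, _, ⟨⟩, h⟩; exact ⟨‹_›, ‹_›, h⟩, fun h => ⟨_, _, .rstore _ _ _ _ h.1 h.2.1, h.2.2⟩⟩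

theorem runs_seq {c d : Cmd} :
    Runs W (.seq c d) σ Q ↔ Runs W c σ fun τ s => Runs W d τ fun ρ t => Q ρ (s + t) := by
  constructor
  · rintro ⟨_, _, ⟨⟩, h⟩
    exact ⟨_, _, ‹_›, _, _, ‹_›, h⟩
  · rintro ⟨_, _, h1, _, _, h2, h⟩
    exact ⟨_, _, .seq h1 h2, h⟩

theorem runs_ite {b : BExp} {c d : Cmd} :
    Runs W (.ite b c d) σ Q ↔ b.Fits W σ ∧
      (b.Holds σ → Runs W c σ fun τ t => Q τ (b.cost + 1 + t)) ∧
      (¬ b.Holds σ → Runs W d σ fun τ t => Q τ (b.cost + 1 + t)) := by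
  constructor
  · rintro ⟨_, _, h, hq⟩
    cases h with
    | iteTrue hf hb hc => exact ⟨hf, fun _ => ⟨_, _, hc, hq⟩, fun h => absurd hb h⟩
    | iteFalse hf hb hc => exact ⟨hf, fun h => absurd h hb, fun _ => ⟨_, _, hc, hq⟩⟩
  · rintro ⟨hf, h1, h2⟩
    by_cases hb : b.Holds σ
    · obtain ⟨_, _, h, hq⟩ := h1 hb
      exact ⟨_, _, .iteTrue hf hb h, hq⟩
    · obtain ⟨_, _, h, hq⟩ := h2 hb
      exact ⟨_, _, .iteFalse hf hb h, hq⟩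

/-- An invariant of a loop speaks about the memory and the time elapsed since the loop was
entered.  A bound on that time makes the loop terminate. -/
theorem runs_while {b : BExp} {c : Cmd} (I : Mem → ℕ → Prop) (T : ℕ)
    (h0 : I σ 0) (hT : ∀ τ t, I τ t → t ≤ T)
    (hstep : ∀ τ t, c.Frame σ τ → I τ t → b.Fits W τ ∧
      (b.Holds τ → Runs W c τ fun ρ s => I ρ (t + (b.cost + 1 + s))) ∧
      (¬ b.Holds τ → Q τ (t + (b.cost + 1)))) :
    Runs W (.while b c) σ Q := by
  -- Here `k` bounds the number of remaining rounds: each round takes at least one step, while the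
  -- elapsed time never exceeds `T`.
  have key : ∀ k τ t, T < t + k → c.Frame σ τ → I τ t →
      Runs W (.while b c) τ fun ρ s => Q ρ (t + s) := by
    intro k
    induction k with
    | zero =>
      intro τ t hk _ hI
      have := hT τ t hI
      omega
    | succ k ih =>
      intro τ t hk hF hI
      obtain ⟨hf, h1, h2⟩ := hstep τ t hF hI
      by_cases hb : b.Holds τ
      · obtain ⟨ρ, s, he, hI'⟩ := h1 hb
        obtain ⟨ρ', s', he', hq⟩ := ih ρ _ (by omega) (hF.trans he.frame) hI'
        exact ⟨ρ', _, .whileTrue hf hb he he', by convert hq using 1; omega⟩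
      · exact ⟨τ, _, .whileFalse hf hb, h2 hb⟩
  have := key (T + 1) σ 0 (by omega) (Cmd.Frame.refl _ _) h0
  simpa using this

/-- A loop that counts an index register up to a fixed bound.  The invariant `J` depends on the
counter. -/
theorem runs_count {b : BExp} {c : Cmd} (x : ℕ) (lo hi : ℕ) (J : ℕ → Mem → ℕ → Prop)
    (hlo : lo ≤ hi) (hx : σ.ireg x = lo) (h0 : J lo σ 0)
    (hb : ∀ i τ t, lo ≤ i → i ≤ hi → c.Frame σ τ → τ.ireg x = i → J i τ t →
      b.Fits W τ ∧ (b.Holds τ ↔ i < hi))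
    (hstep : ∀ i τ t, lo ≤ i → i < hi → c.Frame σ τ → τ.ireg x = i → J i τ t →
      Runs W c τ fun ρ s => ρ.ireg x = i + 1 ∧ J (i + 1) ρ (t + (b.cost + 1 + s)))
    (hQ : ∀ τ t, c.Frame σ τ → τ.ireg x = hi → J hi τ t → Q τ (t + (b.cost + 1))) :
    Runs W (.while b c) σ Q := by
  have key : ∀ k i τ t, i + k = hi → lo ≤ i → c.Frame σ τ → τ.ireg x = i → J i τ t →
      Runs W (.while b c) τ fun ρ s => Q ρ (t + s) := by
    intro k
    induction k with
    | zero =>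
      intro i τ t hk hl hF hi' hJ
      obtain rfl : i = hi := by omega
      obtain ⟨hf, hh⟩ := hb _ τ t hl le_rfl hF hi' hJ
      exact ⟨τ, _, .whileFalse hf (by simp [hh]), hQ τ t hF hi' hJ⟩
    | succ k ih =>
      intro i τ t hk hl hF hi' hJ
      obtain ⟨hf, hh⟩ := hb i τ t hl (by omega) hF hi' hJ
      obtain ⟨ρ, s, he, hx', hJ'⟩ := hstep i τ t hl (by omega) hF hi' hJ
      obtain ⟨ρ', s', he', hq⟩ := ih (i + 1) ρ _ (by omega) (by omega) (hF.trans he.frame) hx' hJ'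
      exact ⟨ρ', _, .whileTrue hf (hh.2 (by omega)) he he', by convert hq using 1; omega⟩
  obtain ⟨k, rfl⟩ := Nat.exists_eq_add_of_le hlo
  have := key k lo σ 0 rfl le_rfl (Cmd.Frame.refl _ _) hx h0
  simpa using this

/-- A loop that counts an index register up to and including the value of an expression. -/
theorem runs_upto {c : Cmd} {e : IExp} (x lo N : ℕ) (J : ℕ → Mem → ℕ → Prop) (hlo : lo ≤ N + 1)
    (hx : σ.ireg x = lo) (h0 : J lo σ 0)
    (he : ∀ i τ t, lo ≤ i → i ≤ N + 1 → c.Frame σ τ → J i τ t → e.Fits W τ ∧ e.eval τ = N)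
    (hstep : ∀ i τ t, lo ≤ i → i ≤ N → c.Frame σ τ → τ.ireg x = i → J i τ t →
      Runs W c τ fun ρ s => ρ.ireg x = i + 1 ∧ J (i + 1) ρ (t + (e.cost + 4 + s)))
    (hQ : ∀ τ t, c.Frame σ τ → τ.ireg x = N + 1 → J (N + 1) τ t → Q τ (t + (e.cost + 4))) :
    Runs W (.while (APSP.ile (.reg x) e) c) σ Q := by
  refine runs_count x lo (N + 1) J hlo hx h0 ?_ ?_ ?_
  · intro i τ t h1 h2 hF hxi hJ
    obtain ⟨h3, h4⟩ := he i τ t h1 h2 hF hJ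
    refine ⟨⟨h3, trivial⟩, ?_⟩
    simp only [APSP.ile, BExp.Holds, IExp.eval, h4, hxi]
    omega
  · intro i τ t h1 h2 hF hxi hJ
    refine (hstep i τ t h1 (by omega) hF hxi hJ).imp fun ρ s _ h => ?_
    simpa [APSP.ile, add_assoc] using h
  · intro τ t hF hxi hJ
    simpa [APSP.ile, add_assoc] using hQ τ t hF hxi hJ

/-- A loop that counts an index register up to the value of an expression, which is excluded. -/
theorem runs_below {c : Cmd} {e : IExp} (x lo N : ℕ) (J : ℕ → Mem → ℕ → Prop) (hlo : lo ≤ N)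
    (hx : σ.ireg x = lo) (h0 : J lo σ 0)
    (he : ∀ i τ t, lo ≤ i → i ≤ N → c.Frame σ τ → J i τ t → e.Fits W τ ∧ e.eval τ = N)
    (hstep : ∀ i τ t, lo ≤ i → i < N → c.Frame σ τ → τ.ireg x = i → J i τ t →
      Runs W c τ fun ρ s => ρ.ireg x = i + 1 ∧ J (i + 1) ρ (t + (e.cost + 3 + s)))
    (hQ : ∀ τ t, c.Frame σ τ → τ.ireg x = N → J N τ t → Q τ (t + (e.cost + 3))) :
    Runs W (.while (.ilt (.reg x) e) c) σ Q := by
  have hcost : (BExp.ilt (.reg x) e).cost + 1 = e.cost + 3 := by simp; omega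
  refine runs_count x lo N J hlo hx h0 ?_ ?_ ?_
  · intro i τ t h1 h2 hF hxi hJ
    obtain ⟨h3, h4⟩ := he i τ t h1 h2 hF hJ
    refine ⟨⟨trivial, h3⟩, ?_⟩
    simp only [BExp.Holds, IExp.eval, h4, hxi]
  · intro i τ t h1 h2 hF hxi hJ
    rw [hcost]
    exact hstep i τ t h1 h2 hF hxi hJ
  · intro τ t hF hxi hJ
    rw [hcost]
    exact hQ τ t hF hxi hJ

end Rules

-- With these rules `simp` executes straight-line code symbolically; branches and loops are left to
-- explicit rules.
attribute [simp] runs_skip runs_iset runs_rset runs_istore runs_rstore runs_seq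

@[simp] theorem block_cons_cons (c d : Cmd) (cs : List Cmd) :
    block (c :: d :: cs) = .seq c (block (d :: cs)) := rfl
@[simp] theorem block_single (c : Cmd) : block [c] = c := rfl

end RealRAM

/-! ## Lexicographically-first shortest paths -/

namespace WDigraph

variable {n m : ℕ} {G : WDigraph n m}

namespace DiPath

/-- Concatenation of paths. -/
def comp {u v : Fin n} (p : DiPath G u v) : {w : Fin n} → DiPath G v w → DiPath G u w
  | _, nil => p
  | _, snoc q e hs ht => snoc (p.comp q) e hs ht

theorem length_comp {u v w : Fin n} (p : DiPath G u v) (q : DiPath G v w) :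
    (p.comp q).length = p.length + q.length := by
  induction q with
  | nil => simp [comp, length]
  | snoc q e hs ht ih => simp [comp, length, ih, add_assoc]

/-- The first edge of a path. -/
def firstEdge {u : Fin n} : {v : Fin n} → DiPath G u v → Option (Fin m)
  | _, nil => none
  | _, snoc p e _ _ => some (p.firstEdge.getD e)

theorem src_of_firstEdge {u v : Fin n} (p : DiPath G u v) {e : Fin m} (h : p.firstEdge = some e) :
    G.src e = u := by
  induction p generalizing e with
  | nil => simp [firstEdge] at h
  | snoc p f hs ht ih =>
    cases p with
    | nil => simp [firstEdge] at h; subst h; exact hs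
    | snoc p' f' hs' ht' =>
      simp only [firstEdge, Option.getD_some] at h ih
      exact ih h

theorem firstEdge_mem {u v : Fin n} (p : DiPath G u v) {e : Fin m} (h : p.firstEdge = some e) :
    e ∈ p.edges := by
  induction p generalizing e with
  | nil => simp [firstEdge] at h
  | snoc p f hs ht ih =>
    cases p with
    | nil => simp [firstEdge] at h; subst h; simp [edges]
    | snoc p' f' hs' ht' =>
      simp only [firstEdge, Option.getD_some] at h ih
      exact Or.inr (ih h)

/-- A path is cut at one of its edges. -/
theorem exists_comp_of_mem_edges {u v : Fin n} (p : DiPath G u v) {e : Fin m} (h : e ∈ p.edges) :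
    ∃ (r : DiPath G u (G.src e)) (q : DiPath G (G.src e) v), p = r.comp q ∧
      q.firstEdge = some e := by
  induction p with
  | nil => simp [edges] at h
  | snoc p f hs ht ih =>
    rcases h with rfl | h
    · subst hs
      exact ⟨p, snoc nil e rfl ht, rfl, rfl⟩
    · obtain ⟨r, q, rfl, hq⟩ := ih h
      exact ⟨r, snoc q f hs ht, rfl, by simp [firstEdge, hq]⟩

/-- A path is cut after its first edge. -/
theorem exists_comp_of_firstEdge {u v : Fin n} (p : DiPath G u v) {e : Fin m}
    (h : p.firstEdge = some e) :
    ∃ (r : DiPath G u (G.tgt e)) (q : DiPath G (G.tgt e) v), p = r.comp q ∧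
      r.length = G.weight e := by
  induction p generalizing e with
  | nil => simp [firstEdge] at h
  | snoc p f hs ht ih =>
    cases p with
    | nil =>
      simp [firstEdge] at h; subst h; subst ht
      exact ⟨snoc nil f hs rfl, nil, rfl, by simp [length]⟩
    | snoc p' f' hs' ht' =>
      simp only [firstEdge, Option.getD_some] at h ih
      obtain ⟨r, q, hp, hr⟩ := ih h
      exact ⟨r, snoc q f hs ht, by rw [hp]; rfl, hr⟩

theorem firstEdge_snoc {u v w : Fin n} (p : DiPath G u v) (e : Fin m) (hs : G.src e = v)
    (ht : G.tgt e = w) (h : u ≠ v) : (snoc p e hs ht).firstEdge = p.firstEdge := by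
  cases p with
  | nil => exact absurd rfl h
  | snoc => rfl

theorem exists_firstEdge {u v : Fin n} (p : DiPath G u v) (h : u ≠ v) :
    ∃ e, p.firstEdge = some e := by
  cases p with
  | nil => exact absurd rfl h
  | snoc p e => exact ⟨_, rfl⟩

theorem eq_or_ancestor {u v : Fin n} (p : DiPath G u v) : u = v ∨ G.Ancestor u v := by
  induction p with
  | nil => exact Or.inl rfl
  | snoc p e hs ht ih =>
    right
    rcases ih with rfl | h
    · exact .single ⟨e, hs, ht⟩
    · exact .tail h ⟨e, hs, ht⟩

theorem mem_vertices_start {u v : Fin n} (p : DiPath G u v) : u ∈ p.vertices := by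
  induction p with
  | nil => simp [vertices]
  | snoc p e hs ht ih => exact Or.inr ih

theorem IsLexFirst.isShortest {π : Fin n ≃ Fin n} {u v : Fin n} {p : DiPath G u v}
    (h : p.IsLexFirst π) : p.IsShortest := by
  cases p with
  | nil => exact h
  | snoc => exact h.1

end DiPath

theorem Ancestor.nonempty_diPath {u v : Fin n} (h : G.Ancestor u v) :
    Nonempty (G.DiPath u v) := by
  induction h with
  | single h => obtain ⟨e, hs, ht⟩ := h; exact ⟨.snoc .nil e hs ht⟩
  | tail _ h ih =>
    obtain ⟨e, hs, ht⟩ := h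
    obtain ⟨p⟩ := ih
    exact ⟨.snoc p e hs ht⟩

theorem nonempty_diPath_iff {u v : Fin n} :
    Nonempty (G.DiPath u v) ↔ u = v ∨ G.Ancestor u v := by
  constructor
  · rintro ⟨p⟩; exact p.eq_or_ancestor
  · rintro (rfl | h)
    · exact ⟨.nil⟩
    · exact h.nonempty_diPath

theorem IsAcyclic.wellFounded (hG : G.IsAcyclic) : WellFounded G.Adj := by
  have : WellFounded G.Ancestor := by
    have : IsTrans (Fin n) G.Ancestor := ⟨fun _ _ _ h h' => Relation.TransGen.trans h h'⟩
    have : Std.Irrefl G.Ancestor := ⟨hG⟩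
    exact Finite.wellFounded_of_trans_of_irrefl _
  exact Subrelation.wf (fun {a b} h => Relation.TransGen.single h) this

theorem IsAcyclic.no_return (hG : G.IsAcyclic) {u x : Fin n} (p : G.DiPath u x) {e : Fin m}
    (hs : G.src e = x) (ht : G.tgt e = u) : False := by
  refine hG u ?_
  rcases p.eq_or_ancestor with rfl | h
  · exact .single ⟨e, hs, ht⟩
  · exact .tail h ⟨e, hs, ht⟩

theorem IsAcyclic.eq_nil (hG : G.IsAcyclic) {u v : Fin n} (h : u = v) (p : G.DiPath u v) :
    p.length = 0 := by
  cases p with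
  | nil => rfl
  | snoc p e hs ht => exact (hG.no_return p hs (ht.trans h.symm)).elim

theorem IsAcyclic.nil_isLexFirst (hG : G.IsAcyclic) (π : Fin n ≃ Fin n) (u : Fin n) :
    (DiPath.nil : G.DiPath u u).IsLexFirst π := by
  intro q
  rw [hG.eq_nil rfl q]
  rfl

/-- If the last edge of a path minimizes the length, and its tail has the lowest number in case of
ties, then the path is the lexicographically-first shortest one. -/
theorem IsAcyclic.snoc_isLexFirst (hG : G.IsAcyclic) {π : Fin n ≃ Fin n} {u v w : Fin n}
    (p : G.DiPath u v) (hp : p.IsLexFirst π) (e : Fin m) (hs : G.src e = v) (ht : G.tgt e = w)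
    (hmin : ∀ (f : Fin m) (q : G.DiPath u (G.src f)), G.tgt f = w → q.IsShortest →
      p.length + G.weight e ≤ q.length + G.weight f ∧
      (p.length + G.weight e = q.length + G.weight f → π v ≤ π (G.src f)))
    (hex : ∀ f : Fin m, G.tgt f = w → Nonempty (G.DiPath u (G.src f)) →
      ∃ q : G.DiPath u (G.src f), q.IsShortest) :
    (DiPath.snoc p e hs ht).IsLexFirst π := by
  subst hs
  have hsh : (DiPath.snoc p e rfl ht).IsShortest := by
    intro q
    cases q with
    | nil => exact (hG.no_return p rfl ht).elim
    | snoc q f hs' ht' =>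
      subst hs'
      obtain ⟨q', hq'⟩ := hex f ht' ⟨q⟩
      have := (hmin f q' ht' hq').1
      have := hq' q
      simp only [DiPath.length]
      linarith
  refine ⟨hsh, ?_, hp⟩
  intro x q f hs' ht' hq
  subst hs'
  have hq' : q.IsShortest := fun q' => by
    have := hq (DiPath.snoc q' f rfl ht')
    simpa [DiPath.length] using this
  refine (hmin f q ht' hq').2 (le_antisymm ?_ ?_)
  · exact hsh (DiPath.snoc q f rfl ht')
  · exact hq (DiPath.snoc p e rfl ht)

/-- Well-founded induction on the end vertex. Among the edges into `w` whose tail is already reached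
by a lexicographically-first path, one that minimizes the pair of length and number of the tail is a
correct last edge by `snoc_isLexFirst`. -/
theorem IsAcyclic.exists_isLexFirst (hG : G.IsAcyclic) (π : Fin n ≃ Fin n) (u v : Fin n)
    (h : Nonempty (G.DiPath u v)) : ∃ p : G.DiPath u v, p.IsLexFirst π := by
  induction v using hG.wellFounded.induction with
  | _ w ih =>
  by_cases huw : u = w
  · subst huw; exact ⟨.nil, hG.nil_isLexFirst π u⟩
  have ih' : ∀ f : Fin m, G.tgt f = w → Nonempty (G.DiPath u (G.src f)) →
      ∃ q : G.DiPath u (G.src f), q.IsLexFirst π := fun f hf hq => ih _ ⟨f, rfl, hf⟩ hq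
  classical
  let S : Finset (Fin m) := Finset.univ.filter fun f =>
    G.tgt f = w ∧ ∃ q : G.DiPath u (G.src f), q.IsLexFirst π
  -- The value `0` is never compared, as `S` contains only edges for which the path exists. The
  -- choice of the path does not matter either, since all shortest paths have the same length
  -- (`hD`).
  let D : Fin m → ℝ := fun f =>
    if h : ∃ q : G.DiPath u (G.src f), q.IsLexFirst π then h.choose.length + G.weight f else 0
  have hD : ∀ (f : Fin m) (q : G.DiPath u (G.src f)), q.IsShortest →
      (∃ q : G.DiPath u (G.src f), q.IsLexFirst π) → D f = q.length + G.weight f := by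
    intro f q hq hex
    simp only [D, dif_pos hex]
    have h1 := hex.choose_spec.isShortest q
    have h2 := hq hex.choose
    linarith
  have hS : S.Nonempty := by
    obtain ⟨p⟩ := h
    cases p with
    | nil => exact absurd rfl huw
    | snoc p e hs ht =>
      subst hs
      exact ⟨e, by simp only [S, Finset.mem_filter, Finset.mem_univ, true_and]
                   exact ⟨ht, ih' e ht ⟨p⟩⟩⟩
  obtain ⟨e, heS, hemin⟩ := S.exists_min_image (fun f => toLex (D f, π (G.src f))) hS
  simp only [S, Finset.mem_filter, Finset.mem_univ, true_and] at heS hemin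
  obtain ⟨ht, p, hp⟩ := heS
  refine ⟨DiPath.snoc p e rfl ht, hG.snoc_isLexFirst p hp e rfl ht ?_ ?_⟩
  · intro f q hf hq
    have hex := ih' f hf ⟨q⟩
    have := hemin f ⟨hf, hex⟩
    rw [Prod.Lex.toLex_le_toLex, hD e p hp.isShortest ⟨p, hp⟩, hD f q hq hex] at this
    rcases this with h | ⟨h, h'⟩
    · exact ⟨h.le, fun h' => absurd h' h.ne⟩
    · exact ⟨h.le, fun _ => h'⟩
  · intro f hf hq
    obtain ⟨q, hq⟩ := ih' f hf hq
    exact ⟨q, hq.isShortest⟩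

/-- Compare the paths from their ends: each last tail has a number at most that of the other, so the
tails coincide, and a simple graph has only one edge between two given vertices. -/
theorem IsAcyclic.isLexFirst_unique (hG : G.IsAcyclic) {π : Fin n ≃ Fin n} {u v : Fin n}
    (p q : G.DiPath u v) (hp : p.IsLexFirst π) (hq : q.IsLexFirst π) : p = q := by
  induction p with
  | nil =>
    cases q with
    | nil => rfl
    | snoc q e hs ht => exact (hG.no_return q hs ht).elim
  | snoc p e hs ht ih =>
    cases q with
    | nil => exact (hG.no_return p hs ht).elim
    | snoc q f hs' ht' =>
      have h1 := hp.2.1 _ q f hs' ht' hq.1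
      have h2 := hq.2.1 _ p e hs ht hp.1
      have h3 : G.src e = G.src f := π.injective (le_antisymm h1 h2)
      have h4 : e = f := G.simple (Prod.ext h3 (ht.trans ht'.symm))
      subst h4
      subst hs
      subst hs'
      rw [ih q hp.2.2 hq.2.2]

/-- The final parts of a lexicographically-first shortest path are lexicographically first. -/
theorem DiPath.IsLexFirst.of_comp (hG : G.IsAcyclic) {π : Fin n ≃ Fin n} {u v w : Fin n}
    (r : G.DiPath u v) (q : G.DiPath v w) (h : (r.comp q).IsLexFirst π) : q.IsLexFirst π := by
  induction q with
  | nil => exact hG.nil_isLexFirst π v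
  | snoc q e hs ht ih =>
    obtain ⟨h1, h2, h3⟩ := h
    -- A shorter replacement of the final part would shorten the whole path.
    have hsh : (DiPath.snoc q e hs ht).IsShortest := by
      intro s
      have := h1 (r.comp s)
      simp only [length_comp, length] at this ⊢
      linarith
    refine ⟨hsh, ?_, ih h3⟩
    intro x s f hs' ht' hsf
    -- A shortest competitor from `v`, preceded by `r`, is a shortest competitor from `u`: it is no
    -- longer than the given path.
    refine h2 x (r.comp s) f hs' ht' ?_
    intro s'
    have h4 := h1 s'
    have h5 := hsf (DiPath.snoc q e hs ht)
    simp only [length_comp, length] at h4 h5 ⊢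
    linarith

/-- A tree edge with tail `u` lies on some lexicographically-first path to `v`. Cut at this edge,
the final part starts at `u`, is lexicographically first, and hence is `p` itself. So `T_v` has
exactly one edge out of each ancestor, which is what makes a table of successors possible. -/
theorem IsAcyclic.mem_treeEdges_iff (hG : G.IsAcyclic) {π : Fin n ≃ Fin n} {u v : Fin n}
    {p : G.DiPath u v} (hp : p.IsLexFirst π) (e : Fin m) :
    e ∈ G.treeEdges π v ∧ G.src e = u ↔ p.firstEdge = some e := by
  constructor
  · rintro ⟨⟨x, q, hq, he⟩, rfl⟩
    obtain ⟨r, q', rfl, hq'⟩ := q.exists_comp_of_mem_edges he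
    rwa [hG.isLexFirst_unique p q' hp (hq.of_comp hG)]
  · intro h
    exact ⟨⟨u, p, hp, p.firstEdge_mem h⟩, p.src_of_firstEdge h⟩

/-- One step along a lexicographically-first shortest path whose last edge is fixed. -/
theorem IsAcyclic.isLexFirst_step (hG : G.IsAcyclic) {π : Fin n ≃ Fin n} {x j i : Fin n}
    {q : G.DiPath x j} {e f : Fin m} {hs : G.src e = j} {ht : G.tgt e = i}
    (h : (DiPath.snoc q e hs ht).IsLexFirst π) (hf : q.firstEdge = some f) :
    ∃ q' : G.DiPath (G.tgt f) j, (DiPath.snoc q' e hs ht).IsLexFirst π := by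
  obtain ⟨r, q', rfl, -⟩ := q.exists_comp_of_firstEdge hf
  exact ⟨q', DiPath.IsLexFirst.of_comp hG r (DiPath.snoc q' e hs ht) h⟩

theorem IsNumbering.lt_of_ancestor {π : Fin n ≃ Fin n} (hπ : G.IsNumbering π) {u v : Fin n}
    (h : G.Ancestor u v) : π u < π v := by
  induction h with
  | single h => exact hπ.topological _ _ h
  | tail _ h ih => exact ih.trans (hπ.topological _ _ h)

/-- An ancestor of `v` into which no edge of the tree of `v` leads is a leaf of that tree. -/
theorem mem_leaves_of_forall {π : Fin n ≃ Fin n} {u v : Fin n} {p : G.DiPath u v}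
    (hp : p.IsLexFirst π) (h : ∀ e ∈ G.treeEdges π v, G.tgt e ≠ u) : u ∈ G.leaves π v :=
  ⟨⟨u, p, hp, p.mem_vertices_start⟩, h⟩

/-- The sources occupy the lowest numbers; thus the main loop, which starts behind as many numbers
as there are sources, misses no other vertex. -/
theorem ncard_sources_le {π : Fin n ≃ Fin n} (hπ : G.IsNumbering π) {v : Fin n}
    (hv : ¬ G.IsSource v) : {v | G.IsSource v}.ncard ≤ π v := by
  have hsub : π '' {v | G.IsSource v} ⊆ ((Finset.Iio (π v) : Finset (Fin n)) : Set (Fin n)) := by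
    rintro _ ⟨u, hu, rfl⟩
    simpa using hπ.sources_first u v hu hv
  have := Set.ncard_le_ncard hsub (Finset.finite_toSet _)
  rwa [Set.ncard_image_of_injective _ π.injective, Set.ncard_coe_finset, Fin.card_Iio] at this

theorem edges_le (G : WDigraph n m) : m ≤ n * n := by
  have := Fintype.card_le_of_injective _ G.simple
  simpa using this

theorem sum_indeg (G : WDigraph n m) : ∑ v, G.indeg v = m := by
  have := Finset.card_eq_sum_card_fiberwise (f := G.tgt) (s := Finset.univ) (t := Finset.univ)
    (fun _ _ => Finset.mem_coe.2 (Finset.mem_univ _))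
  simpa [indeg] using this.symm

end WDigraph

namespace APSP

open RealRAM

/-! ## Tables -/

section Tables

variable {n W : ℕ}

/-- A column index is at most `n`, so it is the remainder of the address modulo `n + 1`. By this
lemma a write to one entry is seen to leave the others unchanged. -/
theorem cell_inj {i k i' k' : ℕ} (hk : k ≤ n) (hk' : k' ≤ n) :
    cell n i k = cell n i' k' ↔ i = i' ∧ k = k' := by
  constructor
  · intro h
    unfold cell at h
    have h1 : (i * (n + 1) + k) / (n + 1) = i := by
      rw [mul_comm, Nat.mul_add_div (by omega), Nat.div_eq_of_lt (by omega), add_zero]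
    have h2 : (i' * (n + 1) + k') / (n + 1) = i' := by
      rw [mul_comm, Nat.mul_add_div (by omega), Nat.div_eq_of_lt (by omega), add_zero]
    have : i = i' := by rw [← h1, ← h2, h]
    subst this
    exact ⟨rfl, by omega⟩
  · rintro ⟨rfl, rfl⟩; rfl

/-- The address of a cell is computed without an overflow. -/
def CellFits (W N i k : ℕ) : Prop := N + 1 < W ∧ i * (N + 1) < W ∧ i * (N + 1) + k < W

attribute [simp] rN rM rR rI rK rJ rT rS rQ rCur rX rBest rW aSrc aTgt aNum aInDeg aInTail aAncCount
  aAnc aNext aFinite aWeight aInWeight aDist incr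

@[simp] theorem cellE_eval (σ : Mem) (i k : IExp) :
    (cellE i k).eval σ = cell (σ.ireg 0) (i.eval σ) (k.eval σ) := rfl

@[simp] theorem cellE_cost (i k : IExp) : (cellE i k).cost = i.cost + k.cost + 5 := by
  simp [cellE]; ring

@[simp] theorem cellE_fits (σ : Mem) (i k : IExp) : (cellE i k).Fits W σ ↔
    i.Fits W σ ∧ k.Fits W σ ∧ CellFits W (σ.ireg 0) (i.eval σ) (k.eval σ) := by
  simp [cellE, CellFits]; tauto

theorem lt_word (hW : (n + 2) ^ 2 ≤ W) {i : ℕ} (hi : i ≤ n + 3) : i < W := by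
  have : n + 3 < (n + 2) ^ 2 := by nlinarith
  omega

/-- The largest address in question is `(n + 1) ^ 2`. -/
theorem CellFits.mk (hW : (n + 2) ^ 2 ≤ W) {i k : ℕ} (hi : i ≤ n) (hk : k ≤ n + 1) :
    CellFits W n i k := by
  have := Nat.mul_le_mul_right (n + 1) hi
  refine ⟨lt_word hW (by omega), ?_, ?_⟩ <;> nlinarith

theorem exists_vertex (π : Fin n ≃ Fin n) {i : ℕ} (h1 : 1 ≤ i) (h2 : i ≤ n) :
    ∃ v : Fin n, i = π v + 1 :=
  ⟨π.symm ⟨i - 1, by omega⟩, by simp; omega⟩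

end Tables

/-! ### The initial table of distances. -/

section InitDist

variable {n W : ℕ}

theorem runs_initDist (hW : (n + 2) ^ 2 ≤ W) {σ : Mem} (hn : σ.ireg rN = n) :
    Runs W initDist σ fun τ t =>
      (∀ i k, 1 ≤ i → i ≤ n → 1 ≤ k → k ≤ n →
        τ.iarr aFinite (cell n i k) = if i = k then 1 else 0) ∧
      (∀ i, 1 ≤ i → i ≤ n → τ.rarr aDist (cell n i i) = 0) ∧ t ≤ 80 * (n + 1) ^ 2 := by
  simp only [initDist, block_cons_cons, block_single, runs_seq]
  simp
  -- The counter starts at `1`, so `i - 1` rounds have been made; adding the cost of one round to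
  -- `t` avoids the subtraction. Later invariants of loops that start at `1` have the same form.
  refine runs_upto rI 1 n (fun i τ t =>
    (∀ j k, 1 ≤ j → j < i → 1 ≤ k → k ≤ n →
      τ.iarr aFinite (cell n j k) = if j = k then 1 else 0) ∧
    (∀ j, 1 ≤ j → j < i → τ.rarr aDist (cell n j j) = 0) ∧ t + 70 * (n + 1) ≤ i * (70 * (n + 1)))
    (by omega) (by simp) ⟨by omega, by omega, by omega⟩ ?_ ?_ ?_
  · intro i τ t _ _ hF _
    exact ⟨trivial, by simpa [hn] using hF.ireg rN rfl⟩
  · rintro i τ t h1 h2 hF hi ⟨hJ1, hJ2, hJ3⟩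
    have hn' : τ.ireg rN = n := by simpa [hn] using hF.ireg rN rfl
    simp
    refine runs_upto rK 1 n (fun k ρ s =>
      (∀ j k', 1 ≤ j → 1 ≤ k' → k' ≤ n → ρ.iarr aFinite (cell n j k') =
        if j = i ∧ k' < k then 0 else τ.iarr aFinite (cell n j k')) ∧ s + 25 ≤ k * 25) (by omega)
        (by simp) ?_ ?_ ?_ ?_
    · refine ⟨fun j k' h1 h2 _ => ?_, by omega⟩
      rw [if_neg (by omega)]; rfl
    · intro k ρ s _ _ hF' _
      exact ⟨trivial, by simpa [hn'] using hF'.ireg rN rfl⟩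
    · rintro k ρ s k1 k2 hF' hk ⟨hK1, hK2⟩
      have hn'' : ρ.ireg rN = n := by simpa [hn'] using hF'.ireg rN rfl
      have hi' : ρ.ireg rI = i := by simpa [hi] using hF'.ireg rI rfl
      simp [hn'', hi', hk, CellFits.mk hW h2 (Nat.le_succ_of_le k2),
        lt_word hW (show k + 1 ≤ n + 3 by omega)]
      refine ⟨fun j k' j1 k1' k2' => ?_, by omega⟩
      simp only [cell_inj k2' k2]
      by_cases hjk : j = i ∧ k' = k
      · rw [if_pos hjk, if_pos (by omega)]
      · rw [if_neg hjk, hK1 j k' j1 k1' k2']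
        exact if_congr (by omega) rfl rfl
    · rintro ρ s hF' hk ⟨hK1, hK2⟩
      have hn'' : ρ.ireg rN = n := by simpa [hn'] using hF'.ireg rN rfl
      have hi' : ρ.ireg rI = i := by simpa [hi] using hF'.ireg rI rfl
      simp [hn'', hi', CellFits.mk hW h2 (Nat.le_succ_of_le h2),
        lt_word hW (show i + 1 ≤ n + 3 by omega)]
      refine ⟨fun j k' j1 j2 k1' k2' => ?_, fun j j1 j2 => ?_, by nlinarith⟩
      · simp only [cell_inj k2' h2]
        by_cases hjk : j = i ∧ k' = i
        · rw [if_pos hjk, if_pos (by omega)]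
        · rw [if_neg hjk, hK1 j k' j1 k1' k2']
          by_cases hji : j = i
          · rw [if_pos (by omega), if_neg (by omega)]
          · rw [if_neg (by omega), hJ1 j k' j1 (by omega) k1' k2']
      · rw [cell_inj (by omega) h2]
        intro hji
        rw [← hJ2 j j1 (by omega)]
        exact congrFun (hF'.rarr aDist rfl) _
  · rintro τ t hF hi ⟨h1, h2, h3⟩
    refine ⟨fun i k i1 i2 => h1 i k i1 (by omega), fun i i1 i2 => h2 i i1 (by omega), ?_⟩
    simp; nlinarith

end InitDist

end APSP

namespace APSP

open RealRAM WDigraph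

variable {n m W : ℕ} {G : WDigraph n m} {π : Fin n ≃ Fin n} {σ τ ρ : Mem}

/-! ## Entries of the output tables -/

/-- The flag that tells whether the distance from `u` to `v` is finite. -/
def finAt (π : Fin n ≃ Fin n) (σ : Mem) (u v : Fin n) : ℕ :=
  σ.iarr aFinite (cell n (π u + 1) (π v + 1))

/-- The distance from `u` to `v`. -/
def distAt (π : Fin n ≃ Fin n) (σ : Mem) (u v : Fin n) : ℝ :=
  σ.rarr aDist (cell n (π u + 1) (π v + 1))

/-- The successor of `u` in the tree of `v`. -/
def nextAt (π : Fin n ≃ Fin n) (σ : Mem) (u v : Fin n) : ℕ :=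
  σ.iarr aNext (cell n (π v + 1) (π u + 1))

/-- The entries for the pair `u`, `v` are correct. -/
def Entry (G : WDigraph n m) (π : Fin n ≃ Fin n) (σ : Mem) (u v : Fin n) : Prop :=
  finAt π σ u v = 1 ∧ ∃ p : G.DiPath u v, p.IsLexFirst π ∧ distAt π σ u v = p.length ∧
    ∃ e, p.firstEdge = some e ∧ nextAt π σ u v = π (G.tgt e) + 1

/-- Two memories differ at most in entries for ancestors of `v`. -/
def Outside (G : WDigraph n m) (π : Fin n ≃ Fin n) (v : Fin n) (σ τ : Mem) : Prop :=
  ∀ x y, y ≠ v ∨ ¬ G.Ancestor x v → finAt π τ x y = finAt π σ x y ∧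
    distAt π τ x y = distAt π σ x y ∧ nextAt π τ x y = nextAt π σ x y

/-- The number of ancestors of `v` that have been added to the tree of `v`. -/
noncomputable def filled (G : WDigraph n m) (π : Fin n ≃ Fin n) (σ : Mem) (v : Fin n) : ℕ :=
  {u | G.Ancestor u v ∧ nextAt π σ u v ≠ 0}.ncard

theorem Outside.refl (v : Fin n) (σ : Mem) : Outside G π v σ σ := fun _ _ _ => ⟨rfl, rfl, rfl⟩

theorem Outside.trans {v : Fin n} (h : Outside G π v σ τ) (h' : Outside G π v τ ρ) :
    Outside G π v σ ρ := fun x y hxy =>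
  ⟨(h' x y hxy).1.trans (h x y hxy).1, (h' x y hxy).2.1.trans (h x y hxy).2.1,
    (h' x y hxy).2.2.trans (h x y hxy).2.2⟩

theorem Entry.congr {u v : Fin n} (h : Entry G π σ u v) (h1 : finAt π τ u v = finAt π σ u v)
    (h2 : distAt π τ u v = distAt π σ u v) (h3 : nextAt π τ u v = nextAt π σ u v) :
    Entry G π τ u v := by
  unfold Entry at *
  rw [h1, h2, h3]; exact h

theorem Entry.outside {u v w : Fin n} (h : Entry G π σ u v) (ho : Outside G π w σ τ)
    (hv : v ≠ w) : Entry G π τ u v :=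
  h.congr (ho u v (.inl hv)).1 (ho u v (.inl hv)).2.1 (ho u v (.inl hv)).2.2

theorem filled_le (v : Fin n) : filled G π σ v ≤ {u | G.Ancestor u v}.ncard :=
  Set.ncard_le_ncard (fun _ h => h.1) (Set.toFinite _)

/-- One correct pair is entered into the tables. -/
structure Fills (G : WDigraph n m) (π : Fin n ≃ Fin n) (σ τ : Mem) (x v : Fin n) : Prop where
  fin_eq : ∀ u y, finAt π τ u y = if u = x ∧ y = v then 1 else finAt π σ u y
  dist_eq : ∀ u y, ¬ (u = x ∧ y = v) → distAt π τ u y = distAt π σ u y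
  next_eq : ∀ u y, ¬ (u = x ∧ y = v) → nextAt π τ u y = nextAt π σ u y
  entry : Entry G π τ x v
  anc : G.Ancestor x v

namespace Fills

variable {x v : Fin n}

theorem outside (h : Fills G π σ τ x v) : Outside G π v σ τ := by
  intro u y huy
  have : ¬ (u = x ∧ y = v) := by
    rintro ⟨rfl, rfl⟩
    rcases huy with h' | h'
    · exact h' rfl
    · exact h' h.anc
  exact ⟨by rw [h.fin_eq, if_neg this], h.dist_eq u y this, h.next_eq u y this⟩

theorem next_ne (h : Fills G π σ τ x v) : nextAt π τ x v ≠ 0 := by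
  obtain ⟨-, -, -, -, e, -, h⟩ := h.entry
  omega

theorem mono (h : Fills G π σ τ x v) {u : Fin n} (hu : nextAt π σ u v ≠ 0) :
    nextAt π τ u v ≠ 0 := by
  by_cases hux : u = x
  · subst hux; exact h.next_ne
  · rwa [h.next_eq u v (fun h => hux h.1)]

theorem entries (h : Fills G π σ τ x v)
    (hc : ∀ u, G.Ancestor u v → nextAt π σ u v = 0 ∨ Entry G π σ u v) :
    ∀ u, G.Ancestor u v → nextAt π τ u v = 0 ∨ Entry G π τ u v := by
  intro u hu
  by_cases hux : u = x
  · subst hux; exact .inr h.entry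
  · have hn : ¬ (u = x ∧ v = v) := fun h => hux h.1
    rw [h.next_eq u v hn]
    refine (hc u hu).imp_right fun he => he.congr ?_ (h.dist_eq u v hn) (h.next_eq u v hn)
    rw [h.fin_eq, if_neg hn]

/-- This makes `filled` a potential: each round of the walk in `addPath` raises it by one and is
paid for in this way. -/
theorem filled_eq (h : Fills G π σ τ x v) (hx : nextAt π σ x v = 0) :
    filled G π τ v = filled G π σ v + 1 := by
  unfold filled
  have : {u | G.Ancestor u v ∧ nextAt π τ u v ≠ 0} =
      insert x {u | G.Ancestor u v ∧ nextAt π σ u v ≠ 0} := by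
    ext u
    by_cases hux : u = x
    · subst hux
      simp [h.anc, h.next_ne]
    · simp [hux, h.next_eq u v (fun h => hux h.1)]
  rw [this, Set.ncard_insert_of_notMem (by simp [hx]) (Set.toFinite _)]

end Fills

/-! ## The choice of the last but one vertex -/

/-- The best among the first `s` candidates has been selected. -/
def Best {d : ℕ} (A : Fin d → Prop) (D : Fin d → ℝ) (q : Fin d → ℕ) (w : Fin d → ℝ)
    (s J : ℕ) (b x : ℝ) : Prop :=
  (J = 0 ∧ ∀ i : Fin d, (i : ℕ) < s → ¬ A i) ∨
  ∃ i₀ : Fin d, A i₀ ∧ J = q i₀ ∧ x = w i₀ ∧ b = D i₀ ∧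
    ∀ i : Fin d, (i : ℕ) < s → A i → D i₀ < D i ∨ (D i₀ = D i ∧ q i₀ ≤ q i)

namespace Best

variable {d : ℕ} {A : Fin d → Prop} {D : Fin d → ℝ} {q : Fin d → ℕ} {w : Fin d → ℝ}
  {s J : ℕ} {b x : ℝ}

theorem skip (h : Best A D q w s J b x) (hs : s < d) (hA : ¬ A ⟨s, hs⟩) :
    Best A D q w (s + 1) J b x := by
  have key : ∀ i : Fin d, (i : ℕ) < s + 1 → A i → (i : ℕ) < s := by
    intro i hi hAi
    rcases Nat.lt_succ_iff_lt_or_eq.1 hi with h | h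
    · exact h
    · exact absurd hAi (by rwa [show i = ⟨s, hs⟩ from Fin.ext h])
  rcases h with ⟨h1, h2⟩ | ⟨i₀, h1, h2, h3, h4, h5⟩
  · exact .inl ⟨h1, fun i hi hAi => h2 i (key i hi hAi) hAi⟩
  · exact .inr ⟨i₀, h1, h2, h3, h4, fun i hi hAi => h5 i (key i hi hAi) hAi⟩

theorem take (h : Best A D q w s J b x) (hs : s < d) (hA : A ⟨s, hs⟩)
    (hb : J = 0 ∨ D ⟨s, hs⟩ < b ∨ (D ⟨s, hs⟩ = b ∧ q ⟨s, hs⟩ < J)) (hq : ∀ i, q i ≠ 0) :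
    Best A D q w (s + 1) (q ⟨s, hs⟩) (D ⟨s, hs⟩) (w ⟨s, hs⟩) := by
  refine .inr ⟨⟨s, hs⟩, hA, rfl, rfl, rfl, fun i hi hAi => ?_⟩
  rcases Nat.lt_succ_iff_lt_or_eq.1 hi with hi | hi
  · rcases h with ⟨h1, h2⟩ | ⟨i₀, h1, h2, h3, h4, h5⟩
    · exact absurd hAi (h2 i hi)
    · subst h4
      have hJ : J ≠ 0 := h2 ▸ hq i₀
      rcases h5 i hi hAi with h6 | ⟨h6, h7⟩ <;> rcases hb with hb | hb | ⟨hb, hb'⟩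
      · exact absurd hb hJ
      · exact .inl (hb.trans h6)
      · exact .inl (hb ▸ h6)
      · exact absurd hb hJ
      · exact .inl (h6 ▸ hb)
      · exact .inr ⟨hb.trans h6, by omega⟩
  · rw [show i = ⟨s, hs⟩ from Fin.ext hi]
    exact .inr ⟨rfl, le_rfl⟩

theorem keep (h : Best A D q w s J b x) (hs : s < d)
    (hb : ¬ (J = 0 ∨ D ⟨s, hs⟩ < b ∨ (D ⟨s, hs⟩ = b ∧ q ⟨s, hs⟩ < J))) :
    Best A D q w (s + 1) J b x := by
  simp only [not_or, not_lt, not_and] at hb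
  obtain ⟨hb1, hb2, hb3⟩ := hb
  rcases h with ⟨h1, h2⟩ | ⟨i₀, h1, h2, h3, h4, h5⟩
  · exact absurd h1 hb1
  · refine .inr ⟨i₀, h1, h2, h3, h4, fun i hi hAi => ?_⟩
    rcases Nat.lt_succ_iff_lt_or_eq.1 hi with hi | hi
    · exact h5 i hi hAi
    · rw [show i = ⟨s, hs⟩ from Fin.ext hi]
      rw [h4] at hb2 hb3
      rcases hb2.lt_or_eq with h | h
      · exact .inl h
      · exact .inr ⟨h, by rw [← h2]; exact hb3 h.symm⟩

end Best

/-- The list of the edges into `v` is in the memory. -/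
structure InList (G : WDigraph n m) (π : Fin n ≃ Fin n) (σ : Mem) (v : Fin n) {d : ℕ}
    (f : Fin d → Fin m) : Prop where
  inj : Function.Injective f
  range : Set.range f = {e | G.tgt e = v}
  deg : σ.iarr aInDeg (π v + 1) = d
  tail : ∀ s : Fin d, σ.iarr aInTail (cell n (π v + 1) (s + 1)) = π (G.src (f s)) + 1
  weight : ∀ s : Fin d, σ.rarr aInWeight (cell n (π v + 1) (s + 1)) = G.weight (f s)

theorem InList.indeg_eq {v : Fin n} {d : ℕ} {f : Fin d → Fin m} (h : InList G π σ v f) :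
    G.indeg v = d := by
  have h1 : (Finset.univ.filter fun e => G.tgt e = v) = Finset.univ.image f := by
    ext e
    have := Set.ext_iff.1 h.range e
    simp only [Set.mem_range, Set.mem_ofPred_eq] at this
    simp [this]
  rw [indeg, h1, Finset.card_image_of_injective _ h.inj]
  simp

/-- Edges into the same vertex of a simple graph have different tails; hence the list fits into one
row of the table. -/
theorem InList.le {v : Fin n} {d : ℕ} {f : Fin d → Fin m} (h : InList G π σ v f) : d ≤ n := by
  have h1 : Function.Injective fun s => G.src (f s) := by
    intro s s' hs
    refine h.inj (G.simple (Prod.ext hs ?_))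
    have h2 : ∀ s, G.tgt (f s) = v := fun s => by
      have : f s ∈ Set.range f := ⟨s, rfl⟩
      rw [h.range] at this
      exact this
    simp [h2]
  simpa using Fintype.card_le_of_injective _ h1

/-- The loop is a search for the minimum of the pair of length and number of the tail, and
`snoc_isLexFirst` recognizes the result as the last edge of the lexicographically-first path. The
hypothesis `hfin` asks for correct distances only to direct ancestors of `v`, because the columns of
other vertices may still be incomplete. -/
theorem runs_chooseLast (hW : (n + 2) ^ 2 ≤ W) (hG : G.IsAcyclic) {k v : Fin n} {d : ℕ}
    {f : Fin d → Fin m} (hL : InList G π σ v f)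
    (hn : σ.ireg rN = n) (hi : σ.ireg rI = π v + 1) (hk : σ.ireg rK = π k + 1)
    (hfin : ∀ x, (finAt π σ k x = 1 ∧ ∃ p : G.DiPath k x, p.IsLexFirst π ∧
      distAt π σ k x = p.length) ∨ (finAt π σ k x ≠ 1 ∧ IsEmpty (G.DiPath k x)) ∨
      ¬ G.Adj x v) (hanc : G.Ancestor k v) :
    Runs W chooseLast σ fun τ t => t ≤ 120 * (d + 1) ∧
      ∃ (e : Fin m) (ht : G.tgt e = v) (p : G.DiPath k (G.src e)),
        (DiPath.snoc p e rfl ht).IsLexFirst π ∧ τ.ireg rJ = π (G.src e) + 1 ∧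
        τ.rreg rW = G.weight e := by
  have hd := hL.le
  have hik : ∀ x : Fin n, (π x : ℕ) + 1 ≤ n := fun x => (π x).2
  simp only [chooseLast, block_cons_cons, block_single, runs_seq]
  simp
  have htgt : ∀ s, G.tgt (f s) = v := fun s => by
    have : f s ∈ Set.range f := ⟨s, rfl⟩
    rw [hL.range] at this
    exact this
  let A : Fin d → Prop := fun s => finAt π σ k (G.src (f s)) = 1
  let D : Fin d → ℝ := fun s => distAt π σ k (G.src (f s)) + G.weight (f s)
  let q : Fin d → ℕ := fun s => π (G.src (f s)) + 1
  let w : Fin d → ℝ := fun s => G.weight (f s)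
  refine runs_upto rS 1 d (fun s τ t => Best A D q w (s - 1) (τ.ireg rJ) (τ.rreg rBest)
    (τ.rreg rW) ∧ t + 100 ≤ s * 100) (by omega) (by simp)
    ⟨.inl ⟨by simp, by simp⟩, by omega⟩ ?_ ?_ ?_
  · intro s τ t _ _ hF _
    have h1 : τ.ireg 3 = π v + 1 := (hF.ireg rI rfl).trans (by simpa using hi)
    have h2 : τ.iarr 3 = σ.iarr 3 := hF.iarr 3 rfl
    exact ⟨trivial, by simp [h1, h2]; exact hL.deg⟩
  · rintro s τ t s1 s2 hF hs ⟨hJ1, hJ2⟩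
    have hi' : τ.ireg 3 = π v + 1 := (hF.ireg rI rfl).trans (by simpa using hi)
    have hk' : τ.ireg 4 = π k + 1 := (hF.ireg rK rfl).trans (by simpa using hk)
    have hn' : τ.ireg 0 = n := (hF.ireg rN rfl).trans (by simpa using hn)
    have ha4 : τ.iarr 4 = σ.iarr 4 := hF.iarr 4 rfl
    have ha8 : τ.iarr 8 = σ.iarr 8 := hF.iarr 8 rfl
    have hr1 : τ.rarr 1 = σ.rarr 1 := hF.rarr 1 rfl
    have hr2 : τ.rarr 2 = σ.rarr 2 := hF.rarr 2 rfl
    obtain ⟨s', rfl⟩ : ∃ s', s = s' + 1 := ⟨s - 1, by omega⟩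
    have hs' : s' < d := by omega
    have ht := hL.tail ⟨s', hs'⟩
    have hw := hL.weight ⟨s', hs'⟩
    simp only [Nat.add_sub_cancel] at hJ1 ⊢
    -- Numbers start at `1` in the memory, so the value `0` of `rJ` can mean that no candidate has
    -- been seen.
    have hq : ∀ i, q i ≠ 0 := fun i => by simp [q]
    have c1 : CellFits W n (π v + 1) (s' + 1) := CellFits.mk hW (hik v) (by omega)
    have c2 : CellFits W n (π k + 1) (π (G.src (f ⟨s', hs'⟩)) + 1) :=
      CellFits.mk hW (hik k) (hik _ |>.trans (by omega))
    have c3 : s' + 1 + 1 < W := lt_word hW (by omega)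
    simp only [aInTail, aInWeight] at ht hw
    simp [hn', hi', hk', hs, ha4, c1, ht, runs_ite, ha8, c2, hr2, hr1, hw, c3]
    have hA : A ⟨s', hs'⟩ ↔ σ.iarr 8 (cell n (π k + 1) (π (G.src (f ⟨s', hs'⟩)) + 1)) = 1 := Iff.rfl
    have hD : D ⟨s', hs'⟩ = σ.rarr 2 (cell n (π k + 1) (π (G.src (f ⟨s', hs'⟩)) + 1)) +
      G.weight (f ⟨s', hs'⟩) := rfl
    have hqs : q ⟨s', hs'⟩ = π (G.src (f ⟨s', hs'⟩)) + 1 := rfl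
    simp only [← hqs]
    refine ⟨fun hA => ⟨fun hb => ⟨hJ1.take hs' hA hb hq, by omega⟩, fun h1 h2 h3 =>
      ⟨hJ1.keep hs' ?_, by omega⟩⟩, fun hA => ⟨hJ1.skip hs' hA, by omega⟩⟩
    rintro (h | h | ⟨h, h'⟩)
    · exact h1 h
    · exact absurd h (not_lt.2 h2)
    · exact absurd h' (not_lt.2 (h3 h))
  · rintro τ t hF hs ⟨hJ1, hJ2⟩
    refine ⟨by simp; omega, ?_⟩
    simp only [Nat.add_sub_cancel] at hJ1
    have hAdj : ∀ s, G.Adj (G.src (f s)) v := fun s => ⟨f s, rfl, htgt s⟩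
    have hsurj : ∀ e, G.tgt e = v → ∃ s, f s = e := fun e he => by
      have : e ∈ Set.range f := by rw [hL.range]; exact he
      exact this
    have hA : ∀ s, Nonempty (G.DiPath k (G.src (f s))) → A s := by
      rintro s ⟨p⟩
      rcases hfin (G.src (f s)) with h | h | h
      · exact h.1
      · exact (h.2.false p).elim
      · exact absurd (hAdj s) h
    have hDist : ∀ s, A s → ∃ p : G.DiPath k (G.src (f s)), p.IsLexFirst π ∧
        distAt π σ k (G.src (f s)) = p.length := by
      intro s hs
      rcases hfin (G.src (f s)) with h | h | h
      · exact h.2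
      · exact absurd hs h.1
      · exact absurd (hAdj s) h
    rcases hJ1 with ⟨-, h2⟩ | ⟨i₀, h1, h2, h3, -, h5⟩
    -- There is a candidate: the last edge of any path from `k` to `v`.
    · exfalso
      obtain ⟨p⟩ := hanc.nonempty_diPath
      cases p with
      | nil => exact hG _ hanc
      | snoc p e hs ht =>
        subst hs
        obtain ⟨s, rfl⟩ := hsurj e ht
        exact h2 s s.2 (hA s ⟨p⟩)
    · obtain ⟨p, hp, hpl⟩ := hDist i₀ h1
      refine ⟨f i₀, ⟨htgt i₀, p, hG.snoc_isLexFirst p hp _ _ _ ?_ ?_⟩, h2, h3⟩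
      · intro e r ht hr
        obtain ⟨s, rfl⟩ := hsurj e ht
        have hs := hA s ⟨r⟩
        obtain ⟨p', hp', hpl'⟩ := hDist s hs
        have : p'.length = r.length := le_antisymm (hp'.isShortest r) (hr p')
        have h6 := h5 s s.2 hs
        simp only [D, q, hpl, hpl', this] at h6
        rcases h6 with h6 | ⟨h6, h7⟩
        · exact ⟨h6.le, fun h => absurd h h6.ne⟩
        · exact ⟨h6.le, fun _ => by rw [Fin.le_def]; omega⟩
      · intro e ht hr
        obtain ⟨s, rfl⟩ := hsurj e ht
        obtain ⟨p', hp', -⟩ := hDist s (hA s hr)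
        exact ⟨p', hp'.isShortest⟩

end APSP

namespace APSP

open RealRAM WDigraph

variable {n m W : ℕ} {G : WDigraph n m} {π : Fin n ≃ Fin n} {σ τ ρ : Mem}

theorem num_eq_iff {x y : Fin n} : (π x : ℕ) + 1 = π y + 1 ↔ x = y := by
  simp [← Fin.ext_iff]

/-! ## The addition of a path -/

/-- The tree of `v` while paths are added to it: `u` is the next vertex of the current path. -/
structure Growing (G : WDigraph n m) (π : Fin n ≃ Fin n) (v : Fin n) (cur : Fin n → Prop)
    (σ : Mem) : Prop where
  entries : ∀ u, G.Ancestor u v → nextAt π σ u v = 0 ∨ Entry G π σ u v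
  closed : ∀ u y, G.Ancestor u v → nextAt π σ u v = π y + 1 →
    y = v ∨ cur y ∨ nextAt π σ y v ≠ 0

/-- Entering one vertex into a growing tree. -/
theorem Growing.fill {v x y : Fin n} {cur : Fin n → Prop} (h : Growing G π v cur σ)
    (hf : Fills G π σ τ x v) (hy : nextAt π τ x v = π y + 1) (hc : ∀ z, cur z → z = x) :
    Growing G π v (· = y) τ := by
  refine ⟨hf.entries h.entries, fun u z hu hz => ?_⟩
  by_cases hux : u = x
  · subst hux
    rw [hz, num_eq_iff] at hy
    exact .inr (.inl hy)
  · rw [hf.next_eq u v (fun h => hux h.1)] at hz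
    rcases h.closed u z hu hz with h1 | h1 | h1
    · exact .inl h1
    · rw [hc z h1]; exact .inr (.inr hf.next_ne)
    · exact .inr (.inr (hf.mono h1))

theorem Growing.imp {v : Fin n} {cur cur' : Fin n → Prop} (h : Growing G π v cur σ)
    (hc : ∀ y, cur y → y = v ∨ cur' y ∨ nextAt π σ y v ≠ 0) : Growing G π v cur' σ := by
  refine ⟨h.entries, fun u y hu hy => ?_⟩
  rcases h.closed u y hu hy with h1 | h1 | h1
  · exact .inl h1
  · exact hc y h1
  · exact .inr (.inr h1)

/-- The walk follows the lexicographically-first path from `k` to `v`. At each vertex `x` the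
remaining part is lexicographically first as well, so the entry of `x` in the column of the last but
one vertex gives the next vertex. Stopping at a vertex that already has a successor does no harm,
since the entered vertices are closed under successors. Each round enters a new vertex; so the time
is bounded by the growth of `filled`, up to a constant. -/
theorem runs_addPath (hW : (n + 2) ^ 2 ≤ W) (hG : G.IsAcyclic) {k v : Fin n} {e : Fin m}
    {ht : G.tgt e = v} {p : G.DiPath k (G.src e)} (hp : (DiPath.snoc p e rfl ht).IsLexFirst π)
    (hn : σ.ireg rN = n) (hi : σ.ireg rI = π v + 1) (hk : σ.ireg rK = π k + 1)
    (hj : σ.ireg rJ = π (G.src e) + 1) (hw : σ.rreg rW = G.weight e)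
    (hcol : ∀ u, G.Ancestor u (G.src e) → Entry G π σ u (G.src e))
    (hg : Growing G π v (fun _ => False) σ) :
    Runs W addPath σ fun τ t => Outside G π v σ τ ∧ Growing G π v (fun _ => False) τ ∧
      (∀ u, nextAt π σ u v ≠ 0 → nextAt π τ u v ≠ 0) ∧ nextAt π τ k v ≠ 0 ∧
      t + 100 * filled G π σ v ≤ 100 * filled G π τ v + 100 := by
  have hle : ∀ x : Fin n, (π x : ℕ) + 1 ≤ n := fun x => (π x).2
  have hcf : ∀ x y : Fin n, CellFits W n (π x + 1) (π y + 1) := fun x y =>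
    CellFits.mk hW (hle x) ((hle y).trans (by omega))
  have hjv : G.src e ≠ v := by
    intro h
    exact hG v (.single ⟨e, h, ht⟩)
  have hancj : G.Ancestor (G.src e) v := .single ⟨e, rfl, ht⟩
  simp only [addPath, block_cons_cons, block_single, runs_seq]
  simp [hk]
  refine runs_while (fun τ t => ∃ x : Fin n, τ.ireg rCur = π x + 1 ∧
      (∃ q : G.DiPath x (G.src e), (DiPath.snoc q e rfl ht).IsLexFirst π) ∧
      Outside G π v σ τ ∧ Growing G π v (· = x) τ ∧
      (∀ u, nextAt π σ u v ≠ 0 → nextAt π τ u v ≠ 0) ∧ (k = x ∨ nextAt π τ k v ≠ 0) ∧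
      -- The potential never exceeds `n`, which bounds the time spent in the loop.
      t + 100 * filled G π σ v ≤ 100 * filled G π τ v) (100 * n) ?_ ?_ ?_
  · refine ⟨k, by simp, ⟨p, hp⟩, Outside.refl _ _, ?_, fun _ h => h, .inl rfl, ?_⟩
    · have h := hg.imp (cur' := (· = k)) (by simp)
      exact ⟨h.entries, h.closed⟩
    · exact (Nat.zero_add _).le
  · rintro τ t ⟨x, -, -, -, -, -, -, h⟩
    have h1 : filled G π τ v ≤ n := (filled_le v).trans
      ((Set.ncard_le_ncard (Set.subset_univ _)).trans (by simp [Set.ncard_univ]))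
    omega
  · rintro τ t hF ⟨x, hx, ⟨q, hq⟩, ho, hgr, hmono, hkx, htm⟩
    have hn' : τ.ireg 0 = n := (hF.ireg rN rfl).trans (by simpa using hn)
    have hi' : τ.ireg 3 = π v + 1 := (hF.ireg rI rfl).trans (by simpa using hi)
    have hj' : τ.ireg 5 = π (G.src e) + 1 := (hF.ireg rJ rfl).trans (by simpa using hj)
    have hw' : τ.rreg 2 = G.weight e := (hF.rreg rW rfl).trans (by simpa using hw)
    have hnx : τ.iarr 7 (cell n (π v + 1) (π x + 1)) = nextAt π τ x v := rfl
    have hxv : G.Ancestor x v := by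
      rcases q.eq_or_ancestor with h | h
      · rw [h]; exact hancj
      · exact h.tail ⟨e, rfl, ht⟩
    simp only [rCur] at hx
    simp [hn', hi', hx, hj', hcf, hnx, ← Fin.ext_iff, runs_ite, hw']
    constructor
    · intro hxj hx0
      obtain ⟨f, hf⟩ := q.exists_firstEdge hxj
      have hxancj : G.Ancestor x (G.src e) := q.eq_or_ancestor.resolve_left hxj
      -- The column of the last but one vertex is not touched while the tree of `v` grows, so its
      -- entries are still correct.
      obtain ⟨-, p', hp', hd', f', hf', hn'⟩ :=
        (hcol x hxancj).outside ho hjv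
      obtain rfl : p' = q := hG.isLexFirst_unique _ _ hp' hq.2.2
      obtain rfl : f' = f := by rw [hf] at hf'; exact (Option.some.inj hf').symm
      simp only [distAt, nextAt, aDist, aNext] at hd' hn'
      simp only [hd', hn']
      obtain ⟨q', hq'⟩ := hG.isLexFirst_step hq hf
      generalize hρ : Mem.setIReg _ rCur _ = ρ
      have key : Fills G π τ ρ x v := by
        subst hρ
        refine ⟨?_, ?_, ?_, ⟨?_, _, hq, ?_, f', ?_, ?_⟩, hxv⟩
        · intro u y
          simp [finAt, cell_inj (Nat.succ_le_of_lt (π y).2) (hle v), ← Fin.ext_iff]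
        · intro u y huy
          simp [distAt, cell_inj (Nat.succ_le_of_lt (π y).2) (hle v), ← Fin.ext_iff]
          intro h h'; exact absurd ⟨h, h'⟩ huy
        · intro u y huy
          simp [nextAt, cell_inj (Nat.succ_le_of_lt (π u).2) (hle x), ← Fin.ext_iff]
          intro h h'; exact absurd ⟨h', h⟩ huy
        · simp [finAt]
        · simp [distAt, DiPath.length]
        · rw [DiPath.firstEdge_snoc _ _ _ _ hxj, hf]
        · simp [nextAt]
      have hnext : nextAt π ρ x v = π (G.tgt f') + 1 := by subst hρ; simp [nextAt]
      have hfill := key.filled_eq hx0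
      refine ⟨G.tgt f', ?_, ⟨q', hq'⟩, ho.trans key.outside, hgr.fill key hnext (fun _ h => h),
        fun u hu => key.mono (hmono u hu), .inr ?_, ?_⟩
      · subst hρ; simp
      · rcases hkx with rfl | h
        · exact key.next_ne
        · exact key.mono h
      · omega
    · intro hex
      have hnj : τ.iarr 7 (cell n (π v + 1) (π (G.src e) + 1)) = nextAt π τ (G.src e) v := rfl
      simp only [hnj]
      constructor
      · intro hj0
        have hq1 : (DiPath.snoc (DiPath.nil : G.DiPath (G.src e) (G.src e)) e rfl ht).IsLexFirst
            π :=
          DiPath.IsLexFirst.of_comp hG q (DiPath.snoc DiPath.nil e rfl ht) hq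
        generalize hρ : Mem.setIArr _ 7 _ _ = ρ
        have key : Fills G π τ ρ (G.src e) v := by
          subst hρ
          refine ⟨?_, ?_, ?_, ⟨?_, _, hq1, ?_, e, rfl, ?_⟩, hancj⟩
          · intro u y
            simp [finAt, cell_inj (Nat.succ_le_of_lt (π y).2) (hle v), ← Fin.ext_iff]
          · intro u y huy
            simp [distAt, cell_inj (Nat.succ_le_of_lt (π y).2) (hle v), ← Fin.ext_iff]
            intro h h'; exact absurd ⟨h, h'⟩ huy
          · intro u y huy
            simp [nextAt, cell_inj (Nat.succ_le_of_lt (π u).2) (hle (G.src e)), ← Fin.ext_iff]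
            intro h h'; exact absurd ⟨h', h⟩ huy
          · simp [finAt]
          · simp [distAt, DiPath.length]
          · simp [nextAt, ht]
        have hnext : nextAt π ρ (G.src e) v = π v + 1 := by subst hρ; simp [nextAt]
        have hfill := key.filled_eq hj0
        -- Whichever condition ended the loop, the pending vertex `x` is in the tree now; so the
        -- tree is again closed under successors without an exception.
        have hx : nextAt π ρ x v ≠ 0 := by
          by_cases hxj : x = G.src e
          · rw [hxj]; exact key.next_ne
          · exact key.mono (hex hxj)
        refine ⟨ho.trans key.outside, ⟨key.entries hgr.entries, fun u y hu hy => ?_⟩,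
          fun u hu => key.mono (hmono u hu), ?_, by omega⟩
        · by_cases huj : u = G.src e
          · subst huj
            rw [hnext, num_eq_iff] at hy
            exact .inl hy.symm
          · rw [key.next_eq u v (fun h => huj h.1)] at hy
            rcases hgr.closed u y hu hy with h | rfl | h
            · exact .inl h
            · exact .inr (.inr hx)
            · exact .inr (.inr (key.mono h))
        · rcases hkx with rfl | h
          · exact hx
          · exact key.mono h
      · intro hj0
        have hx : nextAt π τ x v ≠ 0 := by
          by_cases hxj : x = G.src e
          · rw [hxj]; exact hj0
          · exact hex hxj
        refine ⟨ho, hgr.imp fun y hy => .inr (.inr (hy ▸ hx)), hmono, ?_, by omega⟩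
        rcases hkx with rfl | h
        · exact hx
        · exact h

end APSP

namespace APSP

open RealRAM WDigraph

variable {n m W : ℕ} {G : WDigraph n m} {π : Fin n ≃ Fin n} {σ τ ρ : Mem}

/-! ## The main loop -/

/-- The list of the ancestors of `v` is in the memory. -/
structure AncList (G : WDigraph n m) (π : Fin n ≃ Fin n) (σ : Mem) (v : Fin n) {a : ℕ}
    (g : Fin a → Fin n) : Prop where
  mono : StrictMono fun s => π (g s)
  range : Set.range g = {u | G.Ancestor u v}
  count : σ.iarr aAncCount (π v + 1) = a
  anc : ∀ s : Fin a, σ.iarr aAnc (cell n (π v + 1) (s + 1)) = π (g s) + 1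

namespace AncList

variable {v : Fin n} {a : ℕ} {g : Fin a → Fin n}

theorem inj (h : AncList G π σ v g) : Function.Injective g := fun s s' hs =>
  h.mono.injective (by simp [hs])

theorem card (h : AncList G π σ v g) : {u | G.Ancestor u v}.ncard = a := by
  rw [← h.range, ← Set.image_univ, Set.ncard_image_of_injective _ h.inj]
  simp [Set.ncard_univ]

theorem le (h : AncList G π σ v g) : a ≤ n := by
  simpa using Fintype.card_le_of_injective _ h.inj

theorem ancestor (h : AncList G π σ v g) (s : Fin a) : G.Ancestor (g s) v := by
  have : g s ∈ Set.range g := ⟨s, rfl⟩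
  rw [h.range] at this
  exact this

theorem exists_index (h : AncList G π σ v g) {u : Fin n} (hu : G.Ancestor u v) :
    ∃ s, g s = u := by
  have : u ∈ Set.range g := by rw [h.range]; exact hu
  exact this

end AncList

theorem runs_initNext (hW : (n + 2) ^ 2 ≤ W) {v : Fin n} {a : ℕ} {g : Fin a → Fin n}
    (hA : AncList G π σ v g) (hn : σ.ireg rN = n) (hi : σ.ireg rI = π v + 1) :
    Runs W initNext σ fun τ t => Outside G π v σ τ ∧
      (∀ u, G.Ancestor u v → nextAt π τ u v = 0) ∧ t ≤ 60 * (a + 1) := by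
  have hle : ∀ x : Fin n, (π x : ℕ) + 1 ≤ n := fun x => (π x).2
  have ha := hA.le
  simp only [initNext, block_cons_cons, block_single, runs_seq]
  simp
  refine runs_upto rT 1 a (fun s τ t => Outside G π v σ τ ∧
    (∀ s' : Fin a, (s' : ℕ) + 1 < s → nextAt π τ (g s') v = 0) ∧ t + 40 ≤ s * 40) (by omega)
    (by simp) ⟨Outside.refl _ _, by omega, by omega⟩ ?_ ?_ ?_
  · intro s τ t _ _ hF _
    have h1 : τ.ireg 3 = π v + 1 := (hF.ireg rI rfl).trans (by simpa using hi)
    have h2 : τ.iarr 5 = σ.iarr 5 := hF.iarr 5 rfl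
    exact ⟨trivial, by simp [h1, h2]; exact hA.count⟩
  · rintro s τ t s1 s2 hF hs ⟨hJ1, hJ2, hJ3⟩
    have hi' : τ.ireg 3 = π v + 1 := (hF.ireg rI rfl).trans (by simpa using hi)
    have hn' : τ.ireg 0 = n := (hF.ireg rN rfl).trans (by simpa using hn)
    have ha6 : τ.iarr 6 = σ.iarr 6 := hF.iarr 6 rfl
    obtain ⟨s', rfl⟩ : ∃ s', s = s' + 1 := ⟨s - 1, by omega⟩
    have hs' : s' < a := by omega
    have ht := hA.anc ⟨s', hs'⟩
    simp only [aAnc] at ht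
    have c1 : CellFits W n (π v + 1) (s' + 1) := CellFits.mk hW (hle v) (by omega)
    have c2 : CellFits W n (π v + 1) (π (g ⟨s', hs'⟩) + 1) :=
      CellFits.mk hW (hle v) ((hle _).trans (by omega))
    have c3 : s' + 1 + 1 < W := lt_word hW (by omega)
    simp [hn', hi', hs, ha6, ht, c1, c2, c3]
    refine ⟨hJ1.trans fun x y hxy => ⟨?_, ?_, ?_⟩, fun s₂ hs₂ => ?_, by omega⟩
    · simp [finAt]
    · simp [distAt]
    · simp [nextAt, cell_inj (Nat.succ_le_of_lt (π x).2) (hle (g ⟨s', hs'⟩)), ← Fin.ext_iff]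
      rintro rfl rfl
      rcases hxy with h | h
      · exact absurd rfl h
      · exact absurd (hA.ancestor _) h
    · simp only [nextAt, Mem.setIReg_iarr, Mem.setIArr_iarr, aNext, true_and]
      split_ifs with hc
      · rfl
      · refine hJ2 s₂ ?_
        rcases Nat.lt_or_eq_of_le hs₂ with h | h
        · omega
        · exact absurd (by rw [show s₂ = ⟨s', hs'⟩ from Fin.ext h]) hc
  · rintro τ t hF hs ⟨hJ1, hJ2, hJ3⟩
    refine ⟨hJ1, fun u hu => ?_, by simp; omega⟩
    obtain ⟨s, rfl⟩ := hA.exists_index hu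
    exact hJ2 s (by omega)

/-- The tables are correct for the vertices in `done`, and show no distances for other pairs than
ancestors. -/
structure Partial (G : WDigraph n m) (π : Fin n ≃ Fin n) (done : Fin n → Prop) (σ : Mem) :
    Prop where
  infinite : ∀ u v, ¬ (u = v ∨ G.Ancestor u v) → finAt π σ u v = 0
  diag : ∀ v, finAt π σ v v = 1 ∧ distAt π σ v v = 0
  col : ∀ v, done v → ∀ u, G.Ancestor u v → Entry G π σ u v

theorem Partial.outside {done : Fin n → Prop} (hG : G.IsAcyclic) {v : Fin n}
    (h : Partial G π done σ) (ho : Outside G π v σ τ) (hv : ¬ done v) : Partial G π done τ := by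
  refine ⟨fun u w huw => ?_, fun w => ?_, fun w hw u hu => ?_⟩
  · rw [(ho u w ?_).1, h.infinite u w huw]
    by_contra hcon
    simp only [not_or, not_not] at hcon
    exact huw (.inr (hcon.1 ▸ hcon.2))
  · have : w ≠ v ∨ ¬ G.Ancestor w v := by
      by_contra hcon
      simp only [not_or, not_not] at hcon
      exact hG v (hcon.1 ▸ hcon.2)
    rw [(ho w w this).1, (ho w w this).2.1]
    exact h.diag w
  · exact (h.col w hw u hu).outside ho (fun h => hv (h ▸ hw))

/-- The loop of `mainLoop` over the ancestors of one vertex. -/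
def treeLoop : Cmd :=
  .while (ile (.reg rT) (.arr aAncCount (.reg rI))) (block [
    .iset rK (.arr aAnc (cellE (.reg rI) (.reg rT))),
    .ite (.ieq (.arr aNext (cellE (.reg rI) (.reg rK))) (.const 0))
      (block [chooseLast, addPath])
      .skip,
    incr rT])

/-- The charging argument: each search for a last edge, of cost proportional to `d + 1`, is charged
to the ancestor `k` that caused it, and such a `k` is a leaf of `T_v`. The walks are paid for by the
potential `filled`, which ends at `a` at most, and everything else costs a constant for each
ancestor. -/
theorem runs_treeLoop (hW : (n + 2) ^ 2 ≤ W) (hG : G.IsAcyclic) (hπ : G.IsNumbering π)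
    {v : Fin n} {a d : ℕ} {f : Fin d → Fin m} {g : Fin a → Fin n} {done : Fin n → Prop}
    (hdone : ∀ x, G.Adj x v → done x) (hv : ¬ done v) (hP : Partial G π done σ)
    (hL : InList G π σ v f) (hA : AncList G π σ v g)
    (hn : σ.ireg rN = n) (hi : σ.ireg rI = π v + 1) (hT : σ.ireg rT = 1)
    (h0 : ∀ u, G.Ancestor u v → nextAt π σ u v = 0) :
    Runs W treeLoop σ fun τ t => Outside G π v σ τ ∧ (∀ u, G.Ancestor u v → Entry G π τ u v) ∧
      t ≤ 600 * (a + 1) + 120 * (d * (G.leaves π v).ncard) := by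
  have hle : ∀ x : Fin n, (π x : ℕ) + 1 ≤ n := fun x => (π x).2
  have ha := hA.le
  unfold treeLoop
  -- The set `Ch` contains the vertices charged so far. They are leaves of `T_v` and have a
  -- successor by now, so that none of them is charged twice.
  refine runs_upto rT 1 a (fun s τ t => Outside G π v σ τ ∧ Growing G π v (fun _ => False) τ ∧
    (∀ s' : Fin a, (s' : ℕ) + 1 < s → nextAt π τ (g s') v ≠ 0) ∧
    ∃ Ch : Finset (Fin n), ↑Ch ⊆ G.leaves π v ∧ (∀ u ∈ Ch, nextAt π τ u v ≠ 0) ∧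
      t + 450 ≤ s * 450 + 100 * filled G π τ v + 120 * (d * Ch.card)) (by omega)
    hT ⟨Outside.refl _ _, ⟨fun u hu => .inl (h0 u hu), fun u y hu hy => ?_⟩, by omega,
      ∅, by simp, by simp, by omega⟩ ?_ ?_ ?_
  · rw [h0 u hu] at hy; omega
  · intro s τ t _ _ hF _
    have h1 : τ.ireg 3 = π v + 1 := (hF.ireg rI rfl).trans (by simpa using hi)
    have h2 : τ.iarr 5 = σ.iarr 5 := hF.iarr 5 rfl
    exact ⟨trivial, by simp [h1, h2]; exact hA.count⟩
  · rintro s τ t s1 s2 hF hs ⟨hJ1, hJ2, hJ3, Ch, hCh, hCh', htm⟩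
    have hi' : τ.ireg 3 = π v + 1 := (hF.ireg rI rfl).trans (by simpa using hi)
    have hn' : τ.ireg 0 = n := (hF.ireg rN rfl).trans (by simpa using hn)
    have ha6 : τ.iarr 6 = σ.iarr 6 := hF.iarr 6 rfl
    obtain ⟨s', rfl⟩ : ∃ s', s = s' + 1 := ⟨s - 1, by omega⟩
    have hs' : s' < a := by omega
    have ht := hA.anc ⟨s', hs'⟩
    have hanc := hA.ancestor ⟨s', hs'⟩
    simp only [aAnc] at ht
    set k := g ⟨s', hs'⟩ with hk
    have c1 : CellFits W n (π v + 1) (s' + 1) := CellFits.mk hW (hle v) (by omega)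
    have c2 : CellFits W n (π v + 1) (π k + 1) := CellFits.mk hW (hle v) ((hle _).trans (by omega))
    have c3 : s' + 1 + 1 < W := lt_word hW (by omega)
    have hnk : τ.iarr 7 (cell n (π v + 1) (π k + 1)) = nextAt π τ k v := rfl
    simp [hn', hi', hs, ha6, ht, c1, c2, runs_ite, hnk]
    set τ₁ := τ.setIReg 4 (π k + 1) with hτ₁
    constructor
    · intro hk0
      have hP' : Partial G π done τ := hP.outside hG hJ1 hv
      -- Suppose that a tree edge `e` enters `k`. Its tail is an ancestor of `v` with a lower
      -- number, so it has been treated; its correct entry points to `k`. As the tree is closed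
      -- under successors, `k` would have been entered too.
      have hkleaf : k ∈ G.leaves π v := by
        obtain ⟨p, hp⟩ := hG.exists_isLexFirst π k v hanc.nonempty_diPath
        refine mem_leaves_of_forall hp fun e he htk => ?_
        have hev : G.Ancestor (G.src e) v := Relation.TransGen.head ⟨e, rfl, htk⟩ hanc
        obtain ⟨s₂, hs₂⟩ := hA.exists_index hev
        have hlt : s₂ < ⟨s', hs'⟩ := by
          rw [← hA.mono.lt_iff_lt]
          simp only [hs₂, ← hk, ← htk]
          exact hπ.topological _ _ ⟨e, rfl, rfl⟩
        have hne := hJ3 s₂ (Nat.succ_lt_succ (Fin.lt_def.1 hlt))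
        rw [hs₂] at hne
        obtain ⟨-, p', hp', -, e', he', hn'⟩ := (hJ2.entries _ hev).resolve_left hne
        obtain rfl : e = e' := by
          have := (hG.mem_treeEdges_iff hp' e).1 ⟨he, rfl⟩
          rw [he'] at this
          exact (Option.some.inj this).symm
        rw [htk] at hn'
        rcases hJ2.closed _ _ hev hn' with h | h | h
        · rw [h] at hanc; exact hG v hanc
        · exact h
        · exact h hk0
      have hL' : InList G π τ₁ v f := by
        refine ⟨hL.inj, hL.range, ?_, fun s => ?_, fun s => ?_⟩
        · rw [← hL.deg]; exact congrFun (hF.iarr 3 rfl) _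
        · rw [← hL.tail s]; exact congrFun (hF.iarr 4 rfl) _
        · rw [← hL.weight s]; exact congrFun (hF.rarr 1 rfl) _
      refine (runs_chooseLast hW hG hL' (k := k) (by simp [hτ₁, hn']) (by simp [hτ₁, hi'])
        (by simp [hτ₁]) ?_ hanc).imp ?_
      · intro x
        by_cases hkx : G.Adj x v
        · by_cases hx : k = x ∨ G.Ancestor k x
          · left
            rcases hx with rfl | hx
            · exact ⟨(hP'.diag k).1, .nil, hG.nil_isLexFirst π k, (hP'.diag k).2⟩
            · obtain ⟨h1, p, h2, h3, -⟩ := hP'.col x (hdone x hkx) k hx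
              exact ⟨h1, p, h2, h3⟩
          · refine .inr (.inl ⟨?_, ?_⟩)
            · have : finAt π τ₁ k x = finAt π τ k x := rfl
              rw [this, hP'.infinite k x hx]; simp
            · rw [← not_nonempty_iff, nonempty_diPath_iff]; exact hx
        · exact .inr (.inr hkx)
      · rintro ρ r hF' ⟨hr, e, hte, p, hp, hj, hw⟩
        have hfin : ρ.iarr 8 = τ.iarr 8 := hF'.iarr 8 rfl
        have hnext : ρ.iarr 7 = τ.iarr 7 := hF'.iarr 7 rfl
        have hdist : ρ.rarr 2 = τ.rarr 2 := hF'.rarr 2 rfl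
        have h1 : ∀ u v, finAt π ρ u v = finAt π τ u v := fun u v => congrFun hfin _
        have h2 : ∀ u v, nextAt π ρ u v = nextAt π τ u v := fun u v => congrFun hnext _
        have h3 : ∀ u v, distAt π ρ u v = distAt π τ u v := fun u v => congrFun hdist _
        have hent : ∀ u v, Entry G π τ u v → Entry G π ρ u v := fun u v h =>
          h.congr (h1 u v) (h3 u v) (h2 u v)
        refine (runs_addPath hW hG hp ?_ ?_ ?_ hj hw ?_ ?_).imp ?_
        · rw [hF'.ireg rN rfl]; simp [hτ₁, hn']
        · rw [hF'.ireg rI rfl]; simp [hτ₁, hi']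
        · rw [hF'.ireg rK rfl]; simp [hτ₁]
        · exact fun u hu => hent _ _ (hP'.col _ (hdone _ ⟨e, rfl, hte⟩) u hu)
        · refine ⟨fun u hu => ?_, fun u y hu hy => ?_⟩
          · rw [h2]; exact (hJ2.entries u hu).imp_right (hent u v)
          · rw [h2] at hy ⊢; exact hJ2.closed u y hu hy
        · rintro ρ' r' hF'' ⟨ho, hg, hmono, hk', hr'⟩
          have hs'' : ρ'.ireg 6 = s' + 1 := by
            rw [hF''.ireg 6 rfl, hF'.ireg 6 rfl]; simp [hτ₁, hs]
          simp only [h2] at hmono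
          simp [hs'', c3]
          refine ⟨hJ1.trans fun x y hxy => ?_, ⟨hg.entries, hg.closed⟩, fun s₂ hs₂ => ?_,
            insert k Ch, ?_, ?_, ?_⟩
          · obtain ⟨h4, h5, h6⟩ := ho x y hxy
            rw [h1] at h4; rw [h2] at h6; rw [h3] at h5
            exact ⟨h4, h5, h6⟩
          · rcases Nat.lt_or_eq_of_le hs₂ with h | h
            · exact hmono _ (hJ3 s₂ (by omega))
            · rw [show s₂ = ⟨s', hs'⟩ from Fin.ext h]; exact hk'
          · rw [Finset.coe_insert]; exact Set.insert_subset hkleaf hCh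
          · intro u hu
            rcases Finset.mem_insert.1 hu with rfl | hu
            · exact hk'
            · exact hmono u (hCh' u hu)
          -- Charged vertices already had a successor before this round, while `k` had none.
          · have hkCh : k ∉ Ch := fun h => hCh' k h hk0
            have hf1 : filled G π ρ v = filled G π τ v := by simp only [filled, h2]
            have hf2 : filled G π (ρ'.setIReg 6 (s' + 1 + 1)) v = filled G π ρ' v := rfl
            rw [Finset.card_insert_of_notMem hkCh, hf2]
            rw [hf1] at hr'
            have : d * (Ch.card + 1) = d * Ch.card + d := by ring
            omega
    · intro hk0
      simp [hτ₁, c3]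
      refine ⟨hJ1, ⟨hJ2.entries, hJ2.closed⟩, fun s₂ hs₂ => ?_, Ch, hCh, hCh', ?_⟩
      · rcases Nat.lt_or_eq_of_le hs₂ with h | h
        · exact hJ3 s₂ (by omega)
        · rw [show s₂ = ⟨s', hs'⟩ from Fin.ext h]; exact hk0
      · have hf2 : filled G π (τ₁.setIReg 6 (s' + 1 + 1)) v = filled G π τ v := rfl
        have hf3 : filled G π ((τ.setIReg 4 (↑(π k) + 1)).setIReg 6 (s' + 1 + 1)) v =
          filled G π τ v := rfl
        omega
  · rintro τ t hF hs ⟨hJ1, hJ2, hJ3, Ch, hCh, hCh', htm⟩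
    refine ⟨hJ1, fun u hu => ?_, ?_⟩
    · obtain ⟨s, rfl⟩ := hA.exists_index hu
      exact (hJ2.entries _ hu).resolve_left (hJ3 s (by omega))
    · have h1 : Ch.card ≤ (G.leaves π v).ncard := by
        rw [← Set.ncard_coe_finset]
        exact Set.ncard_le_ncard hCh (Set.toFinite _)
      have h2 : filled G π τ v ≤ a := (filled_le v).trans hA.card.le
      have h3 := Nat.mul_le_mul_left d h1
      simp; omega

end APSP

/-! ### The loop over all vertices that are not sources. -/

namespace APSP

open RealRAM WDigraph

variable {n m W : ℕ} {G : WDigraph n m} {π : Fin n ≃ Fin n} {σ τ ρ : Mem}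

theorem Numbered.exists_inList (h : Numbered G π σ) (v : Fin n) :
    ∃ (d : ℕ) (f : Fin d → Fin m), InList G π σ v f := by
  obtain ⟨d, f, h1, h2, h3, h4, h5⟩ := h.inEdges_eq v
  exact ⟨d, f, h1, h2, h3, h4, h5⟩

theorem AncestorsListed.exists_ancList (h : AncestorsListed G π σ) (v : Fin n) :
    ∃ (a : ℕ) (g : Fin a → Fin n), AncList G π σ v g := by
  obtain ⟨d, f, h1, h2, h3, h4⟩ := h.anc_eq v
  exact ⟨d, f, h1, h2, h3, h4⟩

theorem InList.congr {v : Fin n} {d : ℕ} {f : Fin d → Fin m} (h : InList G π σ v f)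
    (h3 : τ.iarr 3 = σ.iarr 3) (h4 : τ.iarr 4 = σ.iarr 4) (h1 : τ.rarr 1 = σ.rarr 1) :
    InList G π τ v f := by
  refine ⟨h.inj, h.range, ?_, fun s => ?_, fun s => ?_⟩
  · rw [← h.deg]; exact congrFun h3 _
  · rw [← h.tail s]; exact congrFun h4 _
  · rw [← h.weight s]; exact congrFun h1 _

theorem AncList.congr {v : Fin n} {a : ℕ} {g : Fin a → Fin n} (h : AncList G π σ v g)
    (h5 : τ.iarr 5 = σ.iarr 5) (h6 : τ.iarr 6 = σ.iarr 6) : AncList G π τ v g := by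
  refine ⟨h.mono, h.range, ?_, fun s => ?_⟩
  · rw [← h.count]; exact congrFun h5 _
  · rw [← h.anc s]; exact congrFun h6 _

theorem not_ancestor_of_isSource {u v : Fin n} (hv : G.IsSource v) : ¬ G.Ancestor u v := by
  intro h
  rcases Relation.TransGen.tail'_iff.1 h with ⟨x, -, e, -, he⟩
  exact hv e he

/-- In topological order all direct ancestors of a vertex are finished before its own turn. The time
is bounded by a sum over the vertices treated so far, in which a vertex contributes a multiple of `n
+ 1` and its product of indegree and number of leaves. -/
theorem runs_mainLoop (hW : (n + 2) ^ 2 ≤ W) (hG : G.IsAcyclic) (hπ : G.IsNumbering π)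
    (hσ : AncestorsListed G π σ) (hP : Partial G π G.IsSource σ) :
    Runs W mainLoop σ fun τ t => Output G π τ ∧
      t ≤ 1000 * (n + 1) ^ 2 + 120 * G.leafSum π := by
  have hle : ∀ x : Fin n, (π x : ℕ) + 1 ≤ n := fun x => (π x).2
  have hn : σ.ireg 0 = n := hσ.numbered.loaded.n_eq
  have hR : σ.ireg 2 = {v | G.IsSource v}.ncard := hσ.numbered.sources_eq
  have hRn : {v | G.IsSource v}.ncard ≤ n :=
    (Set.ncard_le_ncard (Set.subset_univ _)).trans (by simp [Set.ncard_univ])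
  have hR1 : {v | G.IsSource v}.ncard + 1 < W := lt_word hW (by omega)
  unfold mainLoop
  simp only [block_cons_cons, block_single, runs_seq]
  simp [hR, hR1]
  refine runs_upto rI _ n (fun i τ t => Partial G π (fun v => (π v : ℕ) + 1 < i ∨ G.IsSource v) τ ∧
    t ≤ ∑ v with (π v : ℕ) + 1 < i, (900 * (n + 1) + 120 * (G.indeg v * (G.leaves π v).ncard)))
    (Nat.succ_le_succ hRn) (by simp) ⟨⟨hP.infinite, hP.diag, ?_⟩, by omega⟩ ?_ ?_ ?_
  -- A vertex whose number does not exceed the number of sources is a source; it has no ancestors,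
  -- and its column is vacuously correct.
  · rintro v (hv | hv)
    · refine hP.col v ?_
      by_contra hs
      have := ncard_sources_le hπ hs
      omega
    · exact hP.col v hv
  · intro i τ t _ _ hF _
    exact ⟨trivial, (hF.ireg 0 rfl).trans (by simpa using hn)⟩
  · rintro i τ t i1 i2 hF hi ⟨hJ1, hJ2⟩
    obtain ⟨v, rfl⟩ := exists_vertex π (by omega) i2
    obtain ⟨d, f, hL⟩ := hσ.numbered.exists_inList v
    obtain ⟨a, g, hA⟩ := hσ.exists_ancList v
    have hn' : τ.ireg 0 = n := (hF.ireg 0 rfl).trans (by simpa using hn)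
    have hLτ : InList G π τ v f := hL.congr (hF.iarr 3 rfl) (hF.iarr 4 rfl) (hF.rarr 1 rfl)
    have hAτ : AncList G π τ v g := hA.congr (hF.iarr 5 rfl) (hF.iarr 6 rfl)
    have hadj : ∀ x, G.Adj x v → ((π x : ℕ) + 1 < π v + 1 ∨ G.IsSource x) ∧ x ≠ v := by
      intro x hx
      have := Fin.lt_def.1 (hπ.topological _ _ hx)
      exact ⟨.inl (by omega), by rintro rfl; omega⟩
    -- Excluding `v` explicitly makes it unnecessary to show that `v` is not a source.
    have hP1 : Partial G π (fun x => ((π x : ℕ) + 1 < π v + 1 ∨ G.IsSource x) ∧ x ≠ v) τ :=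
      ⟨hJ1.infinite, hJ1.diag, fun w hw => hJ1.col w hw.1⟩
    rw [runs_seq]
    refine (runs_initNext hW hAτ hn' hi).imp ?_
    rintro τ₁ r hF₁ ⟨ho₁, h0, hr⟩
    rw [runs_seq, runs_iset]
    refine ⟨trivial, ?_⟩
    rw [runs_seq]
    set τ₂ := τ₁.setIReg 6 (IExp.eval τ₁ (.const 1)) with hτ₂
    have hP2 := hP1.outside hG ho₁ (fun h => h.2 rfl)
    have hP3 : Partial G π (fun x => ((π x : ℕ) + 1 < π v + 1 ∨ G.IsSource x) ∧ x ≠ v) τ₂ :=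
      ⟨hP2.infinite, hP2.diag, hP2.col⟩
    refine (runs_treeLoop hW hG hπ hadj (fun h => h.2 rfl) hP3
      (hLτ.congr (hF₁.iarr 3 rfl) (hF₁.iarr 4 rfl) (hF₁.rarr 1 rfl))
      (hAτ.congr (hF₁.iarr 5 rfl) (hF₁.iarr 6 rfl)) ?_ ?_ (by simp [hτ₂]) h0).imp ?_
    · simpa [hτ₂, hn'] using hF₁.ireg 0 rfl
    · simpa [hτ₂, hi] using hF₁.ireg 3 rfl
    · rintro τ₃ s hF₃ ⟨ho₃, hent, hs⟩
      have hi3 : τ₃.ireg 3 = π v + 1 := (hF₃.ireg 3 rfl).trans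
        (by simpa [hτ₂, hi] using hF₁.ireg 3 rfl)
      have hlt : (π v : ℕ) + 1 + 1 < W := lt_word hW (by have := hle v; omega)
      simp [hi3, hlt]
      have hP4 := hP3.outside hG ho₃ (fun h => h.2 rfl)
      refine ⟨⟨hP4.infinite, hP4.diag, fun w hw u hu => ?_⟩, ?_⟩
      · by_cases hwv : w = v
        · subst hwv; exact hent u hu
        · refine hP4.col w ⟨?_, hwv⟩ u hu
          rcases hw with hw | hw
          · left
            have : π w ≠ π v := fun h => hwv (π.injective h)
            have := Fin.val_ne_iff.2 this
            omega
          · exact .inr hw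
      · have hset : (Finset.univ.filter fun w => π w ≤ π v) =
            insert v (Finset.univ.filter fun w => (π w : ℕ) + 1 < π v + 1) := by
          ext w
          simp only [Finset.mem_filter, Finset.mem_univ, true_and, Finset.mem_insert]
          rw [← π.injective.eq_iff, Fin.ext_iff, Fin.le_def]
          omega
        rw [hset, Finset.sum_insert (by simp), hL.indeg_eq]
        have := hA.le
        omega
  · rintro τ t hF hi ⟨hJ1, hJ2⟩
    have hdone : ∀ v : Fin n, (π v : ℕ) + 1 < n + 1 ∨ G.IsSource v := fun v =>
      .inl (Nat.succ_lt_succ (π v).2)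
    refine ⟨⟨fun u => ?_, fun u v huv => ?_, fun u v huv => hJ1.infinite u v huv,
      fun u v huv => ?_⟩, ?_⟩
    · rw [← hσ.numbered.num_eq u]; exact congrFun (hF.iarr 2 rfl) _
    · by_cases h : u = v
      · subst h
        exact ⟨(hJ1.diag u).1, .nil, hG.nil_isLexFirst π u, hG.nil_isLexFirst π u, (hJ1.diag u).2⟩
      · obtain ⟨h1, p, h2, h3, -⟩ := hJ1.col v (hdone v) u (huv.resolve_left h)
        exact ⟨h1, p, h2.isShortest, h2, h3⟩
    · obtain ⟨-, p, h2, -, e, he, h3⟩ := hJ1.col v (hdone v) u huv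
      refine ⟨e, fun f => ?_, h3⟩
      rw [hG.mem_treeEdges_iff h2, he]
      simp [eq_comm]
    · have : (Finset.univ.filter fun v => (π v : ℕ) + 1 < n + 1) = Finset.univ := by
        ext v; simp
      rw [this, Finset.sum_add_distrib] at hJ2
      simp [← Finset.mul_sum] at hJ2 ⊢
      unfold leafSum
      nlinarith

/-- The predicate `Q` carries the real-valued bound on the time of the ancestors program through
estimates in natural numbers. -/
theorem runs_afterNumbering {A : Cmd} {Q : ℕ → Prop} (hW : (n + 2) ^ 2 ≤ W) (hG : G.IsAcyclic)
    (hπ : G.IsNumbering π)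
    (hA : Runs W A σ fun τ t => AncestorsListed G π τ ∧ Q t) :
    Runs W (afterNumbering A) σ fun τ t => Output G π τ ∧
      ∃ s, Q s ∧ t ≤ s + 1100 * (n + 1) ^ 2 + 120 * G.leafSum π := by
  simp only [afterNumbering, block_cons_cons, block_single, runs_seq]
  refine hA.imp ?_
  rintro τ t - ⟨hτ, hQ⟩
  refine (runs_initDist hW hτ.numbered.loaded.n_eq).imp ?_
  rintro ρ s hF ⟨h1, h2, h3⟩
  have hle : ∀ x : Fin n, (π x : ℕ) + 1 ≤ n := fun x => (π x).2
  have hnum : Numbered G π ρ := by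
    obtain ⟨⟨a1, a2, a3, a4, a5⟩, b1, b2, b3⟩ := hτ.numbered
    refine ⟨⟨(hF.ireg 0 rfl).trans a1, (hF.ireg 1 rfl).trans a2, fun e => ?_, fun e => ?_,
      fun e => ?_⟩, fun u => ?_, (hF.ireg 2 rfl).trans b2, fun v => ?_⟩
    · rw [← a3 e]; exact congrFun (hF.iarr 0 rfl) _
    · rw [← a4 e]; exact congrFun (hF.iarr 1 rfl) _
    · rw [← a5 e]; exact congrFun (hF.rarr 0 rfl) _
    · rw [← b1 u]; exact congrFun (hF.iarr 2 rfl) _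
    · obtain ⟨d, f, hL⟩ := hτ.numbered.exists_inList v
      obtain ⟨c1, c2, c3, c4, c5⟩ := hL.congr (hF.iarr 3 rfl) (hF.iarr 4 rfl) (hF.rarr 1 rfl)
      exact ⟨d, f, c1, c2, c3, c4, c5⟩
  have hanc : AncestorsListed G π ρ := by
    refine ⟨hnum, fun v => ?_⟩
    obtain ⟨a, g, hg⟩ := hτ.exists_ancList v
    obtain ⟨c1, c2, c3, c4⟩ := hg.congr (hF.iarr 5 rfl) (hF.iarr 6 rfl)
    exact ⟨a, g, c1, c2, c3, c4⟩
  have hpart : Partial G π G.IsSource ρ := by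
    refine ⟨fun u v huv => ?_, fun v => ⟨?_, ?_⟩, fun v hv u hu =>
      absurd hu (not_ancestor_of_isSource hv)⟩
    · rw [finAt, h1 _ _ (by omega) (hle u) (by omega) (hle v), if_neg]
      rw [num_eq_iff]
      exact fun h => huv (.inl h)
    · rw [finAt, h1 _ _ (by omega) (hle v) (by omega) (hle v), if_pos rfl]
    · rw [distAt, h2 _ (by omega) (hle v)]
  refine (runs_mainLoop hW hG hπ hanc hpart).imp ?_
  rintro ρ' r - ⟨h4, h5⟩
  refine ⟨h4, t, hQ, ?_⟩
  nlinarith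

end APSP

namespace APSP

open RealRAM WDigraph

variable {n m W : ℕ} {G : WDigraph n m} {π : Fin n ≃ Fin n} {σ τ ρ : Mem}

/-! ## Lists of edges in tables -/

/-- Row `r` of a two-dimensional table, whose length is `len`, holds the values of the elements of
a list. -/
def Row {α β : Type*} (n len : ℕ) (tab : ℕ → β) (r : ℕ) (val : α → β) (l : List α) : Prop :=
  len = l.length ∧ ∀ (s : ℕ) (h : s < l.length), tab (cell n r (s + 1)) = val l[s]

/-- The edges with a number below `k` and with the key `v`, in a list. -/
def KeyList (key : Fin m → Fin n) (k : ℕ) (v : Fin n) (l : List (Fin m)) : Prop :=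
  l.Nodup ∧ ∀ e, e ∈ l ↔ (e : ℕ) < k ∧ key e = v

theorem KeyList.append {key : Fin m → Fin n} {k : ℕ} {v : Fin n} {l : List (Fin m)}
    (h : KeyList key k v l) (hk : k < m) (hv : key ⟨k, hk⟩ = v) :
    KeyList key (k + 1) v (l ++ [⟨k, hk⟩]) := by
  refine ⟨List.nodup_append.2 ⟨h.1, by simp, ?_⟩, fun e => ?_⟩
  · rintro a ha b hb rfl
    rw [List.mem_singleton] at hb
    subst hb
    have := ((h.2 _).1 ha).1
    simp at this
  · rw [List.mem_append, h.2, List.mem_singleton]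
    constructor
    · rintro (h1 | rfl)
      · exact ⟨by omega, h1.2⟩
      · exact ⟨Nat.lt_succ_self k, hv⟩
    · rintro ⟨h1, h2⟩
      rcases Nat.lt_succ_iff_lt_or_eq.1 h1 with h1 | h1
      · exact .inl ⟨h1, h2⟩
      · exact .inr (Fin.ext h1)

theorem KeyList.skip {key : Fin m → Fin n} {k : ℕ} {v : Fin n} {l : List (Fin m)}
    (h : KeyList key k v l) (hk : k < m) (hv : key ⟨k, hk⟩ ≠ v) : KeyList key (k + 1) v l := by
  refine ⟨h.1, fun e => ?_⟩
  rw [h.2]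
  constructor
  · rintro ⟨h1, h2⟩; exact ⟨by omega, h2⟩
  · rintro ⟨h1, h2⟩
    rcases Nat.lt_succ_iff_lt_or_eq.1 h1 with h1 | h1
    · exact ⟨h1, h2⟩
    · exact absurd (by rw [← h2, show e = ⟨k, hk⟩ from Fin.ext h1]) hv

/-- Edges with the same key differ in the other endpoint, so the list fits into a row. The keys are
tails for the lists of outgoing edges, and heads for the lists of incoming ones. -/
theorem KeyList.length_le {key other : Fin m → Fin n} {k : ℕ} {v : Fin n} {l : List (Fin m)}
    (h : KeyList key k v l) (hinj : Function.Injective fun e => (key e, other e)) :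
    l.length ≤ n := by
  have h1 : (l.map other).Nodup := by
    refine List.Nodup.map_on ?_ h.1
    intro e he f hf hef
    exact hinj (Prod.ext (((h.2 e).1 he).2.trans ((h.2 f).1 hf).2.symm) hef)
  simpa using h1.length_le_card

theorem Row.append {α β : Type*} {len : ℕ} {tab tab' : ℕ → β} {r : ℕ} {val : α → β}
    {l : List α} {a : α} (h : Row n len tab r val l) (hl : l.length < n)
    (hnew : tab' (cell n r (l.length + 1)) = val a)
    (hold : ∀ s, s ≤ n → s ≠ l.length + 1 → tab' (cell n r s) = tab (cell n r s)) :
    Row n (len + 1) tab' r val (l ++ [a]) := by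
  refine ⟨by simp [h.1], fun s hs => ?_⟩
  by_cases hsl : s < l.length
  · rw [List.getElem_append_left hsl, hold _ (by omega) (by omega)]
    exact h.2 s hsl
  · have : s = l.length := by simp at hs; omega
    subst this
    rw [hnew]
    simp

theorem Row.congr {α β : Type*} {len : ℕ} {tab tab' : ℕ → β} {r : ℕ} {val : α → β}
    {l : List α} (h : Row n len tab r val l) (hl : l.length ≤ n)
    (hold : ∀ s, s ≤ n → tab' (cell n r s) = tab (cell n r s)) : Row n len tab' r val l :=
  ⟨h.1, fun s hs => by rw [hold _ (by omega)]; exact h.2 s hs⟩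

/-! ## The numbering of the vertices -/

abbrev aCnt : ℕ := 20
abbrev aOutDeg : ℕ := 21
abbrev aOut : ℕ := 22
abbrev aQueue : ℕ := 23
abbrev rTail : ℕ := 5
attribute [simp] aCnt aOutDeg aOut aQueue rTail

/-- Clear the counters. -/
def clearCounts : Cmd :=
  block [
    .iset rI (.const 0),
    .while (.ilt (.reg rI) (.reg rN)) (block [
      .istore aCnt (.reg rI) (.const 0),
      .istore aOutDeg (.reg rI) (.const 0),
      incr rI])]

/-- Count the incoming edges and list the outgoing edges. -/
def listOut : Cmd :=
  block [
    .iset rI (.const 0),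
    .while (.ilt (.reg rI) (.reg rM)) (block [
      .iset rK (.arr aTgt (.reg rI)),
      .istore aCnt (.reg rK) (.add (.arr aCnt (.reg rK)) (.const 1)),
      .iset rK (.arr aSrc (.reg rI)),
      .istore aOutDeg (.reg rK) (.add (.arr aOutDeg (.reg rK)) (.const 1)),
      .istore aOut (cellE (.reg rK) (.arr aOutDeg (.reg rK))) (.reg rI),
      incr rI])]

/-- Give the next number to the vertex in the register `x`. -/
def append (x : ℕ) : Cmd :=
  block [
    incr rTail,
    .istore aNum (.reg x) (.reg rTail),
    .istore aQueue (.reg rTail) (.reg x)]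

/-- Number the sources. -/
def numberSources : Cmd :=
  block [
    .iset rTail (.const 0),
    .iset rI (.const 0),
    .while (.ilt (.reg rI) (.reg rN)) (block [
      .ite (.ieq (.arr aCnt (.reg rI)) (.const 0)) (append rI) .skip,
      incr rI]),
    .iset rR (.reg rTail)]

/-- Remove the edges out of the vertex in the register `rT`. -/
def removeOut : Cmd :=
  block [
    .iset rS (.const 1),
    .while (ile (.reg rS) (.arr aOutDeg (.reg rT))) (block [
      .iset rQ (.arr aTgt (.arr aOut (cellE (.reg rT) (.reg rS)))),
      .istore aCnt (.reg rQ) (.sub (.arr aCnt (.reg rQ)) (.const 1)),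
      .ite (.ieq (.arr aCnt (.reg rQ)) (.const 0)) (append rQ) .skip,
      incr rS])]

/-- Number the other vertices. -/
def numberOthers : Cmd :=
  block [
    .iset rK (.const 1),
    .while (ile (.reg rK) (.reg rTail)) (block [
      .iset rT (.arr aQueue (.reg rK)),
      removeOut,
      incr rK])]

/-- Clear the indegrees. -/
def clearIn : Cmd :=
  block [
    .iset rI (.const 1),
    .while (ile (.reg rI) (.reg rN)) (block [
      .istore aInDeg (.reg rI) (.const 0),
      incr rI])]

/-- List the incoming edges. -/
def listIn : Cmd :=
  block [
    .iset rI (.const 0),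
    .while (.ilt (.reg rI) (.reg rM)) (block [
      .iset rK (.arr aNum (.arr aTgt (.reg rI))),
      .istore aInDeg (.reg rK) (.add (.arr aInDeg (.reg rK)) (.const 1)),
      .istore aInTail (cellE (.reg rK) (.arr aInDeg (.reg rK))) (.arr aNum (.arr aSrc (.reg rI))),
      .rstore aInWeight (cellE (.reg rK) (.arr aInDeg (.reg rK))) (.arr aWeight (.reg rI)),
      incr rI])]

/-- The computation of an admissible numbering and of the lists of incoming edges. -/
def numbering : Cmd :=
  block [clearCounts, listOut, numberSources, numberOthers, clearIn, listIn]

theorem runs_clearCounts (hW : (n + 2) ^ 2 ≤ W) (hn : σ.ireg rN = n) :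
    Runs W clearCounts σ fun τ t =>
      (∀ v < n, τ.iarr aCnt v = 0) ∧ (∀ v < n, τ.iarr aOutDeg v = 0) ∧ t ≤ 40 * (n + 1) := by
  simp only [clearCounts, block_cons_cons, block_single, runs_seq]
  simp
  refine runs_below rI 0 n (fun i τ t => (∀ v < i, τ.iarr aCnt v = 0) ∧
    (∀ v < i, τ.iarr aOutDeg v = 0) ∧ t ≤ i * 30) (by omega) (by simp) ⟨by omega, by omega,
      by omega⟩ ?_ ?_ ?_
  · intro i τ t _ _ hF _
    exact ⟨trivial, (hF.ireg 0 rfl).trans (by simpa using hn)⟩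
  · rintro i τ t i1 i2 hF hi ⟨h1, h2, h3⟩
    have hlt : i + 1 < W := lt_word hW (by omega)
    simp only [rI] at hi
    simp [hi, hlt]
    refine ⟨fun v hv hvi => h1 v (by omega), fun v hv hvi => h2 v (by omega), by omega⟩
  · rintro τ t hF hi ⟨h1, h2, h3⟩
    refine ⟨h1, h2, by simp; omega⟩

theorem runs_listOut (hW : (n + 2) ^ 2 ≤ W) (hσ : Loaded G σ)
    (h1 : ∀ v < n, σ.iarr aCnt v = 0) (h2 : ∀ v < n, σ.iarr aOutDeg v = 0) :
    Runs W listOut σ fun τ t =>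
      (∀ v : Fin n, τ.iarr aCnt v = (Finset.univ.filter fun e => G.tgt e = v).card) ∧
      (∀ u : Fin n, ∃ l, KeyList G.src m u l ∧
        Row n (τ.iarr aOutDeg u) (τ.iarr aOut) u (fun e : Fin m => (e : ℕ)) l) ∧
      t ≤ 80 * (m + 1) := by
  have hm := G.edges_le
  obtain ⟨a1, a2, a3, a4, a5⟩ := hσ
  simp only [listOut, block_cons_cons, block_single, runs_seq]
  simp
  refine runs_below rI 0 m (fun i τ t =>
    (∀ v : Fin n,
      τ.iarr aCnt v = (Finset.univ.filter fun e : Fin m => (e : ℕ) < i ∧ G.tgt e = v).card) ∧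
    (∀ u : Fin n, ∃ l, KeyList G.src i u l ∧
        Row n (τ.iarr aOutDeg u) (τ.iarr aOut) u (fun e : Fin m => (e : ℕ)) l) ∧ t ≤ i * 60)
    (by omega) (by simp) ⟨by simpa using fun v : Fin n => h1 v v.2, fun u => ⟨[], ?_, ?_, ?_⟩,
      by omega⟩ ?_ ?_ ?_
  · simp [KeyList]
  · simpa using h2 u u.2
  · intro s hs; simp at hs
  · intro i τ t _ _ hF _
    exact ⟨trivial, (hF.ireg 1 rfl).trans (by simpa using a2)⟩
  · rintro i τ t i1 i2 hF hi ⟨hJ1, hJ2, hJ3⟩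
    have hn' : τ.ireg 0 = n := (hF.ireg 0 rfl).trans (by simpa using a1)
    have hsrc : τ.iarr 0 i = G.src ⟨i, i2⟩ := by rw [hF.iarr 0 rfl]; exact a3 ⟨i, i2⟩
    have htgt : τ.iarr 1 i = G.tgt ⟨i, i2⟩ := by rw [hF.iarr 1 rfl]; exact a4 ⟨i, i2⟩
    have hlt : i + 1 < W := by nlinarith
    obtain ⟨l, hl, hr⟩ := hJ2 (G.src ⟨i, i2⟩)
    have hl' := hl.append i2 rfl
    have hlen : l.length + 1 ≤ n := by simpa using hl'.length_le G.simple
    have hdeg : τ.iarr 21 (G.src ⟨i, i2⟩) = l.length := hr.1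
    have hc : τ.iarr 20 (G.tgt ⟨i, i2⟩) + 1 < W := by
      have := hJ1 (G.tgt ⟨i, i2⟩)
      simp only [aCnt] at this
      rw [this]
      have := (Finset.card_le_univ (Finset.univ.filter fun e : Fin m =>
        (e : ℕ) < i ∧ G.tgt e = G.tgt ⟨i, i2⟩))
      simp at this
      nlinarith
    have c1 : CellFits W n (G.src ⟨i, i2⟩) (l.length + 1) :=
      CellFits.mk hW (G.src ⟨i, i2⟩).2.le (by omega)
    have c2 : l.length + 1 < W := lt_word hW (by omega)
    simp only [rI] at hi
    simp [hi, hn', hlt, hsrc, htgt, hdeg, hc, c1, c2]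
    refine ⟨fun v => ?_, fun u => ?_, by omega⟩
    · have hset : (Finset.univ.filter fun e : Fin m => (e : ℕ) ≤ i ∧ G.tgt e = v) =
          if G.tgt ⟨i, i2⟩ = v then insert ⟨i, i2⟩
            (Finset.univ.filter fun e : Fin m => (e : ℕ) < i ∧ G.tgt e = v)
          else (Finset.univ.filter fun e : Fin m => (e : ℕ) < i ∧ G.tgt e = v) := by
        have key : ∀ e : Fin m, (e : ℕ) ≤ i ↔ e = ⟨i, i2⟩ ∨ (e : ℕ) < i := fun e => by
          rw [Fin.ext_iff, le_iff_eq_or_lt]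
        split_ifs with h
        · ext e
          simp only [Finset.mem_filter, Finset.mem_univ, true_and, Finset.mem_insert, key]
          constructor
          · rintro ⟨h1 | h1, h2⟩
            · exact .inl h1
            · exact .inr ⟨h1, h2⟩
          · rintro (h1 | h1)
            · exact ⟨.inl h1, h1 ▸ h⟩
            · exact ⟨.inr h1.1, h1.2⟩
        · ext e
          simp only [Finset.mem_filter, Finset.mem_univ, true_and, key]
          constructor
          · rintro ⟨h1 | h1, h2⟩
            · exact absurd (h1 ▸ h2) h
            · exact ⟨h1, h2⟩
          · rintro h1
            exact ⟨.inr h1.1, h1.2⟩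
      have := hJ1 v
      simp only [aCnt] at this
      rw [hset]
      by_cases h : G.tgt ⟨i, i2⟩ = v
      · subst h
        rw [if_pos rfl, if_pos rfl, Finset.card_insert_of_notMem (by simp), this]
      · rw [if_neg h, if_neg (fun h' => h (Fin.ext h'.symm)), this]
    · by_cases hu : u = G.src ⟨i, i2⟩
      · subst hu
        refine ⟨_, hl', ?_⟩
        rw [if_pos rfl]
        refine Row.append ⟨rfl, hr.2⟩ (by omega) ?_ ?_
        · simp
        · intro s hs hne
          simp [cell_inj hs (show l.length + 1 ≤ n by omega), hne]
      · obtain ⟨l₂, hl₂, hr₂⟩ := hJ2 u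
        refine ⟨l₂, hl₂.skip i2 (Ne.symm hu), ?_⟩
        rw [if_neg (fun h => hu (Fin.ext h))]
        refine hr₂.congr (hl₂.length_le G.simple) fun s hs => ?_
        simp [cell_inj hs (show l.length + 1 ≤ n by omega), ← Fin.ext_iff, hu]
  · rintro τ t hF hi ⟨hJ1, hJ2, hJ3⟩
    refine ⟨fun v => ?_, fun u => hJ2 u, by simp; omega⟩
    simpa using hJ1 v

theorem runs_clearIn (hW : (n + 2) ^ 2 ≤ W) (hn : σ.ireg rN = n) :
    Runs W clearIn σ fun τ t =>
      (∀ v, 1 ≤ v → v ≤ n → τ.iarr aInDeg v = 0) ∧ t ≤ 40 * (n + 1) := by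
  simp only [clearIn, block_cons_cons, block_single, runs_seq]
  simp
  refine runs_upto rI 1 n (fun i τ t => (∀ v, 1 ≤ v → v < i → τ.iarr aInDeg v = 0) ∧
    t ≤ i * 30) (by omega) (by simp) ⟨by omega, by omega⟩ ?_ ?_ ?_
  · intro i τ t _ _ hF _
    exact ⟨trivial, (hF.ireg 0 rfl).trans (by simpa using hn)⟩
  · rintro i τ t i1 i2 hF hi ⟨h1, h2⟩
    have hlt : i + 1 < W := lt_word hW (by omega)
    simp only [rI] at hi
    simp [hi, hlt]
    refine ⟨fun v hv hvi hv' => h1 v (by omega) (by omega), by omega⟩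
  · rintro τ t hF hi ⟨h1, h2⟩
    refine ⟨fun v hv hv' => h1 v hv (by omega), by simp; omega⟩

theorem runs_listIn (hW : (n + 2) ^ 2 ≤ W) (hσ : Loaded G σ)
    (hnum : ∀ u : Fin n, σ.iarr aNum u = π u + 1)
    (h1 : ∀ v, 1 ≤ v → v ≤ n → σ.iarr aInDeg v = 0) :
    Runs W listIn σ fun τ t =>
      (∀ v : Fin n, ∃ l, KeyList G.tgt m v l ∧
        Row n (τ.iarr aInDeg (π v + 1)) (τ.iarr aInTail) (π v + 1)
          (fun e => (π (G.src e) : ℕ) + 1) l ∧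
        Row n (τ.iarr aInDeg (π v + 1)) (τ.rarr aInWeight) (π v + 1) G.weight l) ∧
      t ≤ 80 * (m + 1) := by
  have hm := G.edges_le
  have hle : ∀ x : Fin n, (π x : ℕ) + 1 ≤ n := fun x => (π x).2
  have hinj : Function.Injective fun e => (G.tgt e, G.src e) := fun e f h =>
    G.simple (Prod.ext (congrArg Prod.snd h) (congrArg Prod.fst h))
  obtain ⟨a1, a2, a3, a4, a5⟩ := hσ
  simp only [listIn, block_cons_cons, block_single, runs_seq]
  simp
  refine runs_below rI 0 m (fun i τ t =>
    (∀ v : Fin n, ∃ l, KeyList G.tgt i v l ∧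
        Row n (τ.iarr aInDeg (π v + 1)) (τ.iarr aInTail) (π v + 1)
          (fun e => (π (G.src e) : ℕ) + 1) l ∧
        Row n (τ.iarr aInDeg (π v + 1)) (τ.rarr aInWeight) (π v + 1) G.weight l) ∧ t ≤ i * 70)
    (by omega) (by simp) ⟨fun v => ⟨[], by simp [KeyList], ⟨?_, ?_⟩, ⟨?_, ?_⟩⟩, by omega⟩ ?_ ?_ ?_
  · simpa using h1 _ (by omega) (hle v)
  · intro s hs; simp at hs
  · simpa using h1 _ (by omega) (hle v)
  · intro s hs; simp at hs
  · intro i τ t _ _ hF _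
    exact ⟨trivial, (hF.ireg 1 rfl).trans (by simpa using a2)⟩
  · rintro i τ t i1 i2 hF hi ⟨hJ1, hJ2⟩
    have hn' : τ.ireg 0 = n := (hF.ireg 0 rfl).trans (by simpa using a1)
    have hsrc : τ.iarr 0 i = G.src ⟨i, i2⟩ := by rw [hF.iarr 0 rfl]; exact a3 ⟨i, i2⟩
    have htgt : τ.iarr 1 i = G.tgt ⟨i, i2⟩ := by rw [hF.iarr 1 rfl]; exact a4 ⟨i, i2⟩
    have hwt : τ.rarr 0 i = G.weight ⟨i, i2⟩ := by rw [hF.rarr 0 rfl]; exact a5 ⟨i, i2⟩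
    have hnum' : ∀ u : Fin n, τ.iarr 2 u = π u + 1 := fun u => by
      rw [hF.iarr 2 rfl]; exact hnum u
    have hlt : i + 1 < W := by nlinarith
    obtain ⟨l, hl, hr, hr'⟩ := hJ1 (G.tgt ⟨i, i2⟩)
    have hl' := hl.append i2 rfl
    have hlen : l.length + 1 ≤ n := by simpa using hl'.length_le hinj
    have hdeg : τ.iarr 3 (π (G.tgt ⟨i, i2⟩) + 1) = l.length := hr.1
    have c1 : CellFits W n (π (G.tgt ⟨i, i2⟩) + 1) (l.length + 1) :=
      CellFits.mk hW (hle _) (by omega)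
    have c2 : l.length + 1 < W := lt_word hW (by omega)
    simp only [rI] at hi
    simp [hi, hn', hlt, hsrc, htgt, hdeg, c1, c2, hnum', hwt]
    refine ⟨fun v => ?_, by omega⟩
    by_cases hu : v = G.tgt ⟨i, i2⟩
    · subst hu
      refine ⟨_, hl', ?_⟩
      rw [if_pos rfl]
      refine ⟨Row.append ⟨rfl, hr.2⟩ (by omega) ?_ ?_, Row.append ⟨rfl, hr'.2⟩ (by omega) ?_ ?_⟩
      · simp
      · intro s hs hne
        simp [cell_inj hs (show l.length + 1 ≤ n by omega), hne]
      · simp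
      · intro s hs hne
        simp [cell_inj hs (show l.length + 1 ≤ n by omega), hne]
    · obtain ⟨l₂, hl₂, hr₂, hr₂'⟩ := hJ1 v
      refine ⟨l₂, hl₂.skip i2 (Ne.symm hu), ?_⟩
      rw [if_neg (fun h => hu (π.injective (Fin.ext h)))]
      refine ⟨hr₂.congr (hl₂.length_le hinj) fun s hs => ?_,
        hr₂'.congr (hl₂.length_le hinj) fun s hs => ?_⟩ <;>
      simp [cell_inj hs (show l.length + 1 ≤ n by omega), ← Fin.ext_iff, hu]
  · rintro τ t hF hi ⟨hJ1, hJ2⟩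
    exact ⟨fun u => hJ1 u, by simp; omega⟩

theorem KeyList.exists_fin {key : Fin m → Fin n} {v : Fin n} {l : List (Fin m)}
    (h : KeyList key m v l) : Function.Injective l.get ∧ Set.range l.get = {e | key e = v} := by
  refine ⟨List.nodup_iff_injective_get.1 h.1, ?_⟩
  ext e
  simp only [Set.range_list_get, Set.mem_ofPred_eq]
  rw [h.2]
  simp

end APSP

namespace APSP

open RealRAM WDigraph

variable {n m W : ℕ} {G : WDigraph n m} {π : Fin n ≃ Fin n} {σ τ ρ : Mem}

/-! ## Topological sorting -/

/-- The vertices numbered so far are those in the list `q`, in this order. -/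
structure Queue (σ : Mem) (q : List (Fin n)) : Prop where
  tail : σ.ireg rTail = q.length
  nodup : q.Nodup
  queue : ∀ (j : ℕ) (h : j < q.length), σ.iarr aQueue (j + 1) = q[j]
  num : ∀ (j : ℕ) (h : j < q.length), σ.iarr aNum q[j] = j + 1

theorem Queue.length_le {q : List (Fin n)} (h : Queue σ q) : q.length ≤ n := by
  simpa using h.nodup.length_le_card

theorem Queue.congr {q : List (Fin n)} (h : Queue σ q) (h5 : τ.ireg 5 = σ.ireg 5)
    (h2 : τ.iarr 2 = σ.iarr 2) (h23 : τ.iarr 23 = σ.iarr 23) : Queue τ q := by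
  refine ⟨h5.trans h.tail, h.nodup, fun j hj => ?_, fun j hj => ?_⟩
  · rw [← h.queue j hj]; exact congrFun h23 _
  · rw [← h.num j hj]; exact congrFun h2 _

theorem runs_append (hW : (n + 2) ^ 2 ≤ W) {q : List (Fin n)} {x : ℕ} {v : Fin n}
    (hx5 : x ≠ 5) (h : Queue σ q) (hx : σ.ireg x = v) (hv : v ∉ q) :
    Runs W (append x) σ fun τ t => Queue τ (q ++ [v]) ∧ t ≤ 12 := by
  have hlen : q.length + 1 ≤ n := by
    have h1 : (v :: q).Nodup := List.nodup_cons.2 ⟨hv, h.nodup⟩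
    simpa using h1.length_le_card
  have hlt : q.length + 1 < W := lt_word hW (by omega)
  have h5 : σ.ireg 5 = q.length := h.tail
  simp only [append, block_cons_cons, block_single, runs_seq]
  simp [h5, hlt, hx5, hx]
  refine ⟨by simp, ?_, fun j hj => ?_, fun j hj => ?_⟩
  · rw [List.nodup_append]
    refine ⟨h.nodup, by simp, ?_⟩
    rintro a ha b hb rfl
    rw [List.mem_singleton] at hb
    exact hv (hb ▸ ha)
  · by_cases hjq : j < q.length
    · rw [List.getElem_append_left hjq, ← h.queue j hjq]
      simp; omega
    · have : j = q.length := by simp at hj; omega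
      subst this
      simp
  · by_cases hjq : j < q.length
    · have : q[j] ≠ v := fun h => hv (h ▸ List.getElem_mem hjq)
      rw [List.getElem_append_left hjq, ← h.num j hjq]
      simp [← Fin.ext_iff, this]
    · have : j = q.length := by simp at hj; omega
      subst this
      simp

theorem runs_numberSources (hW : (n + 2) ^ 2 ≤ W) (hn : σ.ireg rN = n)
    (hcnt : ∀ v : Fin n, σ.iarr aCnt v = 0 ↔ G.IsSource v) :
    Runs W numberSources σ fun τ t => ∃ q : List (Fin n), Queue τ q ∧ τ.ireg rR = q.length ∧
      (∀ v, v ∈ q ↔ G.IsSource v) ∧ t ≤ 60 * (n + 1) := by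
  simp only [numberSources, block_cons_cons, block_single, runs_seq]
  simp
  refine runs_below rI 0 n (fun i τ t => ∃ q : List (Fin n), Queue τ q ∧
    (∀ v : Fin n, v ∈ q ↔ (v : ℕ) < i ∧ G.IsSource v) ∧ t ≤ i * 40) (by omega) (by simp)
    ⟨[], ⟨by simp, by simp, by simp, by simp⟩, by simp, by omega⟩ ?_ ?_ ?_
  · intro i τ t _ _ hF _
    exact ⟨trivial, (hF.ireg 0 rfl).trans (by simpa using hn)⟩
  · rintro i τ t i1 i2 hF hi ⟨q, hq, hmem, htm⟩
    have hlt : i + 1 < W := lt_word hW (by omega)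
    have hc : τ.iarr 20 i = 0 ↔ G.IsSource ⟨i, i2⟩ := by
      rw [hF.iarr 20 rfl]; exact hcnt ⟨i, i2⟩
    have hstep : ∀ v : Fin n, (v : ℕ) < i + 1 ↔ (v : ℕ) < i ∨ v = ⟨i, i2⟩ := fun v => by
      rw [show v = (⟨i, i2⟩ : Fin n) ↔ (v : ℕ) = i from Fin.ext_iff]; omega
    simp only [rI] at hi
    simp [runs_ite, hi, hc, hlt, -Order.lt_add_one_iff, -Order.lt_succ_iff]
    constructor
    · intro hs
      refine (runs_append hW (by omega) hq (v := ⟨i, i2⟩) hi (by simp [hmem])).imp ?_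
      rintro ρ r hF' ⟨hq', hr⟩
      have hi' : ρ.ireg 3 = i := (hF'.ireg 3 rfl).trans hi
      simp [hi', hlt, -Order.lt_add_one_iff, -Order.lt_succ_iff]
      refine ⟨_, hq'.congr (by simp) rfl rfl, fun v => ?_, by omega⟩
      rw [List.mem_append, hmem, List.mem_singleton, hstep]
      constructor
      · rintro (h | rfl)
        · exact ⟨.inl h.1, h.2⟩
        · exact ⟨.inr rfl, hs⟩
      · rintro ⟨h | h, h'⟩
        · exact .inl ⟨h, h'⟩
        · exact .inr h
    · intro hs
      refine ⟨_, hq.congr (by simp) rfl rfl, fun v => ?_, by omega⟩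
      rw [hmem, hstep]
      constructor
      · rintro h; exact ⟨.inl h.1, h.2⟩
      · rintro ⟨h | rfl, h'⟩
        · exact ⟨h, h'⟩
        · exact absurd h' hs
  · rintro τ t hF hi ⟨q, hq, hmem, htm⟩
    have h5 : τ.ireg 5 = q.length := hq.tail
    refine ⟨q, hq.congr (by simp) rfl rfl, by simpa using h5, fun v => ?_, by simp; omega⟩
    rw [hmem]
    simp

/-- The state of the topological sorting: the edges in `H` have been removed. -/
structure Sorting (G : WDigraph n m) (R : ℕ) (σ : Mem) (q : List (Fin n)) (H : Finset (Fin m)) :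
    Prop where
  queue : Queue σ q
  cnt : ∀ v : Fin n, σ.iarr aCnt v = (Finset.univ.filter fun e => e ∉ H ∧ G.tgt e = v).card
  mem : ∀ v, v ∈ q ↔ ∀ e, G.tgt e = v → e ∈ H
  order : ∀ (j : ℕ) (h : j < q.length) e, G.tgt e = q[j] → G.src e ∈ q.take j
  src_mem : ∀ e ∈ H, G.src e ∈ q
  sources : ∀ (j : ℕ) (h : j < q.length), j < R ↔ G.IsSource q[j]
  le : R ≤ q.length

theorem Sorting.congr {R : ℕ} {q : List (Fin n)} {H : Finset (Fin m)} (h : Sorting G R σ q H)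
    (h5 : τ.ireg 5 = σ.ireg 5) (h2 : τ.iarr 2 = σ.iarr 2) (h23 : τ.iarr 23 = σ.iarr 23)
    (h20 : τ.iarr 20 = σ.iarr 20) : Sorting G R τ q H :=
  ⟨h.queue.congr h5 h2 h23, fun v => by rw [← h.cnt v]; exact congrFun h20 _, h.mem, h.order,
    h.src_mem, h.sources, h.le⟩

/-- The removal of one edge. -/
theorem runs_remove (hW : (n + 2) ^ 2 ≤ W) {R : ℕ} {q : List (Fin n)} {H : Finset (Fin m)}
    (h : Sorting G R σ q H) {e : Fin m} (he : e ∉ H) (hsrc : G.src e ∈ q)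
    (h8 : σ.ireg rQ = G.tgt e) :
    Runs W (block [
      .istore aCnt (.reg rQ) (.sub (.arr aCnt (.reg rQ)) (.const 1)),
      .ite (.ieq (.arr aCnt (.reg rQ)) (.const 0)) (append rQ) .skip]) σ fun τ t =>
      ∃ q', q <+: q' ∧ Sorting G R τ q' (insert e H) ∧ t ≤ 40 := by
  have hcard : ∀ v : Fin n, (Finset.univ.filter fun f => f ∉ insert e H ∧ G.tgt f = v).card =
      if v = G.tgt e then (Finset.univ.filter fun f => f ∉ H ∧ G.tgt f = v).card - 1
      else (Finset.univ.filter fun f => f ∉ H ∧ G.tgt f = v).card := by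
    intro v
    have : (Finset.univ.filter fun f => f ∉ insert e H ∧ G.tgt f = v) =
        (Finset.univ.filter fun f => f ∉ H ∧ G.tgt f = v).erase e := by
      ext f; simp only [Finset.mem_filter, Finset.mem_univ, true_and, Finset.mem_insert,
        Finset.mem_erase]; tauto
    rw [this]
    split_ifs with hv
    · rw [Finset.card_erase_of_mem (by simp [he, hv])]
    · rw [Finset.erase_eq_of_notMem (by simp; intro _ h; exact hv h.symm)]
  have hcnt : ∀ v : Fin n, (if (v : ℕ) = G.tgt e then σ.iarr 20 (G.tgt e) - 1 else σ.iarr 20 v) =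
      (Finset.univ.filter fun f => f ∉ insert e H ∧ G.tgt f = v).card := by
    intro v
    rw [hcard]
    by_cases hv : v = G.tgt e
    · subst hv
      rw [if_pos rfl, if_pos rfl]
      exact congrArg (· - 1) (h.cnt _)
    · rw [if_neg (fun h => hv (Fin.ext h)), if_neg hv]
      exact h.cnt v
  -- A vertex in the queue has lost all its incoming edges, but `e` is still there; hence no vertex
  -- is numbered twice.
  have hnot : G.tgt e ∉ q := fun hq => he ((h.mem _).1 hq e rfl)
  have hz : σ.iarr 20 (G.tgt e) - 1 = 0 ↔ ∀ f, G.tgt f = G.tgt e → f ∈ insert e H := by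
    have := hcnt (G.tgt e)
    rw [if_pos rfl] at this
    rw [this, Finset.card_eq_zero, Finset.filter_eq_empty_iff]
    constructor
    · intro h' f hf
      by_contra hc
      exact h' (Finset.mem_univ f) ⟨hc, hf⟩
    · rintro h' f - ⟨hf, hf'⟩
      exact hf (h' f hf')
  simp only [rQ] at h8
  simp only [block_cons_cons, block_single, runs_seq]
  rw [runs_istore]
  refine ⟨trivial, ⟨trivial, trivial⟩, ?_⟩
  rw [runs_ite]
  set τ := σ.setIArr aCnt (IExp.eval σ (.reg rQ))
    (IExp.eval σ (.sub (.arr aCnt (.reg rQ)) (.const 1)))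
    with hτ
  have hτ20 : ∀ v : Fin n, τ.iarr 20 v =
      (Finset.univ.filter fun f => f ∉ insert e H ∧ G.tgt f = v).card := by
    intro v
    rw [← hcnt v]
    simp [hτ, h8]
  have hq : Queue τ q := h.queue.congr rfl (by funext j; simp [hτ]) (by funext j; simp [hτ])
  refine ⟨⟨trivial, trivial⟩, fun hb => ?_, fun hb => ?_⟩
  · have hall := hz.1 (by simpa [hτ, h8] using hb)
    refine (runs_append hW (x := rQ) (by decide) hq (v := G.tgt e) (by simpa [hτ] using h8)
      hnot).imp ?_
    rintro ρ r hF ⟨hq', hr⟩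
    refine ⟨q ++ [G.tgt e], List.prefix_append _ _, ⟨hq', fun v => ?_, fun v => ?_,
      fun j hj f hf => ?_,
      fun f hf => ?_, fun j hj => ?_, ?_⟩, by simp; omega⟩
    · rw [← hτ20 v]; exact congrFun (hF.iarr 20 rfl) _
    · rw [List.mem_append, List.mem_singleton, h.mem]
      constructor
      · rintro (h1 | rfl)
        · exact fun f hf => Finset.mem_insert_of_mem (h1 f hf)
        · exact hall
      · intro h1
        by_cases hv : v = G.tgt e
        · exact .inr hv
        · refine .inl fun f hf => (Finset.mem_insert.1 (h1 f hf)).resolve_left ?_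
          rintro rfl; exact hv hf.symm
    · by_cases hjq : j < q.length
      · rw [List.getElem_append_left hjq] at hf
        rw [List.take_append_of_le_length hjq.le]
        exact h.order j hjq f hf
      -- For the new vertex all incoming edges have been removed, and only edges with tails in the
      -- queue are ever removed; so its direct ancestors come earlier.
      · obtain rfl : j = q.length := by simp at hj; omega
        rw [List.take_left]
        have hf' : G.tgt f = G.tgt e := by simpa using hf
        rcases Finset.mem_insert.1 (hall f hf') with rfl | h1
        · exact hsrc
        · exact h.src_mem f h1
    · rcases Finset.mem_insert.1 hf with rfl | h1
      · exact List.mem_append_left _ hsrc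
      · exact List.mem_append_left _ (h.src_mem f h1)
    · by_cases hjq : j < q.length
      · rw [List.getElem_append_left hjq]; exact h.sources j hjq
      · obtain rfl : j = q.length := by simp at hj; omega
        have hle := h.le
        refine iff_of_false (by omega) ?_
        rw [List.getElem_concat_length rfl]
        exact fun hs => hs e rfl
    · have := h.le
      simp; omega
  · have hall : ¬ ∀ f, G.tgt f = G.tgt e → f ∈ insert e H := fun h' => by
      refine hb ?_
      simpa [hτ, h8] using hz.2 h'
    rw [runs_skip]
    refine ⟨q, List.prefix_rfl, ⟨hq, hτ20, fun v => ?_, h.order, fun f hf => ?_, h.sources, h.le⟩,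
      by simp⟩
    · rw [h.mem]
      constructor
      · exact fun h1 f hf => Finset.mem_insert_of_mem (h1 f hf)
      · intro h1 f hf
        refine (Finset.mem_insert.1 (h1 f hf)).resolve_left ?_
        rintro rfl
        exact hall (hf ▸ h1)
    · rcases Finset.mem_insert.1 hf with rfl | h1
      · exact hsrc
      · exact h.src_mem f h1

theorem runs_removeOut (hW : (n + 2) ^ 2 ≤ W) {R : ℕ} {q : List (Fin n)} {H : Finset (Fin m)}
    (h : Sorting G R σ q H) {u : Fin n} (hu : u ∈ q) {l : List (Fin m)}
    (hl : KeyList G.src m u l)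
    (hrow : Row n (σ.iarr aOutDeg u) (σ.iarr aOut) u (fun e : Fin m => (e : ℕ)) l)
    (htgt : ∀ e : Fin m, σ.iarr aTgt e = G.tgt e)
    (hn : σ.ireg rN = n) (h6 : σ.ireg rT = u) (hH : ∀ e ∈ H, G.src e ≠ u) :
    Runs W removeOut σ fun τ t => ∃ q' H', q <+: q' ∧ Sorting G R τ q' H' ∧
      (∀ e, e ∈ H' ↔ e ∈ H ∨ G.src e = u) ∧ H'.card = H.card + l.length ∧
      t ≤ 20 + 100 * l.length := by
  have hlen : l.length ≤ n := hl.length_le G.simple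
  simp only [removeOut, block_cons_cons, block_single, runs_seq]
  simp
  refine runs_upto rS 1 l.length (fun s τ t => ∃ q' H', q <+: q' ∧ Sorting G R τ q' H' ∧
      (∀ e, e ∈ H' ↔ e ∈ H ∨ e ∈ l.take (s - 1)) ∧ H'.card = H.card + (s - 1) ∧
      t + 80 ≤ s * 80) (by omega) (by simp) ⟨q, H, List.prefix_rfl, h.congr (by simp) rfl rfl rfl,
        by simp, by simp, by omega⟩ ?_ ?_ ?_
  · intro s τ t _ _ hF _
    refine ⟨trivial, ?_⟩
    have h6' : τ.ireg 6 = u := (hF.ireg 6 rfl).trans (by simpa using h6)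
    have h21 : τ.iarr 21 = σ.iarr 21 := hF.iarr 21 rfl
    simp [h6', h21]
    exact hrow.1
  · rintro s τ t s1 s2 hF hs ⟨q', H', hpre, hS, hH', hc, htm⟩
    obtain ⟨s', rfl⟩ : ∃ s', s = s' + 1 := ⟨s - 1, by omega⟩
    have hs' : s' < l.length := by omega
    simp only [Nat.add_sub_cancel] at hH' hc ⊢
    have hn' : τ.ireg 0 = n := (hF.ireg 0 rfl).trans (by simpa using hn)
    have h6' : τ.ireg 6 = u := (hF.ireg 6 rfl).trans (by simpa using h6)
    have h22 : τ.iarr 22 = σ.iarr 22 := hF.iarr 22 rfl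
    have h1 : τ.iarr 1 = σ.iarr 1 := hF.iarr 1 rfl
    have hout := hrow.2 s' hs'
    have ht := htgt l[s']
    have hsrc : G.src l[s'] = u := ((hl.2 _).1 (List.getElem_mem hs')).2
    have c1 : CellFits W n u (s' + 1) := CellFits.mk hW u.2.le (by omega)
    simp only [aOut, aTgt, rS] at hout ht hs
    have hnot : l[s'] ∉ H' := by
      rw [hH']
      rintro (h' | h')
      · exact hH _ h' hsrc
      · obtain ⟨i, hi, hi'⟩ := List.mem_take_iff_getElem.1 h'
        have := (List.Nodup.getElem_inj_iff hl.1).1 hi'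
        omega
    have key := runs_remove hW (σ := τ.setIReg 8 (G.tgt l[s']))
      (hS.congr (by simp) rfl rfl rfl) hnot (by rw [hsrc]; exact hpre.subset hu) (by simp)
    simp only [block_cons_cons, block_single, runs_seq] at key
    rw [runs_seq, runs_iset]
    refine ⟨by simp [hn', h6', hs, c1], ?_⟩
    have hev : IExp.eval τ (.arr aTgt (.arr aOut (cellE (.reg rT) (.reg rS)))) = G.tgt l[s'] := by
      simp [hn', h6', hs, h1, h22, hout, ht]
    rw [hev, runs_seq]
    refine key.imp ?_
    intro ρ r hF₁ hρ
    rw [runs_seq]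
    refine hρ.imp ?_
    rintro ρ' r' hF₂ ⟨q₂, hpre₂, hS₂, hr⟩
    have hs₂ : ρ'.ireg 7 = s' + 1 := by
      rw [hF₂.ireg 7 rfl, hF₁.ireg 7 rfl]; simpa using hs
    have hlt : s' + 1 + 1 < W := lt_word hW (by omega)
    simp [hs₂, hlt]
    refine ⟨q₂, hpre.trans hpre₂, insert l[s'] H', hS₂.congr (by simp) rfl rfl rfl, fun e => ?_,
      ?_, by omega⟩
    · rw [Finset.mem_insert, hH', List.take_add_one, List.mem_append, List.getElem?_eq_getElem hs']
      simp
      tauto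
    · rw [Finset.card_insert_of_notMem hnot, hc]; omega
  · rintro τ t hF hs ⟨q', H', hpre, hS, hH', hc, htm⟩
    refine ⟨q', hpre, H', hS, fun e => ?_, by simpa using hc, by simp; omega⟩
    rw [hH']
    simp [hl.2]

/-- The loop runs over the queue while the removals extend it. Its time is charged to the vertices
taken from the queue and to the removed edges, which are at most `n` and `m` in number. -/
theorem runs_numberOthers (hW : (n + 2) ^ 2 ≤ W) {R : ℕ} {q : List (Fin n)}
    (h : Sorting G R σ q ∅)
    (hout : ∀ u : Fin n, ∃ l, KeyList G.src m u l ∧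
        Row n (σ.iarr aOutDeg u) (σ.iarr aOut) u (fun e : Fin m => (e : ℕ)) l)
    (htgt : ∀ e : Fin m, σ.iarr aTgt e = G.tgt e) (hn : σ.ireg rN = n) :
    Runs W numberOthers σ fun τ t => ∃ q' H, Sorting G R τ q' H ∧
      (∀ e, e ∈ H ↔ G.src e ∈ q') ∧ t ≤ 200 * (n + m + 1) := by
  simp only [numberOthers, block_cons_cons, block_single, runs_seq]
  simp
  refine runs_while (fun τ t => ∃ (k : ℕ) (q' : List (Fin n)) (H : Finset (Fin m)),
    τ.ireg rK = k + 1 ∧ k ≤ q'.length ∧ Sorting G R τ q' H ∧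
    (∀ e, e ∈ H ↔ G.src e ∈ q'.take k) ∧ t ≤ 100 * (k + H.card)) (100 * (n + m))
    ⟨0, q, ∅, by simp, by omega, h.congr (by simp) rfl rfl rfl, by simp, by simp⟩ ?_ ?_
  · rintro τ t ⟨k, q', H, -, hk, hS, -, ht⟩
    have h1 := hS.queue.length_le
    have h2 := Finset.card_le_univ H
    simp at h2
    omega
  · rintro τ t hF ⟨k, q', H, hk, hkq, hS, hH, ht⟩
    have h1 := hS.queue.length_le
    have h2 := Finset.card_le_univ H
    have h5 : τ.ireg 5 = q'.length := hS.queue.tail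
    have hlt : k + 1 + 1 < W := lt_word hW (by omega)
    simp only [rK] at hk
    simp at h2
    refine ⟨by simp [ile], fun hb => ?_, fun hb => ?_⟩
    · have hkl : k < q'.length := by
        simp [ile, hk, h5] at hb; omega
      have hqk : τ.iarr 23 (k + 1) = q'[k] := hS.queue.queue k hkl
      obtain ⟨l, hl, hrow⟩ := hout q'[k]
      rw [runs_seq, runs_iset]
      refine ⟨trivial, ?_⟩
      have hev : IExp.eval τ (.arr 23 (.reg 4)) = q'[k] := by simp [hk, hqk]
      rw [hev, runs_seq]
      refine (runs_removeOut hW (σ := τ.setIReg 6 q'[k]) (q := q') (H := H) (R := R)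
        (hS.congr (by simp) rfl rfl rfl)
        (List.getElem_mem hkl) hl ?_ ?_ ?_ (by simp) ?_).imp ?_
      · have h21 : τ.iarr 21 = σ.iarr 21 := hF.iarr 21 rfl
        have h22 : τ.iarr 22 = σ.iarr 22 := hF.iarr 22 rfl
        simpa [h21, h22] using hrow
      · intro e
        rw [← htgt e]
        exact congrFun (hF.iarr 1 rfl) _
      · exact (hF.ireg 0 rfl).trans (by simpa using hn)
      · intro e he heq
        rw [hH] at he
        obtain ⟨i, hi, hi'⟩ := List.mem_take_iff_getElem.1 he
        rw [heq] at hi'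
        have := (List.Nodup.getElem_inj_iff hS.queue.nodup).1 hi'
        omega
      · rintro ρ r hF' ⟨q₂, H₂, hpre, hS₂, hH₂, hc, hr⟩
        have hk' : ρ.ireg 4 = k + 1 := by rw [hF'.ireg 4 rfl]; simpa using hk
        have hl2 := hpre.length_le
        simp [hk', hlt]
        refine ⟨q₂, by omega, H₂, hS₂.congr (by simp) rfl rfl rfl, fun e => ?_, ?_⟩
        · obtain ⟨q₃, rfl⟩ := hpre
          rw [hH₂, hH, List.take_append_of_le_length (by omega), List.take_add_one,
            List.mem_append, List.getElem?_eq_getElem hkl]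
          simp
        · simp [ile]; omega
    · have hkl : k = q'.length := by
        simp [ile, hk, h5] at hb; omega
      subst hkl
      refine ⟨q', H, hS, fun e => by rw [hH]; simp, by simp [ile]; omega⟩

/-- Acyclicity enters here, as induction along the edges: a vertex whose direct ancestors are all in
the queue has lost all its incoming edges, so it is in the queue itself. -/
theorem Sorting.mem_all {R : ℕ} {q : List (Fin n)} {H : Finset (Fin m)} (h : Sorting G R σ q H)
    (hG : G.IsAcyclic) (hH : ∀ e, e ∈ H ↔ G.src e ∈ q) (v : Fin n) : v ∈ q := by
  induction v using hG.wellFounded.induction with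
  | _ v ih =>
    rw [h.mem]
    intro e he
    rw [hH]
    exact ih _ ⟨e, rfl, he⟩

/-- The number of a vertex is its position in the queue; the field `order` makes this numbering
topological, and `sources` puts the sources first. -/
theorem Sorting.exists_numbering {R : ℕ} {q : List (Fin n)} {H : Finset (Fin m)}
    (h : Sorting G R σ q H) (hq : ∀ v, v ∈ q) :
    ∃ π : Fin n ≃ Fin n, G.IsNumbering π ∧ ∀ u : Fin n, σ.iarr aNum u = π u + 1 := by
  have hlen : q.length = n := by
    have := Fintype.card_congr (List.Nodup.getEquivOfForallMemList q h.queue.nodup hq)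
    simpa using this
  let π : Fin n ≃ Fin n :=
    (List.Nodup.getEquivOfForallMemList q h.queue.nodup hq).symm.trans (finCongr hlen)
  have hπ : ∀ (j : ℕ) (hj : j < q.length), (π q[j] : ℕ) = j := by
    intro j hj
    have : (List.Nodup.getEquivOfForallMemList q h.queue.nodup hq).symm q[j] = ⟨j, hj⟩ := by
      rw [Equiv.symm_apply_eq]; rfl
    simp [π, this]
  have hex : ∀ v : Fin n, ∃ (j : ℕ) (hj : j < q.length), q[j] = v := fun v =>
    List.mem_iff_getElem.1 (hq v)
  refine ⟨π, ⟨?_, ?_⟩, ?_⟩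
  · rintro u v ⟨e, rfl, hv⟩
    obtain ⟨j, hj, rfl⟩ := hex v
    obtain ⟨i, hi, hi'⟩ := List.mem_take_iff_getElem.1 (h.order j hj e hv)
    have hi2 : i < q.length := by omega
    rw [Fin.lt_def, hπ j hj, ← hi', hπ i hi2]
    omega
  · intro u v hu hv
    obtain ⟨j, hj, rfl⟩ := hex v
    obtain ⟨i, hi, rfl⟩ := hex u
    rw [Fin.lt_def, hπ j hj, hπ i hi]
    have h1 := (h.sources i hi).2 hu
    have h2 := mt (h.sources j hj).1 hv
    omega
  · intro u
    obtain ⟨j, hj, rfl⟩ := hex u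
    rw [hπ j hj]
    exact h.queue.num j hj

theorem runs_numbering (hW : (n + 2) ^ 2 ≤ W) (hG : G.IsAcyclic) (hσ : Loaded G σ) :
    Runs W numbering σ fun τ t => ∃ π : Fin n ≃ Fin n, G.IsNumbering π ∧ Numbered G π τ ∧
      t ≤ 1000 * (1 + n + m) := by
  have hloaded : ∀ {σ τ : Mem}, numbering.Frame σ τ → Loaded G σ → Loaded G τ := by
    rintro σ τ hF ⟨a1, a2, a3, a4, a5⟩
    refine ⟨(hF.ireg 0 rfl).trans a1, (hF.ireg 1 rfl).trans a2, fun e => ?_, fun e => ?_,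
      fun e => ?_⟩
    · rw [← a3 e]; exact congrFun (hF.iarr 0 rfl) _
    · rw [← a4 e]; exact congrFun (hF.iarr 1 rfl) _
    · rw [← a5 e]; exact congrFun (hF.rarr 0 rfl) _
  -- A part of `numbering` writes no more than the whole does, so the input survives each part.
  have hw : ∀ {c : Cmd} {σ τ : Mem}, (∀ l, numbering.writes l = false → c.writes l = false) →
      c.Frame σ τ → Loaded G σ → Loaded G τ := fun hc hF h => hloaded (fun l hl => hF l (hc l hl)) h
  unfold numbering
  simp only [block_cons_cons, block_single, runs_seq]
  refine (runs_clearCounts hW hσ.n_eq).imp ?_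
  rintro τ₁ t₁ hF₁ ⟨h11, h12, ht₁⟩
  have hσ₁ : Loaded G τ₁ := hw (fun l hl => by
    simp only [numbering, block_cons_cons, block_single, Cmd.writes, Bool.or_eq_false_iff] at hl
    exact hl.1) hF₁ hσ
  refine (runs_listOut hW hσ₁ h11 h12).imp ?_
  rintro τ₂ t₂ hF₂ ⟨h21, h22, ht₂⟩
  have hσ₂ : Loaded G τ₂ := hw (fun l hl => by
    simp only [numbering, block_cons_cons, block_single, Cmd.writes, Bool.or_eq_false_iff] at hl
    exact hl.2.1) hF₂ hσ₁
  refine (runs_numberSources (G := G) hW hσ₂.n_eq ?_).imp ?_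
  · intro v
    rw [h21, Finset.card_eq_zero, Finset.filter_eq_empty_iff]
    simp [IsSource]
  rintro τ₃ t₃ hF₃ ⟨q, hq, hR, hmem, ht₃⟩
  have hσ₃ : Loaded G τ₃ := hw (fun l hl => by
    simp only [numbering, block_cons_cons, block_single, Cmd.writes, Bool.or_eq_false_iff] at hl
    exact hl.2.2.1) hF₃ hσ₂
  -- Before any removal, the vertices without remaining incoming edges are the sources, and the
  -- condition `order` is vacuous for them.
  have hS : Sorting G q.length τ₃ q ∅ := by
    refine ⟨hq, fun v => ?_, fun v => ?_, fun j hj e he => ?_, by simp, fun j hj => ?_, le_rfl⟩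
    · have := h21 v
      simp only [aCnt] at this
      rw [hF₃.iarr 20 rfl, this]
      simp
    · rw [hmem]; simp [IsSource]
    · exact absurd he ((hmem _).1 (List.getElem_mem hj) e)
    · exact iff_of_true hj ((hmem _).1 (List.getElem_mem hj))
  refine (runs_numberOthers hW hS ?_ hσ₃.tgt_eq hσ₃.n_eq).imp ?_
  · intro u
    obtain ⟨l, hl, hr⟩ := h22 u
    have e1 : τ₃.iarr 21 = τ₂.iarr 21 := hF₃.iarr 21 rfl
    have e2 : τ₃.iarr 22 = τ₂.iarr 22 := hF₃.iarr 22 rfl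
    exact ⟨l, hl, by simpa [e1, e2] using hr⟩
  rintro τ₄ t₄ hF₄ ⟨q₄, H, hS₄, hH, ht₄⟩
  have hσ₄ : Loaded G τ₄ := hw (fun l hl => by
    simp only [numbering, block_cons_cons, block_single, Cmd.writes, Bool.or_eq_false_iff] at hl
    exact hl.2.2.2.1) hF₄ hσ₃
  obtain ⟨π, hπ, hnum⟩ := hS₄.exists_numbering (hS₄.mem_all hG hH)
  refine (runs_clearIn hW hσ₄.n_eq).imp ?_
  rintro τ₅ t₅ hF₅ ⟨h51, ht₅⟩
  have hσ₅ : Loaded G τ₅ := hw (fun l hl => by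
    simp only [numbering, block_cons_cons, block_single, Cmd.writes, Bool.or_eq_false_iff] at hl
    exact hl.2.2.2.2.1) hF₅ hσ₄
  have hnum₅ : ∀ u : Fin n, τ₅.iarr aNum u = π u + 1 := fun u => by
    rw [← hnum u]; exact congrFun (hF₅.iarr 2 rfl) _
  refine (runs_listIn hW hσ₅ hnum₅ h51).imp ?_
  rintro τ₆ t₆ hF₆ ⟨h61, ht₆⟩
  have hσ₆ : Loaded G τ₆ := hw (fun l hl => by
    simp only [numbering, block_cons_cons, block_single, Cmd.writes, Bool.or_eq_false_iff] at hl
    exact hl.2.2.2.2.2) hF₆ hσ₅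
  refine ⟨π, hπ, ⟨hσ₆, fun u => ?_, ?_, fun v => ?_⟩, by omega⟩
  · rw [← hnum₅ u]; exact congrFun (hF₆.iarr 2 rfl) _
  · have e1 : τ₆.ireg 2 = q.length := by
      rw [hF₆.ireg 2 rfl, hF₅.ireg 2 rfl, hF₄.ireg 2 rfl]; exact hR
    have e2 : {v | G.IsSource v} = ((q.toFinset : Finset (Fin n)) : Set (Fin n)) := by
      ext v; simp [hmem]
    rw [e2, Set.ncard_coe_finset, List.toFinset_card_of_nodup hq.nodup]
    exact e1
  · obtain ⟨l, hl, hr1, hr2⟩ := h61 v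
    obtain ⟨hinj, hrange⟩ := hl.exists_fin
    exact ⟨l.length, l.get, hinj, hrange, hr1.1, fun s => hr1.2 s s.2, fun s => hr2.2 s s.2⟩

end APSP

namespace RealRAM

/-! ## Programs in another part of the memory -/

/-- The part of the memory whose registers and arrays have numbers from `K` on. -/
def Mem.view (K : ℕ) (τ : Mem) : Mem where
  ireg x := τ.ireg (K + x)
  rreg x := τ.rreg (K + x)
  iarr a := τ.iarr (K + a)
  rarr a := τ.rarr (K + a)

/-- Renumber the registers and arrays. -/
def IExp.shift (K : ℕ) : IExp → IExp
  | .const k => .const k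
  | .reg x => .reg (K + x)
  | .arr a i => .arr (K + a) (i.shift K)
  | .add e f => .add (e.shift K) (f.shift K)
  | .sub e f => .sub (e.shift K) (f.shift K)
  | .mul e f => .mul (e.shift K) (f.shift K)
  | .div e f => .div (e.shift K) (f.shift K)

/-- Renumber the registers and arrays. -/
def RExp.shift (K : ℕ) : RExp → RExp
  | .const q => .const q
  | .reg x => .reg (K + x)
  | .arr a i => .arr (K + a) (i.shift K)
  | .add e f => .add (e.shift K) (f.shift K)
  | .sub e f => .sub (e.shift K) (f.shift K)
  | .mul e f => .mul (e.shift K) (f.shift K)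
  | .div e f => .div (e.shift K) (f.shift K)

/-- Renumber the registers and arrays. -/
def BExp.shift (K : ℕ) : BExp → BExp
  | .ieq e f => .ieq (e.shift K) (f.shift K)
  | .ilt e f => .ilt (e.shift K) (f.shift K)
  | .req e f => .req (e.shift K) (f.shift K)
  | .rlt e f => .rlt (e.shift K) (f.shift K)
  | .not b => .not (b.shift K)
  | .and b c => .and (b.shift K) (c.shift K)
  | .or b c => .or (b.shift K) (c.shift K)

/-- Renumber the registers and arrays. -/
def Cmd.shift (K : ℕ) : Cmd → Cmd
  | .skip => .skip
  | .iset x e => .iset (K + x) (e.shift K)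
  | .rset x e => .rset (K + x) (e.shift K)
  | .istore a i e => .istore (K + a) (i.shift K) (e.shift K)
  | .rstore a i e => .rstore (K + a) (i.shift K) (e.shift K)
  | .seq c d => .seq (c.shift K) (d.shift K)
  | .ite b c d => .ite (b.shift K) (c.shift K) (d.shift K)
  | .while b c => .while (b.shift K) (c.shift K)

section Shift

variable {W K : ℕ} {τ : Mem}

@[simp] theorem IExp.eval_shift (e : IExp) : (e.shift K).eval τ = e.eval (τ.view K) := by
  induction e <;> simp_all [IExp.shift, Mem.view]

@[simp] theorem IExp.cost_shift (e : IExp) : (e.shift K).cost = e.cost := by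
  induction e <;> simp_all [IExp.shift]

@[simp] theorem IExp.fits_shift (e : IExp) : (e.shift K).Fits W τ ↔ e.Fits W (τ.view K) := by
  induction e <;> simp_all [IExp.shift]

@[simp] theorem RExp.eval_shift (e : RExp) : (e.shift K).eval τ = e.eval (τ.view K) := by
  induction e <;> simp_all [RExp.shift, Mem.view]

@[simp] theorem RExp.cost_shift (e : RExp) : (e.shift K).cost = e.cost := by
  induction e <;> simp_all [RExp.shift]

@[simp] theorem RExp.fits_shift (e : RExp) : (e.shift K).Fits W τ ↔ e.Fits W (τ.view K) := by
  induction e <;> simp_all [RExp.shift]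

@[simp] theorem BExp.holds_shift (e : BExp) : (e.shift K).Holds τ ↔ e.Holds (τ.view K) := by
  induction e <;> simp_all [BExp.shift]

@[simp] theorem BExp.cost_shift (e : BExp) : (e.shift K).cost = e.cost := by
  induction e <;> simp_all [BExp.shift]

@[simp] theorem BExp.fits_shift (e : BExp) : (e.shift K).Fits W τ ↔ e.Fits W (τ.view K) := by
  induction e <;> simp_all [BExp.shift]

theorem Mem.ext' {σ τ : Mem} (h1 : ∀ x, σ.ireg x = τ.ireg x) (h2 : ∀ x, σ.rreg x = τ.rreg x)
    (h3 : ∀ a i, σ.iarr a i = τ.iarr a i) (h4 : ∀ a i, σ.rarr a i = τ.rarr a i) : σ = τ := by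
  cases σ; cases τ
  simp only [Mem.mk.injEq]
  exact ⟨funext h1, funext h2, funext fun a => funext (h3 a), funext fun a => funext (h4 a)⟩

@[simp] theorem Mem.view_setIReg (x v : ℕ) :
    (τ.setIReg (K + x) v).view K = (τ.view K).setIReg x v := by
  apply Mem.ext' <;> intros <;> simp [Mem.view]
@[simp] theorem Mem.view_setRReg (x : ℕ) (v : ℝ) :
    (τ.setRReg (K + x) v).view K = (τ.view K).setRReg x v := by
  apply Mem.ext' <;> intros <;> simp [Mem.view]
@[simp] theorem Mem.view_setIArr (a i v : ℕ) :
    (τ.setIArr (K + a) i v).view K = (τ.view K).setIArr a i v := by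
  apply Mem.ext' <;> intros <;> simp [Mem.view]
@[simp] theorem Mem.view_setRArr (a i : ℕ) (v : ℝ) :
    (τ.setRArr (K + a) i v).view K = (τ.view K).setRArr a i v := by
  apply Mem.ext' <;> intros <;> simp [Mem.view]
theorem Mem.view_setIReg_of_lt {x v : ℕ} (h : x < K) : (τ.setIReg x v).view K = τ.view K := by
  apply Mem.ext' <;> intros <;> simp [Mem.view]; omega

/-- Registers and arrays are named by constants in the program text, so renumbering them gives a
simulation with the same running time. Nothing is known about the memory that a multiplication
program uses; renumbered, it cannot disturb the tables. -/
theorem Exec.shift {c : Cmd} {σ σ' : Mem} {t : ℕ} (h : Exec W c σ σ' t) :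
    ∀ τ : Mem, τ.view K = σ → ∃ τ', Exec W (c.shift K) τ τ' t ∧ τ'.view K = σ' := by
  induction h with
  | skip => exact fun τ h => ⟨τ, .skip _, h⟩
  | iset σ x e he =>
    rintro τ rfl
    exact ⟨_, by
      simpa [Cmd.shift] using Exec.iset τ (K + x) (e.shift K) (by simpa using he), by simp⟩
  | rset σ x e he =>
    rintro τ rfl
    exact ⟨_, by
      simpa [Cmd.shift] using Exec.rset τ (K + x) (e.shift K) (by simpa using he), by simp⟩
  | istore σ a i e hi he =>
    rintro τ rfl
    exact ⟨_, by
      simpa [Cmd.shift] using Exec.istore τ (K + a) (i.shift K) (e.shift K) (by simpa using hi)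
        (by simpa using he), by simp⟩
  | rstore σ a i e hi he =>
    rintro τ rfl
    exact ⟨_, by
      simpa [Cmd.shift] using Exec.rstore τ (K + a) (i.shift K) (e.shift K) (by simpa using hi)
        (by simpa using he), by simp⟩
  | seq _ _ h1 h2 =>
    intro τ hτ
    obtain ⟨τ₁, e1, hτ₁⟩ := h1 τ hτ
    obtain ⟨τ₂, e2, hτ₂⟩ := h2 τ₁ hτ₁
    exact ⟨τ₂, .seq e1 e2, hτ₂⟩
  | @iteTrue b _ _ _ _ _ hf hb _ h1 =>
    rintro τ rfl
    obtain ⟨τ₁, e1, hτ₁⟩ := h1 τ rfl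
    exact ⟨τ₁, by
      simpa [Cmd.shift] using Exec.iteTrue (b := b.shift K) (by simpa using hf)
        (by simpa using hb) e1, hτ₁⟩
  | @iteFalse b _ _ _ _ _ hf hb _ h1 =>
    rintro τ rfl
    obtain ⟨τ₁, e1, hτ₁⟩ := h1 τ rfl
    exact ⟨τ₁, by
      simpa [Cmd.shift] using Exec.iteFalse (b := b.shift K) (by simpa using hf)
        (by simpa using hb) e1, hτ₁⟩
  | @whileTrue b _ _ _ _ _ _ hf hb _ _ h1 h2 =>
    rintro τ rfl
    obtain ⟨τ₁, e1, hτ₁⟩ := h1 τ rfl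
    obtain ⟨τ₂, e2, hτ₂⟩ := h2 τ₁ hτ₁
    exact ⟨τ₂, by
      simpa [Cmd.shift] using Exec.whileTrue (b := b.shift K) (by simpa using hf)
        (by simpa using hb) e1 e2, hτ₂⟩
  | @whileFalse b _ _ hf hb =>
    rintro τ rfl
    exact ⟨τ, by
      simpa [Cmd.shift] using Exec.whileFalse (b := b.shift K) (by simpa using hf)
        (by simpa using hb), rfl⟩

theorem Runs.shift {c : Cmd} {Q : Mem → ℕ → Prop} (h : Runs W c (τ.view K) Q) :
    Runs W (c.shift K) τ fun τ' t => Q (τ'.view K) t := by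
  obtain ⟨σ', t, he, hq⟩ := h
  obtain ⟨τ', he', rfl⟩ := he.shift τ rfl
  exact ⟨τ', t, he', hq⟩

/-- The number of a register or array. -/
def Loc.index : Loc → ℕ
  | .ireg x => x
  | .rreg x => x
  | .iarr a => a
  | .rarr a => a

theorem Cmd.writes_shift (c : Cmd) {l : Loc} (h : l.index < K) : (c.shift K).writes l = false := by
  induction c with
  | skip => rfl
  | iset x e | rset x e | istore a i e | rstore a i e =>
    simp only [Cmd.shift, Cmd.writes, decide_eq_false_iff_not]
    rintro rfl
    simp [Loc.index] at h
  | seq c d hc hd | ite b c d hc hd => simp [Cmd.shift, Cmd.writes, hc, hd]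
  | _ b c hc => simpa [Cmd.shift, Cmd.writes] using hc

end Shift

/-! ## Programs with a limited number of steps -/

abbrev rFuel : ℕ := 40
abbrev rFlag : ℕ := 41

/-- Execute `c` if there is fuel left, and use one unit of it. -/
def spend (c : Cmd) : Cmd :=
  .ite (.ilt (.const 0) (.reg rFuel))
    (.seq (.iset rFuel (.sub (.reg rFuel) (.const 1))) c) .skip

/-- Put the truth value of `b` into the flag if there is fuel left. -/
def setFlag (b : BExp) : Cmd :=
  .ite (.ilt (.const 0) (.reg rFuel))
    (.ite b (.iset rFlag (.const 1)) (.iset rFlag (.const 0))) (.iset rFlag (.const 0))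

/-- Execute a program in another part of the memory as long as there is fuel. -/
def Cmd.limit (K : ℕ) : Cmd → Cmd
  | .skip => .skip
  | .iset x e => spend (.iset (K + x) (e.shift K))
  | .rset x e => spend (.rset (K + x) (e.shift K))
  | .istore a i e => spend (.istore (K + a) (i.shift K) (e.shift K))
  | .rstore a i e => spend (.rstore (K + a) (i.shift K) (e.shift K))
  | .seq c d => .seq (c.limit K) (d.limit K)
  | .ite b c d => spend (.ite (b.shift K) (c.limit K) (d.limit K))
  | .while b c => .seq (setFlag (b.shift K)) (.while (.ieq (.reg rFlag) (.const 1))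
      (.seq (.iset rFuel (.sub (.reg rFuel) (.const 1))) (.seq (c.limit K) (setFlag (b.shift K)))))

/-- The number of steps of a limited program for each unit of fuel. -/
def Cmd.overhead : Cmd → ℕ
  | .skip => 10
  | .iset _ e => e.cost + 10
  | .rset _ e => e.cost + 10
  | .istore _ i e => i.cost + e.cost + 10
  | .rstore _ i e => i.cost + e.cost + 10
  | .seq c d => c.overhead + d.overhead
  | .ite b c d => b.cost + c.overhead + d.overhead + 10
  | .while b c => 2 * b.cost + c.overhead + 40

section Limit

variable {W K : ℕ} {τ : Mem}

attribute [simp] rFuel rFlag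

theorem Exec.of_eq {c : Cmd} {σ σ' : Mem} {s t : ℕ} (h : Exec W c σ σ' s) (hst : s = t) :
    Exec W c σ σ' t := hst ▸ h

theorem exec_spend {c : Cmd} {τ' : Mem} {t : ℕ} (hf : 0 < τ.ireg rFuel)
    (h : Exec W c (τ.setIReg rFuel (τ.ireg rFuel - 1)) τ' t) : Exec W (spend c) τ τ' (8 + t) := by
  have h1 : Exec W (.iset rFuel (.sub (.reg rFuel) (.const 1))) τ
      (τ.setIReg rFuel (τ.ireg rFuel - 1)) 4 := Exec.iset τ rFuel _ ⟨trivial, trivial⟩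
  have h2 := Exec.iteTrue (d := .skip) (b := .ilt (.const 0) (.reg rFuel)) (σ := τ) (W := W)
    ⟨trivial, trivial⟩ hf (h1.seq h)
  exact h2.of_eq (by simp; omega)

theorem exec_spend_zero (c : Cmd) (hf : τ.ireg rFuel = 0) : Exec W (spend c) τ τ 5 :=
  Exec.iteFalse (b := .ilt (.const 0) (.reg rFuel)) (σ := τ) (W := W)
    ⟨trivial, trivial⟩ (by simpa using hf) (.skip _)

theorem exec_setFlag {b : BExp} (hf : 0 < τ.ireg rFuel) (hb : b.Fits W τ) [Decidable (b.Holds τ)] :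
    Exec W (setFlag b) τ (τ.setIReg rFlag (if b.Holds τ then 1 else 0)) (b.cost + 7) := by
  split_ifs with h
  · have := Exec.iteTrue (d := .iset rFlag (.const 0)) (b := .ilt (.const 0) (.reg rFuel)) (W := W)
      ⟨trivial, trivial⟩ hf (Exec.iteTrue (d := .iset rFlag (.const 0)) hb h
        (.iset τ rFlag (.const 1) trivial))
    exact this.of_eq (by simp; omega)
  · have := Exec.iteTrue (d := .iset rFlag (.const 0)) (b := .ilt (.const 0) (.reg rFuel)) (W := W)
      ⟨trivial, trivial⟩ hf (Exec.iteFalse (c := .iset rFlag (.const 1)) hb h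
        (.iset τ rFlag (.const 0) trivial))
    exact this.of_eq (by simp; omega)

theorem exec_setFlag_zero (b : BExp) (hf : τ.ireg rFuel = 0) :
    Exec W (setFlag b) τ (τ.setIReg rFlag 0) 6 :=
  Exec.iteFalse (b := .ilt (.const 0) (.reg rFuel)) (σ := τ) (W := W)
    ⟨trivial, trivial⟩ (by simpa using hf) (.iset τ rFlag (.const 0) trivial)

theorem exec_flagLoop_zero (c : Cmd) (hf : τ.ireg rFlag = 0) :
    Exec W (.while (.ieq (.reg rFlag) (.const 1)) c) τ τ 4 :=
  Exec.whileFalse (b := .ieq (.reg rFlag) (.const 1)) (σ := τ) (W := W)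
    ⟨trivial, trivial⟩ (by simp at hf; simp [hf])

/-- Without fuel no simulated operation is executed, no simulated test is evaluated, and every loop
is left at once. Hence neither termination nor absence of overflows is required of `c`; this covers
everything that follows after the fuel has run out in the middle of a simulation. -/
theorem Cmd.exec_limit_zero (c : Cmd) : ∀ τ : Mem, τ.ireg rFuel = 0 →
    ∃ τ' s, Exec W (c.limit K) τ τ' s ∧ τ'.ireg rFuel = 0 ∧ s ≤ c.overhead := by
  induction c with
  | skip => exact fun τ h => ⟨τ, 1, .skip _, h, by simp [Cmd.overhead]⟩
  | iset x e | rset x e | istore a i e | rstore a i e =>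
    exact fun τ h => ⟨τ, 5, exec_spend_zero _ h, h, by simp [Cmd.overhead]⟩
  | seq c d hc hd =>
    intro τ h
    obtain ⟨τ₁, s₁, e₁, h₁, l₁⟩ := hc τ h
    obtain ⟨τ₂, s₂, e₂, h₂, l₂⟩ := hd τ₁ h₁
    exact ⟨τ₂, _, .seq e₁ e₂, h₂, by simp only [Cmd.overhead]; omega⟩
  | ite b c d hc hd =>
    exact fun τ h => ⟨τ, 5, exec_spend_zero _ h, h, by simp [Cmd.overhead]⟩
  | _ b c hc =>
    intro τ h
    refine ⟨_, _, .seq (exec_setFlag_zero _ h) (exec_flagLoop_zero _ (by simp)),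
      by simpa using h, ?_⟩
    simp only [Cmd.overhead]; omega

/-- A unit of fuel is spent on each assignment, branch and loop round, and each of these takes at
least one step of the original program; so at most `t` units are used. Conversely the code between
two payments has bounded length, which gives `c.overhead` steps for each unit, and once more for the
parts that spend none. If fuel is left at the end, the simulation has never been cut short. -/
theorem Exec.limit (hK : 42 ≤ K) {c : Cmd} {σ σ' : Mem} {t : ℕ} (h : Exec W c σ σ' t) :
    ∀ τ : Mem, τ.view K = σ → ∃ τ' s, Exec W (c.limit K) τ τ' s ∧
      τ'.ireg rFuel ≤ τ.ireg rFuel ∧ τ.ireg rFuel ≤ τ'.ireg rFuel + t ∧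
      s ≤ c.overhead * (τ.ireg rFuel - τ'.ireg rFuel + 1) ∧
      (0 < τ'.ireg rFuel → τ'.view K = σ') := by
  classical
  have zero : ∀ (c : Cmd) (σ' : Mem) (t : ℕ) (τ : Mem), τ.ireg rFuel = 0 →
      ∃ τ' s, Exec W (c.limit K) τ τ' s ∧
      τ'.ireg rFuel ≤ τ.ireg rFuel ∧ τ.ireg rFuel ≤ τ'.ireg rFuel + t ∧
      s ≤ c.overhead * (τ.ireg rFuel - τ'.ireg rFuel + 1) ∧
      (0 < τ'.ireg rFuel → τ'.view K = σ') := by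
    intro c σ' t τ h0
    obtain ⟨τ', s, he, hz, hs⟩ := c.exec_limit_zero (W := W) (K := K) τ h0
    refine ⟨τ', s, he, by omega, by omega, ?_, by omega⟩
    rw [h0, hz]; simpa using hs
  have view_dec : ∀ (τ : Mem) v, (τ.setIReg rFuel v).view K = τ.view K := fun τ v =>
    Mem.view_setIReg_of_lt (by simp; omega)
  have view_flag : ∀ (τ : Mem) v, (τ.setIReg rFlag v).view K = τ.view K := fun τ v =>
    Mem.view_setIReg_of_lt (by simp; omega)
  have atom : ∀ (c : Cmd) (τ τ' : Mem) (t k : ℕ), 0 < τ.ireg rFuel →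
      Exec W c (τ.setIReg rFuel (τ.ireg rFuel - 1)) τ' t →
      τ'.ireg rFuel = τ.ireg rFuel - 1 → t + 8 ≤ k → 1 ≤ t →
      Exec W (spend c) τ τ' (8 + t) ∧ τ'.ireg rFuel ≤ τ.ireg rFuel ∧
        τ.ireg rFuel ≤ τ'.ireg rFuel + t ∧
        8 + t ≤ k * (τ.ireg rFuel - τ'.ireg rFuel + 1) := by
    intro c τ τ' t k hf he hf' hk ht
    refine ⟨exec_spend hf he, by omega, by omega, ?_⟩
    have : τ.ireg rFuel - τ'.ireg rFuel + 1 = 2 := by omega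
    rw [this]; omega
  induction h with
  | skip => exact fun τ h => ⟨τ, 1, .skip _, by omega, by omega, by simp [Cmd.overhead], fun _ => h⟩
  | iset σ x e he =>
    rintro τ rfl
    rcases Nat.eq_zero_or_pos (τ.ireg rFuel) with h0 | h0
    · exact zero _ _ _ τ h0
    · obtain ⟨a, b, c, d⟩ := atom (.iset (K + x) (e.shift K)) τ _ _ (e.cost + 10) h0
        (Exec.iset _ _ _ (by simpa [view_dec] using he)) (by simp; omega) (by simp)
        (by simp)
      exact ⟨_, _, a, b, by simpa using c, d, fun _ => by simp [view_dec]⟩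
  | rset σ x e he =>
    rintro τ rfl
    rcases Nat.eq_zero_or_pos (τ.ireg rFuel) with h0 | h0
    · exact zero _ _ _ τ h0
    · obtain ⟨a, b, c, d⟩ := atom (.rset (K + x) (e.shift K)) τ _ _ (e.cost + 10) h0
        (Exec.rset _ _ _ (by simpa [view_dec] using he)) (by simp) (by simp)
        (by simp)
      exact ⟨_, _, a, b, by simpa using c, d, fun _ => by simp [view_dec]⟩
  | istore σ a i e hi he =>
    rintro τ rfl
    rcases Nat.eq_zero_or_pos (τ.ireg rFuel) with h0 | h0
    · exact zero _ _ _ τ h0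
    · obtain ⟨a, b, c, d⟩ := atom (.istore (K + a) (i.shift K) (e.shift K)) τ _ _
        (i.cost + e.cost + 10) h0 (Exec.istore _ _ _ _ (by simpa [view_dec] using hi)
          (by simpa [view_dec] using he)) (by simp) (by simp) (by simp)
      exact ⟨_, _, a, b, by simpa using c, d, fun _ => by simp [view_dec]⟩
  | rstore σ a i e hi he =>
    rintro τ rfl
    rcases Nat.eq_zero_or_pos (τ.ireg rFuel) with h0 | h0
    · exact zero _ _ _ τ h0
    · obtain ⟨a, b, c, d⟩ := atom (.rstore (K + a) (i.shift K) (e.shift K)) τ _ _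
        (i.cost + e.cost + 10) h0 (Exec.rstore _ _ _ _ (by simpa [view_dec] using hi)
          (by simpa [view_dec] using he)) (by simp) (by simp) (by simp)
      exact ⟨_, _, a, b, by simpa using c, d, fun _ => by simp [view_dec]⟩
  | @seq c d _ _ _ _ _ _ _ h1 h2 =>
    intro τ hτ
    obtain ⟨τ₁, s₁, e₁, a₁, b₁, c₁, d₁⟩ := h1 τ hτ
    rcases Nat.eq_zero_or_pos (τ₁.ireg rFuel) with h0 | h0
    -- The fuel ran out within `c`: nothing is known about the simulated memory, and `d` is only
    -- passed through.
    · obtain ⟨τ₂, s₂, e₂, z, l⟩ := d.exec_limit_zero (W := W) (K := K) τ₁ h0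
      refine ⟨τ₂, _, .seq e₁ e₂, by omega, by omega, ?_, by omega⟩
      rw [z]; rw [h0] at c₁
      simp only [Cmd.overhead]
      nlinarith
    · obtain ⟨τ₂, s₂, e₂, a₂, b₂, c₂, d₂⟩ := h2 τ₁ (d₁ h0)
      refine ⟨τ₂, _, .seq e₁ e₂, by omega, by omega, ?_, d₂⟩
      simp only [Cmd.overhead]
      have h3 : τ.ireg rFuel - τ₁.ireg rFuel + 1 ≤ τ.ireg rFuel - τ₂.ireg rFuel + 1 := by omega
      have h4 : τ₁.ireg rFuel - τ₂.ireg rFuel + 1 ≤ τ.ireg rFuel - τ₂.ireg rFuel + 1 := by omega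
      have h5 := Nat.mul_le_mul_left c.overhead h3
      have h6 := Nat.mul_le_mul_left d.overhead h4
      rw [add_mul]; omega
  | @iteTrue b c d _ _ t hf hb _ h1 =>
    rintro τ rfl
    rcases Nat.eq_zero_or_pos (τ.ireg rFuel) with h0 | h0
    · exact zero _ _ _ τ h0
    · obtain ⟨τ₁, s₁, e₁, a₁, b₁, c₁, d₁⟩ := h1 (τ.setIReg rFuel (τ.ireg rFuel - 1)) (view_dec _ _)
      have hfu : (τ.setIReg rFuel (τ.ireg rFuel - 1)).ireg rFuel = τ.ireg rFuel - 1 := by simp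
      rw [hfu] at a₁ b₁ c₁
      have := exec_spend h0 (Exec.iteTrue (b := b.shift K) (d := d.limit K)
        (by simpa [view_dec] using hf) (by simpa [view_dec] using hb) e₁)
      refine ⟨τ₁, _, this, by omega, by omega, ?_, d₁⟩
      simp only [Cmd.overhead, BExp.cost_shift]
      obtain ⟨u, hu⟩ : ∃ u, τ.ireg rFuel - τ₁.ireg rFuel = u + 1 :=
        ⟨τ.ireg rFuel - τ₁.ireg rFuel - 1, by omega⟩
      have hu' : τ.ireg rFuel - 1 - τ₁.ireg rFuel = u := by omega
      rw [hu]; rw [hu'] at c₁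
      nlinarith [Nat.zero_le d.overhead, Nat.zero_le (d.overhead * u), Nat.zero_le (b.cost * u)]
  | @iteFalse b c d _ _ t hf hb _ h1 =>
    rintro τ rfl
    rcases Nat.eq_zero_or_pos (τ.ireg rFuel) with h0 | h0
    · exact zero _ _ _ τ h0
    · obtain ⟨τ₁, s₁, e₁, a₁, b₁, c₁, d₁⟩ := h1 (τ.setIReg rFuel (τ.ireg rFuel - 1)) (view_dec _ _)
      have hfu : (τ.setIReg rFuel (τ.ireg rFuel - 1)).ireg rFuel = τ.ireg rFuel - 1 := by simp
      rw [hfu] at a₁ b₁ c₁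
      have := exec_spend h0 (Exec.iteFalse (b := b.shift K) (c := c.limit K)
        (by simpa [view_dec] using hf) (by simpa [view_dec] using hb) e₁)
      refine ⟨τ₁, _, this, by omega, by omega, ?_, d₁⟩
      simp only [Cmd.overhead, BExp.cost_shift]
      obtain ⟨u, hu⟩ : ∃ u, τ.ireg rFuel - τ₁.ireg rFuel = u + 1 :=
        ⟨τ.ireg rFuel - τ₁.ireg rFuel - 1, by omega⟩
      have hu' : τ.ireg rFuel - 1 - τ₁.ireg rFuel = u := by omega
      rw [hu]; rw [hu'] at c₁
      nlinarith [Nat.zero_le c.overhead, Nat.zero_le (c.overhead * u), Nat.zero_le (b.cost * u)]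
  | @whileTrue b c _ _ _ s t hf hb _ _ h1 h2 =>
    rintro τ rfl
    rcases Nat.eq_zero_or_pos (τ.ireg rFuel) with h0 | h0
    · exact zero _ _ _ τ h0
    have e0 := exec_setFlag (W := W) (b := b.shift K) h0 (by simpa using hf)
    rw [if_pos (by simpa using hb)] at e0
    set τ₁ := τ.setIReg rFlag 1 with hτ₁
    have hfu₁ : τ₁.ireg rFuel = τ.ireg rFuel := by simp [hτ₁]
    have e1 : Exec W (.iset rFuel (.sub (.reg rFuel) (.const 1))) τ₁
      (τ₁.setIReg rFuel (τ₁.ireg rFuel - 1)) 4 := Exec.iset τ₁ rFuel _ ⟨trivial, trivial⟩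
    set τ₂ := τ₁.setIReg rFuel (τ₁.ireg rFuel - 1) with hτ₂
    have hfu₂ : τ₂.ireg rFuel = τ.ireg rFuel - 1 := by simp [hτ₂, hτ₁]
    obtain ⟨τ₃, s₃, e₃, a₃, b₃, c₃, d₃⟩ := h1 τ₂ (by rw [hτ₂, view_dec, hτ₁, view_flag])
    rw [hfu₂] at a₃ b₃ c₃
    have hflag : BExp.Holds τ₁ (.ieq (.reg rFlag) (.const 1)) := by simp [hτ₁]
    rcases Nat.eq_zero_or_pos (τ₃.ireg rFuel) with h3 | h3
    -- The fuel ran out within the loop body, so the flag is cleared without evaluating the test,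
    -- and the loop ends.
    · have e4 := exec_setFlag_zero (W := W) (b.shift K) h3
      refine ⟨_, _, .seq e0 (.whileTrue ⟨trivial, trivial⟩ hflag (.seq e1 (.seq e₃ e4))
        (exec_flagLoop_zero _ (by simp))), ?_, ?_, ?_, ?_⟩
      · simp at h3; simp [h3]
      · simp at h3 b₃ ⊢; omega
      · have : (τ₃.setIReg rFlag 0).ireg rFuel = 0 := by simpa using h3
        rw [this]
        rw [h3] at c₃
        simp only [Cmd.overhead, BExp.cost_shift, BExp.cost, IExp.cost]
        obtain ⟨u, hu⟩ : ∃ u, τ.ireg rFuel = u + 1 := ⟨_, (Nat.succ_pred_eq_of_pos h0).symm⟩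
        rw [hu] at c₃ ⊢
        simp only [Nat.add_sub_cancel, Nat.sub_zero] at c₃ ⊢
        nlinarith [Nat.zero_le (b.cost * u)]
      · intro h; simp at h h3; omega
    · obtain ⟨τ₄, s₄, e₄, a₄, b₄, c₄, d₄⟩ := h2 τ₃ (d₃ h3)
      -- The simulation of the remaining rounds begins by setting the flag; this step is reused as
      -- the end of the present loop body.
      cases e₄ with
      | seq e₅ e₆ =>
        refine ⟨τ₄, _, .seq e0 (.whileTrue ⟨trivial, trivial⟩ hflag (.seq e1 (.seq e₃ e₅)) e₆),
          by omega, by omega, ?_, d₄⟩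
        simp only [Cmd.overhead, BExp.cost_shift, BExp.cost, IExp.cost] at c₄ ⊢
        obtain ⟨u, hu⟩ : ∃ u, τ₃.ireg rFuel = τ₄.ireg rFuel + u := ⟨_, (Nat.add_sub_of_le a₄).symm⟩
        obtain ⟨w, hw⟩ : ∃ w, τ.ireg rFuel = τ₃.ireg rFuel + 1 + w :=
          ⟨_, (Nat.add_sub_of_le (by omega)).symm⟩
        have q1 : τ.ireg rFuel - 1 - τ₃.ireg rFuel + 1 = w + 1 := by omega
        have q2 : τ₃.ireg rFuel - τ₄.ireg rFuel + 1 = u + 1 := by omega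
        have q3 : τ.ireg rFuel - τ₄.ireg rFuel + 1 = (u + 1) + (w + 1) := by omega
        rw [q1] at c₃; rw [q2] at c₄; rw [q3, mul_add]
        nlinarith [Nat.zero_le (b.cost * w)]
  | @whileFalse b c _ hf hb =>
    rintro τ rfl
    rcases Nat.eq_zero_or_pos (τ.ireg rFuel) with h0 | h0
    · exact zero _ _ _ τ h0
    have e0 := exec_setFlag (W := W) (b := b.shift K) h0 (by simpa using hf)
    rw [if_neg (by simpa using hb)] at e0
    refine ⟨_, _, .seq e0 (exec_flagLoop_zero _ (by simp)), by simp, by simp, ?_,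
      fun _ => view_flag _ _⟩
    simp [Cmd.overhead]; omega

theorem Cmd.writes_limit (c : Cmd) {l : Loc} (h : l.index < K) (h1 : l ≠ .ireg rFuel)
    (h2 : l ≠ .ireg rFlag) : (c.limit K).writes l = false := by
  induction c with
  | skip => rfl
  | iset x e | rset x e | istore a i e | rstore a i e =>
    simp only [Cmd.limit, spend, Cmd.writes, Bool.or_eq_false_iff, decide_eq_false_iff_not]
    refine ⟨⟨h1, ?_⟩, trivial⟩
    rintro rfl
    simp [Loc.index] at h
  | seq c d hc hd => simp [Cmd.limit, Cmd.writes, hc, hd]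
  | ite b c d hc hd =>
    simp only [rFuel] at h1
    simp [Cmd.limit, spend, Cmd.writes, hc, hd, h1]
  | _ b c hc =>
    simp only [rFuel, rFlag] at h1 h2
    simp [Cmd.limit, setFlag, Cmd.writes, hc, h1, h2]

/-- A program of unknown running time is executed with a limited number of steps. -/
theorem Runs.limit (hK : 42 ≤ K) {c : Cmd} {Q : Mem → ℕ → Prop} (h : Runs W c (τ.view K) Q) :
    Runs W (c.limit K) τ fun τ' s => ∃ t, s ≤ c.overhead * (min t (τ.ireg rFuel) + 1) ∧
      (τ'.ireg rFuel = 0 → τ.ireg rFuel ≤ t) ∧ (0 < τ'.ireg rFuel → Q (τ'.view K) t) ∧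
      ∃ ρ, Q ρ t := by
  obtain ⟨σ', t, he, hq⟩ := h
  obtain ⟨τ', s, he', h1, h2, h3, h4⟩ := he.limit hK τ rfl
  refine ⟨τ', s, he', t, h3.trans (Nat.mul_le_mul_left _ ?_), by omega, fun h => ?_, σ', hq⟩
  · omega
  · rw [h4 h]; exact hq

end Limit

end RealRAM

namespace RealRAM

/-! ## The exponent of matrix multiplication -/

/-- A program writes at most one cell in each step. -/
theorem Exec.exists_written {W : ℕ} {c : Cmd} {σ τ : Mem} {t : ℕ} (h : Exec W c σ τ t) (a : ℕ) :
    ∃ S : Finset ℕ, S.card ≤ t ∧ ∀ i ∉ S, τ.rarr a i = σ.rarr a i := by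
  induction h with
  | skip | iset | rset | istore => exact ⟨∅, by simp, by simp⟩
  | rstore σ b i e hi he =>
    refine ⟨{i.eval σ}, by simp, fun j hj => ?_⟩
    have : j ≠ i.eval σ := by simpa using hj
    simp [this]
  | seq _ _ h1 h2 =>
    obtain ⟨S, hS, hS'⟩ := h1
    obtain ⟨T, hT, hT'⟩ := h2
    refine ⟨S ∪ T, (Finset.card_union_le _ _).trans (by omega), fun i hi => ?_⟩
    rw [Finset.mem_union, not_or] at hi
    rw [hT' i hi.2, hS' i hi.1]
  | iteTrue _ _ _ h1 | iteFalse _ _ _ h1 =>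
    obtain ⟨S, hS, hS'⟩ := h1
    exact ⟨S, by omega, hS'⟩
  | whileTrue _ _ _ _ h1 h2 =>
    obtain ⟨S, hS, hS'⟩ := h1
    obtain ⟨T, hT, hT'⟩ := h2
    refine ⟨S ∪ T, (Finset.card_union_le _ _).trans (by omega), fun i hi => ?_⟩
    rw [Finset.mem_union, not_or] at hi
    rw [hT' i hi.2, hS' i hi.1]
  | whileFalse => exact ⟨∅, by simp, by simp⟩

theorem mul_add_inj {n i j i' j' : ℕ} (hj : j < n) (hj' : j' < n) :
    i * n + j = i' * n + j' ↔ i = i' ∧ j = j' := by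
  constructor
  · intro h
    have h1 : (i * n + j) / n = i := by
      rw [mul_comm, Nat.mul_add_div (by omega), Nat.div_eq_of_lt hj, add_zero]
    have h2 : (i' * n + j') / n = i' := by
      rw [mul_comm, Nat.mul_add_div (by omega), Nat.div_eq_of_lt hj', add_zero]
    have : i = i' := by rw [← h1, ← h2, h]
    subst this
    exact ⟨rfl, by omega⟩
  · rintro ⟨rfl, rfl⟩; rfl

/-- All entries of the product have to be written. -/
theorem IsMatMulExponent.two_le {τ : ℝ} (h : IsMatMulExponent τ) : 2 ≤ τ := by
  obtain ⟨P, c, C, hP⟩ := h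
  by_contra! hτ
  have key : ∀ n : ℕ, 1 ≤ n → (n : ℝ) ^ (2 - τ) ≤ C := by
    intro n hn
    -- All entries of the factors are `1`, so those of the product are `n ≠ 0`, while the array for
    -- the result holds zeros at the start. Thus all `n ^ 2` cells must be written, and `n ^ (2 -
    -- τ)` would be bounded.
    let σ : Mem := ⟨fun _ => n, fun _ => 0, fun _ _ => 0, fun a _ => if a = 2 then 0 else 1⟩
    obtain ⟨σ', t, he, hres, ht⟩ := hP n hn (Matrix.of fun _ _ => 1) (Matrix.of fun _ _ => 1) σ rfl
      (fun _ _ => by simp [σ]) (fun _ _ => by simp [σ])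
    obtain ⟨S, hS, hS'⟩ := he.exists_written 2
    let f : Fin n × Fin n → ℕ := fun p => p.1 * n + p.2
    have hf : Function.Injective f := by
      rintro ⟨i, j⟩ ⟨i', j'⟩ h
      have := (mul_add_inj j.2 j'.2).1 h
      exact Prod.ext (Fin.ext this.1) (Fin.ext this.2)
    have hsub : Finset.univ.image f ⊆ S := by
      intro x hx
      obtain ⟨⟨i, j⟩, -, rfl⟩ := Finset.mem_image.1 hx
      by_contra hx
      have h1 := hres i j
      have h2 : σ'.rarr 2 (i * n + j) = 0 := by rw [hS' _ hx]; simp [σ]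
      rw [h2, Matrix.mul_apply] at h1
      simp at h1
      exact absurd h1 (by exact_mod_cast (by omega : ¬ 0 = n))
    have hcard := Finset.card_le_card hsub
    rw [Finset.card_image_of_injective _ hf] at hcard
    simp at hcard
    have h1 : (n : ℝ) ^ (2 : ℝ) ≤ C * (n : ℝ) ^ τ := by
      refine le_trans ?_ ht
      rw [Real.rpow_two, sq]
      exact_mod_cast hcard.trans hS
    have hn' : (0 : ℝ) < n := by exact_mod_cast hn
    rw [Real.rpow_sub hn', div_le_iff₀ (Real.rpow_pos_of_pos hn' τ)]
    exact h1
  have h1 : Filter.Tendsto (fun n : ℕ => (n : ℝ) ^ (2 - τ)) Filter.atTop Filter.atTop :=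
    (tendsto_rpow_atTop (by linarith)).comp tendsto_natCast_atTop_atTop
  obtain ⟨n, hn1, hn2⟩ := ((h1.eventually_gt_atTop (C : ℝ)).and
    (Filter.eventually_ge_atTop 1)).exists
  exact absurd (key n hn2) (not_le.2 hn1)

/-- The schoolbook multiplication of two matrices. -/
def schoolbook : Cmd :=
  block [
    .iset 1 (.const 0),
    .while (.ilt (.reg 1) (.reg 0)) (block [
      .iset 2 (.const 0),
      .while (.ilt (.reg 2) (.reg 0)) (block [
        .rset 0 (.const 0),
        .iset 3 (.const 0),
        .while (.ilt (.reg 3) (.reg 0)) (block [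
          .rset 0 (.add (.reg 0) (.mul
            (.arr 0 (.add (.mul (.reg 1) (.reg 0)) (.reg 3)))
            (.arr 1 (.add (.mul (.reg 3) (.reg 0)) (.reg 2))))),
          .iset 3 (.add (.reg 3) (.const 1))]),
        .rstore 2 (.add (.mul (.reg 1) (.reg 0)) (.reg 2)) (.reg 0),
        .iset 2 (.add (.reg 2) (.const 1))]),
      .iset 1 (.add (.reg 1) (.const 1))])]

theorem square_fits {n W i j : ℕ} (hW : (n + 2) ^ 2 ≤ W) (hi : i < n) (hj : j < n) :
    i * n < W ∧ i * n + j < W ∧ i + 1 < W := by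
  refine ⟨?_, ?_, ?_⟩ <;> nlinarith

theorem runs_schoolbook {n W : ℕ} (hn1 : 1 ≤ n) (hW : (n + 2) ^ 2 ≤ W) {σ : Mem}
    (hn : σ.ireg 0 = n) :
    Runs W schoolbook σ fun τ t => (∀ i < n, ∀ j < n, τ.rarr 2 (i * n + j) =
      ∑ k ∈ Finset.range n, σ.rarr 0 (i * n + k) * σ.rarr 1 (k * n + j)) ∧ t ≤ 200 * n ^ 3 := by
  simp only [schoolbook, block_cons_cons, block_single, runs_seq]
  simp
  refine runs_below 1 0 n (fun i τ t => (∀ i' < i, ∀ j < n, τ.rarr 2 (i' * n + j) =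
      ∑ k ∈ Finset.range n, σ.rarr 0 (i' * n + k) * σ.rarr 1 (k * n + j)) ∧
      t ≤ i * (150 * n ^ 2)) (by omega) (by simp) ⟨by omega, by omega⟩ ?_ ?_ ?_
  · intro i τ t _ _ hF _
    exact ⟨trivial, (hF.ireg 0 rfl).trans (by simpa using hn)⟩
  · rintro i τ t i1 i2 hF hi ⟨hJ1, hJ2⟩
    have hnτ : τ.ireg 0 = n := (hF.ireg 0 rfl).trans (by simpa using hn)
    have hA : τ.rarr 0 = σ.rarr 0 := hF.rarr 0 rfl
    have hB : τ.rarr 1 = σ.rarr 1 := hF.rarr 1 rfl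
    simp
    refine runs_below 2 0 n (fun j ρ s => (∀ i' < i, ∀ j < n, ρ.rarr 2 (i' * n + j) =
        ∑ k ∈ Finset.range n, σ.rarr 0 (i' * n + k) * σ.rarr 1 (k * n + j)) ∧
        (∀ j' < j, ρ.rarr 2 (i * n + j') =
        ∑ k ∈ Finset.range n, σ.rarr 0 (i * n + k) * σ.rarr 1 (k * n + j')) ∧
        s ≤ j * (100 * n)) (by omega) (by simp) ⟨hJ1, by omega, by omega⟩ ?_ ?_ ?_
    · intro j ρ s _ _ hF _
      exact ⟨trivial, (hF.ireg 0 rfl).trans (by simpa using hnτ)⟩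
    · rintro j ρ s j1 j2 hF' hj ⟨hK1, hK2, hK3⟩
      have hnρ : ρ.ireg 0 = n := (hF'.ireg 0 rfl).trans (by simpa using hnτ)
      have hiρ : ρ.ireg 1 = i := (hF'.ireg 1 rfl).trans (by simpa using hi)
      have hA' : ρ.rarr 0 = σ.rarr 0 := (hF'.rarr 0 rfl).trans hA
      have hB' : ρ.rarr 1 = σ.rarr 1 := (hF'.rarr 1 rfl).trans hB
      simp
      refine runs_below 3 0 n (fun k μ r => μ.rreg 0 =
        ∑ k' ∈ Finset.range k, σ.rarr 0 (i * n + k') * σ.rarr 1 (k' * n + j) ∧ r ≤ k * 40)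
        (by omega) (by simp) ⟨by simp, by omega⟩ ?_ ?_ ?_
      · intro k μ r _ _ hF _
        exact ⟨trivial, (hF.ireg 0 rfl).trans (by simpa using hnρ)⟩
      · rintro k μ r k1 k2 hF'' hk ⟨hL1, hL2⟩
        have hnμ : μ.ireg 0 = n := (hF''.ireg 0 rfl).trans (by simpa using hnρ)
        have hiμ : μ.ireg 1 = i := (hF''.ireg 1 rfl).trans (by simpa using hiρ)
        have hjμ : μ.ireg 2 = j := (hF''.ireg 2 rfl).trans (by simpa using hj)
        have hA'' : μ.rarr 0 = σ.rarr 0 := (hF''.rarr 0 rfl).trans hA'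
        have hB'' : μ.rarr 1 = σ.rarr 1 := (hF''.rarr 1 rfl).trans hB'
        simp [hnμ, hiμ, hjμ, hk, square_fits hW i2 k2, square_fits hW k2 j2, hA'', hB'', hL1]
        rw [Finset.sum_range_succ]
        exact ⟨rfl, by omega⟩
      · rintro μ r hF'' hk ⟨hL1, hL2⟩
        have hnμ : μ.ireg 0 = n := (hF''.ireg 0 rfl).trans (by simpa using hnρ)
        have hiμ : μ.ireg 1 = i := (hF''.ireg 1 rfl).trans (by simpa using hiρ)
        have hjμ : μ.ireg 2 = j := (hF''.ireg 2 rfl).trans (by simpa using hj)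
        have hC'' : μ.rarr 2 = ρ.rarr 2 := (hF''.rarr 2 rfl)
        simp [hnμ, hiμ, hjμ, square_fits hW i2 j2, square_fits hW j2 j2, hC'', hL1]
        refine ⟨fun i' hi' j' hj' => ?_, fun j' hj' => ?_, ?_⟩
        · rw [if_neg, hK1 i' hi' j' hj']
          rw [mul_add_inj hj' j2]; omega
        · rcases Nat.lt_or_eq_of_le hj' with h | h
          · rw [if_neg (by omega), hK2 j' h]
          · subst h; simp
        · have : (j + 1) * (100 * n) = j * (100 * n) + 100 * n := by ring
          omega
    · rintro ρ s hF' hj ⟨hK1, hK2, hK3⟩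
      have hiρ : ρ.ireg 1 = i := (hF'.ireg 1 rfl).trans (by simpa using hi)
      simp [hiρ, square_fits hW i2 i2]
      refine ⟨fun i' hi' j' hj' => ?_, by nlinarith⟩
      rcases Nat.lt_or_eq_of_le hi' with h | h
      · exact hK1 i' h j' hj'
      · subst h; exact hK2 j' hj'
  · rintro τ t hF hi ⟨hJ1, hJ2⟩
    refine ⟨hJ1, ?_⟩
    have h1 : n ^ 3 = n * n ^ 2 := by ring
    have h2 : 1 ≤ n ^ 3 := Nat.one_le_pow _ _ hn1
    simp
    nlinarith

theorem isMatMulExponent_three : IsMatMulExponent 3 := by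
  refine ⟨schoolbook, 2, 200, fun n hn A B σ h0 hA hB => ?_⟩
  obtain ⟨τ, t, he, h1, h2⟩ := runs_schoolbook hn le_rfl h0
  refine ⟨τ, t, he, fun i j => ?_, ?_⟩
  · rw [h1 i i.2 j j.2, Matrix.mul_apply, Finset.sum_range]
    exact Finset.sum_congr rfl fun k _ => by rw [hA, hB]
  · have : (3 : ℝ) = (3 : ℕ) := by norm_num
    rw [this, Real.rpow_natCast]
    exact_mod_cast h2

/-- A number above an infimum lies above some element, provided that the set is not empty; the
schoolbook method provides an element. -/
theorem exists_isMatMulExponent_le {τ : ℝ} (h : IsMatMulExponent τ ∨ omega < τ) :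
    ∃ τ' ≤ τ, IsMatMulExponent τ' := by
  rcases h with h | h
  · exact ⟨τ, le_rfl, h⟩
  · obtain ⟨τ', h1, h2⟩ := exists_lt_of_csInf_lt ⟨3, isMatMulExponent_three⟩ h
    exact ⟨τ', h2.le, h1⟩

/-- The specification of a program that multiplies matrices. -/
def Multiplies (P : Cmd) (c C : ℕ) (τ : ℝ) : Prop :=
  ∀ (n : ℕ), 1 ≤ n → ∀ σ : Mem, σ.ireg 0 = n →
    Runs ((n + 2) ^ c) P σ fun σ' t => (∀ i < n, ∀ j < n, σ'.rarr 2 (i * n + j) =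
      ∑ k ∈ Finset.range n, σ.rarr 0 (i * n + k) * σ.rarr 1 (k * n + j)) ∧ (t : ℝ) ≤ C * (n : ℝ) ^ τ

/-- The factors are read off from the memory itself, so that later no matrices have to be supplied,
only the contents of arrays. -/
theorem IsMatMulExponent.exists_multiplies {τ : ℝ} (h : IsMatMulExponent τ) :
    ∃ P c C, Multiplies P c C τ := by
  obtain ⟨P, c, C, hP⟩ := h
  refine ⟨P, c, C, fun n hn σ hσ => ?_⟩
  obtain ⟨σ', t, he, h1, h2⟩ := hP n hn (Matrix.of fun i j => σ.rarr 0 (i * n + j))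
    (Matrix.of fun i j => σ.rarr 1 (i * n + j)) σ hσ (fun _ _ => rfl) (fun _ _ => rfl)
  refine ⟨σ', t, he, fun i hi j hj => ?_, h2⟩
  have := h1 ⟨i, hi⟩ ⟨j, hj⟩
  rw [Matrix.mul_apply] at this
  rw [Finset.sum_range]
  exact this

end RealRAM

namespace RealRAM

/-! ## Transitive closure by matrix multiplication -/

/-- Copy a square block of a matrix.  Register `1` holds the number of its rows; the registers `5`
and `6` hold the address and the row length of the source, and the registers `7` and `8` those of
the target. -/
def copyBlock (d a : ℕ) : Cmd :=
  block [
    .iset 3 (.const 0),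
    .while (.ilt (.reg 3) (.reg 1)) (block [
      .iset 4 (.const 0),
      .while (.ilt (.reg 4) (.reg 1)) (block [
        .rstore d (.add (.add (.reg 7) (.mul (.reg 3) (.reg 8))) (.reg 4))
          (.arr a (.add (.add (.reg 5) (.mul (.reg 3) (.reg 6))) (.reg 4))),
        .iset 4 (.add (.reg 4) (.const 1))]),
      .iset 3 (.add (.reg 3) (.const 1))])]

theorem block_fits {W b r s i j : ℕ} (h : b + s * r + s < W) (hi : i < s) (hj : j < s) :
    i * r < W ∧ b + i * r < W ∧ b + i * r + j < W ∧ j + 1 < W ∧ i + 1 < W := by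
  have : i * r ≤ s * r := Nat.mul_le_mul_right r hi.le
  omega

/-- The condition `s ≤ dr` keeps the rows of the target apart, so that no cell is written twice. -/
theorem runs_copyBlock {W d a s sb sr db dr : ℕ} (hda : d ≠ a) {σ : Mem} (hs : σ.ireg 1 = s)
    (hs1 : 1 ≤ s) (h5 : σ.ireg 5 = sb) (h6 : σ.ireg 6 = sr) (h7 : σ.ireg 7 = db)
    (h8 : σ.ireg 8 = dr) (hWs : sb + s * sr + s < W) (hWd : db + s * dr + s < W) (hdr : s ≤ dr) :
    Runs W (copyBlock d a) σ fun τ t =>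
      (∀ i < s, ∀ j < s, τ.rarr d (db + i * dr + j) = σ.rarr a (sb + i * sr + j)) ∧
      (∀ x, (∀ i < s, ∀ j < s, x ≠ db + i * dr + j) → τ.rarr d x = σ.rarr d x) ∧
      t ≤ 100 * s ^ 2 := by
  have hinj : ∀ i j i' j', j < s → j' < s →
      (db + i * dr + j = db + i' * dr + j' ↔ i = i' ∧ j = j') := by
    intro i j i' j' hj hj'
    rw [← mul_add_inj (n := dr) (hj.trans_le hdr) (hj'.trans_le hdr)]
    omega
  simp only [copyBlock, block_cons_cons, block_single, runs_seq]
  simp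
  refine runs_below 3 0 s (fun i τ t =>
      (∀ i' < i, ∀ j < s, τ.rarr d (db + i' * dr + j) = σ.rarr a (sb + i' * sr + j)) ∧
      (∀ x, (∀ i < s, ∀ j < s, x ≠ db + i * dr + j) → τ.rarr d x = σ.rarr d x) ∧
      t ≤ i * (60 * s)) (by omega) (by simp) ⟨by omega, by simp, by omega⟩ ?_ ?_ ?_
  · intro i τ t _ _ hF _
    exact ⟨trivial, (hF.ireg 1 rfl).trans (by simpa using hs)⟩
  · rintro i τ t i1 i2 hF hi ⟨hJ1, hJ2, hJ3⟩
    have hs' : τ.ireg 1 = s := (hF.ireg 1 rfl).trans (by simpa using hs)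
    have h5' : τ.ireg 5 = sb := (hF.ireg 5 rfl).trans (by simpa using h5)
    have h6' : τ.ireg 6 = sr := (hF.ireg 6 rfl).trans (by simpa using h6)
    have h7' : τ.ireg 7 = db := (hF.ireg 7 rfl).trans (by simpa using h7)
    have h8' : τ.ireg 8 = dr := (hF.ireg 8 rfl).trans (by simpa using h8)
    have hA : τ.rarr a = σ.rarr a := hF.rarr a (by simp [Cmd.writes, hda.symm])
    simp
    refine runs_below 4 0 s (fun j ρ t =>
        (∀ i' < i, ∀ j < s, ρ.rarr d (db + i' * dr + j) = σ.rarr a (sb + i' * sr + j)) ∧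
        (∀ j' < j, ρ.rarr d (db + i * dr + j') = σ.rarr a (sb + i * sr + j')) ∧
        (∀ x, (∀ i < s, ∀ j < s, x ≠ db + i * dr + j) → ρ.rarr d x = σ.rarr d x) ∧
        t ≤ j * 40) (by omega) (by simp) ⟨hJ1, by omega, hJ2, by omega⟩ ?_ ?_ ?_
    · intro i τ t _ _ hF _
      exact ⟨trivial, (hF.ireg 1 rfl).trans (by simpa using hs')⟩
    · rintro j ρ r j1 j2 hF' hj ⟨hK1, hK2, hK3, hK4⟩
      have hiρ : ρ.ireg 3 = i := (hF'.ireg 3 rfl).trans (by simpa using hi)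
      have h5ρ : ρ.ireg 5 = sb := (hF'.ireg 5 rfl).trans (by simpa using h5')
      have h6ρ : ρ.ireg 6 = sr := (hF'.ireg 6 rfl).trans (by simpa using h6')
      have h7ρ : ρ.ireg 7 = db := (hF'.ireg 7 rfl).trans (by simpa using h7')
      have h8ρ : ρ.ireg 8 = dr := (hF'.ireg 8 rfl).trans (by simpa using h8')
      have hAρ : ρ.rarr a = σ.rarr a :=
        (hF'.rarr a (by simp [Cmd.writes, hda.symm])).trans hA
      simp [hiρ, hj, h5ρ, h6ρ, h7ρ, h8ρ, hAρ, block_fits hWs i2 j2, block_fits hWd i2 j2]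
      refine ⟨fun i' hi' j' hj' => ?_, fun j' hj' => ?_, fun x hx => ?_, by omega⟩
      · have := hinj i' j' i j hj' j2
        rw [if_neg (by omega), hK1 i' hi' j' hj']
      · rcases Nat.lt_or_eq_of_le hj' with h | h
        · rw [if_neg (by omega), hK2 j' h]
        · subst h; simp
      · rw [if_neg (hx i i2 j j2), hK3 x hx]
    · rintro ρ r hF' hj ⟨hK1, hK2, hK3, hK4⟩
      have hiρ : ρ.ireg 3 = i := (hF'.ireg 3 rfl).trans (by simpa using hi)
      simp [hiρ, block_fits hWs i2 i2]
      refine ⟨fun i' hi' j' hj' => ?_, hK3, ?_⟩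
      · rcases Nat.lt_or_eq_of_le hi' with h | h
        · exact hK1 i' h j' hj'
        · subst h; exact hK2 j' hj'
      · have : (i + 1) * (60 * s) = i * (60 * s) + 60 * s := by ring
        omega
  · rintro τ t hF hi ⟨hJ1, hJ2, hJ3⟩
    refine ⟨hJ1, hJ2, ?_⟩
    have : s * (60 * s) = 60 * s ^ 2 := by ring
    have : 1 ≤ s ^ 2 := Nat.one_le_pow _ _ hs1
    simp
    omega

/-- Multiply the blocks in the arrays `20` and `21`. -/
def multiplyBlocks (P : Cmd) : Cmd :=
  .seq (.iset 20 (.reg 1)) (P.shift 20)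

theorem writes_multiplyBlocks (P : Cmd) {l : Loc} (hl : l.index < 20) :
    (multiplyBlocks P).writes l = false := by
  simp only [multiplyBlocks, Cmd.writes, Cmd.writes_shift P hl, Bool.or_false,
    decide_eq_false_iff_not]
  rintro rfl
  simp [Loc.index] at hl

/-- Renumbered by `20`, the program finds the dimension in register `20` and the factors in the
arrays `20` and `21`, and it leaves the product in the array `22`. -/
theorem runs_multiplyBlocks {P : Cmd} {c C W s : ℕ} {τ : ℝ} (hP : Multiplies P c C τ) {σ : Mem}
    (hs : σ.ireg 1 = s) (hs1 : 1 ≤ s) (hW : (s + 2) ^ c ≤ W) :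
    Runs W (multiplyBlocks P) σ fun σ' t => (∀ i < s, ∀ j < s, σ'.rarr 22 (i * s + j) =
      ∑ k ∈ Finset.range s, σ.rarr 20 (i * s + k) * σ.rarr 21 (k * s + j)) ∧
      (t : ℝ) ≤ C * (s : ℝ) ^ τ + 2 := by
  simp only [multiplyBlocks, runs_seq, runs_iset]
  refine ⟨trivial, ?_⟩
  have h := hP s hs1 ((σ.setIReg 20 s).view 20) (by simp [Mem.view])
  simp only [IExp.eval, hs]
  refine ((h.mono hW).shift).imp fun τ t hF hQ => ?_
  refine ⟨hQ.1, ?_⟩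
  have := hQ.2
  push_cast [IExp.cost]
  linarith

/-- Copy the block at the address `e` of the matrix into the array `d`. -/
def loadBlock (d : ℕ) (e : IExp) : Cmd :=
  block [.iset 5 e, .iset 6 (.reg 0), .iset 7 (.const 0), .iset 8 (.reg 1), copyBlock d 0]

/-- Copy the product of two blocks into the array `20`. -/
def reuseBlock : Cmd :=
  block [.iset 5 (.const 0), .iset 6 (.reg 1), .iset 7 (.const 0), .iset 8 (.reg 1),
    copyBlock 20 22]

/-- Copy the product of two blocks to the address `e` of the matrix. -/
def storeBlock (e : IExp) : Cmd :=
  block [.iset 5 (.const 0), .iset 6 (.reg 1), .iset 7 e, .iset 8 (.reg 0), copyBlock 0 22]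

section Blocks

variable {W N s b : ℕ} {e : IExp} {σ : Mem}

theorem runs_loadBlock {d : ℕ} (hd : d ≠ 0) (h0 : σ.ireg 0 = N) (h1 : σ.ireg 1 = s) (hs1 : 1 ≤ s)
    (he : e.Fits W σ) (hb : e.eval σ = b) (hWs : b + s * N + s < W) (hW : s * s + s < W) :
    Runs W (loadBlock d e) σ fun τ t =>
      (∀ i < s, ∀ j < s, τ.rarr d (i * s + j) = σ.rarr 0 (b + i * N + j)) ∧
      t ≤ 100 * s ^ 2 + e.cost + 10 := by
  simp only [loadBlock, block_cons_cons, block_single]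
  simp [h0, h1, he, hb]
  refine (runs_copyBlock (d := d) (a := 0) (s := s) (sb := b) (sr := N) (db := 0) (dr := s) hd
    (by simp [h1]) hs1 (by simp) (by simp) (by simp) (by simp) hWs (by omega)
    le_rfl).imp fun τ t hF ⟨hA, _, ht⟩ => ?_
  simp at hA
  exact ⟨hA, by omega⟩

theorem runs_reuseBlock (h1 : σ.ireg 1 = s) (hs1 : 1 ≤ s) (hW : s * s + s < W) :
    Runs W reuseBlock σ fun τ t =>
      (∀ i < s, ∀ j < s, τ.rarr 20 (i * s + j) = σ.rarr 22 (i * s + j)) ∧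
      t ≤ 100 * s ^ 2 + 10 := by
  simp only [reuseBlock, block_cons_cons, block_single]
  simp [h1]
  refine (runs_copyBlock (d := 20) (a := 22) (s := s) (sb := 0) (sr := s) (db := 0) (dr := s)
    (by omega) (by simp [h1]) hs1 (by simp) (by simp) (by simp) (by simp) (by omega) (by omega)
    le_rfl).imp fun τ t hF ⟨hA, _, ht⟩ => ?_
  simp at hA
  exact ⟨hA, by omega⟩

theorem runs_storeBlock (h0 : σ.ireg 0 = N) (h1 : σ.ireg 1 = s) (hs1 : 1 ≤ s) (hs : s ≤ N)
    (he : ∀ x y, e.Fits W ((σ.setIReg 5 x).setIReg 6 y))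
    (hb : ∀ x y, e.eval ((σ.setIReg 5 x).setIReg 6 y) = b) (hWs : b + s * N + s < W)
    (hW : s * s + s < W) :
    Runs W (storeBlock e) σ fun τ t =>
      (∀ i < s, ∀ j < s, τ.rarr 0 (b + i * N + j) = σ.rarr 22 (i * s + j)) ∧
      (∀ x, (∀ i < s, ∀ j < s, x ≠ b + i * N + j) → τ.rarr 0 x = σ.rarr 0 x) ∧
      t ≤ 100 * s ^ 2 + e.cost + 10 := by
  simp only [storeBlock, block_cons_cons, block_single]
  simp [h0, h1, he, hb]
  refine (runs_copyBlock (d := 0) (a := 22) (s := s) (sb := 0) (sr := s) (db := b) (dr := N)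
    (by omega) (by simp [h1]) hs1 (by simp) (by simp) (by simp) (by simp) (by omega) (by omega)
    hs).imp fun τ t hF ⟨hA, hA', ht⟩ => ?_
  simp at hA hA'
  exact ⟨hA, hA', by omega⟩

end Blocks

/-- The address of the left one of two consecutive diagonal blocks. -/
def leftAddr : IExp := .add (.mul (.reg 2) (.reg 0)) (.reg 2)

/-- The address of the block above two consecutive diagonal blocks. -/
def upperAddr : IExp := .add (.mul (.reg 2) (.reg 0)) (.add (.reg 2) (.reg 1))

/-- The address of the right one of two consecutive diagonal blocks. -/
def rightAddr : IExp := .add (.mul (.add (.reg 2) (.reg 1)) (.reg 0)) (.add (.reg 2) (.reg 1))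

/-- Replace the block above two consecutive diagonal blocks by the product of the three blocks. -/
def mergeBlocks (P : Cmd) : Cmd :=
  block [loadBlock 20 leftAddr, loadBlock 21 upperAddr, multiplyBlocks P, reuseBlock,
    loadBlock 21 rightAddr, multiplyBlocks P, storeBlock upperAddr]

theorem writes_mergeBlocks (P : Cmd) {l : Loc} (hl : l.index < 20) (h0 : l ≠ .rarr 0)
    (h3 : ∀ x, 3 ≤ x → x ≤ 8 → l ≠ .ireg x) : (mergeBlocks P).writes l = false := by
  have h := writes_multiplyBlocks P hl
  have h3' : l ≠ .ireg 3 := h3 3 (by omega) (by omega)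
  have h4' : l ≠ .ireg 4 := h3 4 (by omega) (by omega)
  have h5' : l ≠ .ireg 5 := h3 5 (by omega) (by omega)
  have h6' : l ≠ .ireg 6 := h3 6 (by omega) (by omega)
  have h7' : l ≠ .ireg 7 := h3 7 (by omega) (by omega)
  have h8' : l ≠ .ireg 8 := h3 8 (by omega) (by omega)
  have h9 : l ≠ .rarr 20 := by rintro rfl; simp [Loc.index] at hl
  have h10 : l ≠ .rarr 21 := by rintro rfl; simp [Loc.index] at hl
  simp [mergeBlocks, loadBlock, reuseBlock, storeBlock, copyBlock, Cmd.writes, h, h0, h3', h4',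
    h5', h6', h7', h8', h9, h10]

/-- The cost consists of two products and five copies of blocks; the copies are absorbed by `s ^ τ`
because `τ ≥ 2`. The block above the diagonal is overwritten only after both products have been
formed. -/
theorem runs_mergeBlocks {P : Cmd} {c C W N s a : ℕ} {τ : ℝ} (hP : Multiplies P c C τ)
    (hτ : 2 ≤ τ) {σ : Mem} (h0 : σ.ireg 0 = N) (h1 : σ.ireg 1 = s) (h2 : σ.ireg 2 = a)
    (hs1 : 1 ≤ s) (ha : a + s + s ≤ N) (hW : (N + 2) ^ 2 ≤ W) (hWc : (s + 2) ^ c ≤ W) :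
    Runs W (mergeBlocks P) σ fun ρ t =>
      (∀ i < s, ∀ j < s, ρ.rarr 0 (a * N + (a + s) + i * N + j) =
        ∑ l ∈ Finset.range s, (∑ k ∈ Finset.range s, σ.rarr 0 (a * N + a + i * N + k) *
          σ.rarr 0 (a * N + (a + s) + k * N + l)) *
          σ.rarr 0 ((a + s) * N + (a + s) + l * N + j)) ∧
      (∀ x, (∀ i < s, ∀ j < s, x ≠ a * N + (a + s) + i * N + j) → ρ.rarr 0 x = σ.rarr 0 x) ∧
      (t : ℝ) ≤ (2 * C + 700) * (s : ℝ) ^ τ := by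
  have hN : (a + s + s) * N ≤ N * N := Nat.mul_le_mul_right N ha
  have hN' : s * s ≤ N * N := Nat.mul_le_mul (by omega) (by omega)
  have hWN : N * N + N + N < W := by nlinarith
  have e1 : (a + s + s) * N = a * N + s * N + s * N := by ring
  have e2 : (a + s) * N = a * N + s * N := by ring
  simp only [mergeBlocks, block_cons_cons, block_single, runs_seq]
  refine (runs_loadBlock (b := a * N + a) (by omega) h0 h1 hs1
    (by simp [leftAddr, h0, h2]; omega) (by simp [leftAddr, h0, h2])
    (by omega) (by omega)).imp fun σ1 t1 hF1 ⟨hA, ht1⟩ => ?_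
  have h0' : σ1.ireg 0 = N := (hF1.ireg 0 rfl).trans h0
  have h1' : σ1.ireg 1 = s := (hF1.ireg 1 rfl).trans h1
  have h2' : σ1.ireg 2 = a := (hF1.ireg 2 rfl).trans h2
  have hX1 : σ1.rarr 0 = σ.rarr 0 := hF1.rarr 0 rfl
  refine (runs_loadBlock (b := a * N + (a + s)) (by omega) h0' h1' hs1
    (by simp [upperAddr, h0', h2', h1']; omega) (by simp [upperAddr, h0', h2', h1'])
    (by omega) (by omega)).imp fun σ2 t2 hF2 ⟨hB, ht2⟩ => ?_
  have h0' : σ2.ireg 0 = N := (hF2.ireg 0 rfl).trans h0'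
  have h1' : σ2.ireg 1 = s := (hF2.ireg 1 rfl).trans h1'
  have h2' : σ2.ireg 2 = a := (hF2.ireg 2 rfl).trans h2'
  have hX2 : σ2.rarr 0 = σ.rarr 0 := (hF2.rarr 0 rfl).trans hX1
  have hA2 : σ2.rarr 20 = σ1.rarr 20 := hF2.rarr 20 rfl
  refine (runs_multiplyBlocks hP h1' hs1 hWc).imp fun σ3 t3 hF3 ⟨hAB, ht3⟩ => ?_
  have hw : ∀ l : Loc, l.index < 20 → (multiplyBlocks P).writes l = false :=
    fun l hl => writes_multiplyBlocks P hl
  have h0' : σ3.ireg 0 = N := (hF3.ireg 0 (hw _ (by decide))).trans h0'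
  have h1' : σ3.ireg 1 = s := (hF3.ireg 1 (hw _ (by decide))).trans h1'
  have h2' : σ3.ireg 2 = a := (hF3.ireg 2 (hw _ (by decide))).trans h2'
  have hX3 : σ3.rarr 0 = σ.rarr 0 := (hF3.rarr 0 (hw _ (by decide))).trans hX2
  refine (runs_reuseBlock h1' hs1 (by omega)).imp fun σ4 t4 hF4 ⟨hA4, ht4⟩ => ?_
  have h0' : σ4.ireg 0 = N := (hF4.ireg 0 rfl).trans h0'
  have h1' : σ4.ireg 1 = s := (hF4.ireg 1 rfl).trans h1'
  have h2' : σ4.ireg 2 = a := (hF4.ireg 2 rfl).trans h2'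
  have hX4 : σ4.rarr 0 = σ.rarr 0 := (hF4.rarr 0 rfl).trans hX3
  refine (runs_loadBlock (b := (a + s) * N + (a + s)) (by omega) h0' h1' hs1
    (by simp [rightAddr, h0', h2', h1']; omega) (by simp [rightAddr, h0', h2', h1'])
    (by omega) (by omega)).imp fun σ5 t5 hF5 ⟨hB5, ht5⟩ => ?_
  have h0' : σ5.ireg 0 = N := (hF5.ireg 0 rfl).trans h0'
  have h1' : σ5.ireg 1 = s := (hF5.ireg 1 rfl).trans h1'
  have h2' : σ5.ireg 2 = a := (hF5.ireg 2 rfl).trans h2'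
  have hX5 : σ5.rarr 0 = σ.rarr 0 := (hF5.rarr 0 rfl).trans hX4
  have hA5 : σ5.rarr 20 = σ4.rarr 20 := hF5.rarr 20 rfl
  refine (runs_multiplyBlocks hP h1' hs1 hWc).imp fun σ6 t6 hF6 ⟨hABD, ht6⟩ => ?_
  have h0' : σ6.ireg 0 = N := (hF6.ireg 0 (hw _ (by decide))).trans h0'
  have h1' : σ6.ireg 1 = s := (hF6.ireg 1 (hw _ (by decide))).trans h1'
  have h2' : σ6.ireg 2 = a := (hF6.ireg 2 (hw _ (by decide))).trans h2'
  have hX6 : σ6.rarr 0 = σ.rarr 0 := (hF6.rarr 0 (hw _ (by decide))).trans hX5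
  refine (runs_storeBlock (b := a * N + (a + s)) h0' h1' hs1 (by omega)
    (by simp [upperAddr, h0', h2', h1']; omega) (by simp [upperAddr, h0', h2', h1'])
    (by omega) (by omega)).imp fun σ7 t7 hF7 ⟨hX, hX7, ht7⟩ => ?_
  refine ⟨fun i hi j hj => ?_, fun x hx => ?_, ?_⟩
  · rw [hX i hi j hj, hABD i hi j hj]
    refine Finset.sum_congr rfl fun l hl => ?_
    have hl := Finset.mem_range.1 hl
    rw [hA5, hA4 i hi l hl, hAB i hi l hl, hB5 l hl j hj, hX4]
    congr 1
    refine Finset.sum_congr rfl fun k hk => ?_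
    have hk := Finset.mem_range.1 hk
    rw [hA2, hA i hi k hk, hB k hk l hl, hX1]
  · rw [hX7 x hx, hX6]
  · have hs' : (1 : ℝ) ≤ s := by exact_mod_cast hs1
    have hsq : (s : ℝ) ^ 2 ≤ (s : ℝ) ^ τ := by
      rw [← Real.rpow_two]; exact Real.rpow_le_rpow_of_exponent_le hs' hτ
    have hsq1 : (1 : ℝ) ≤ (s : ℝ) ^ 2 := by nlinarith
    simp [leftAddr, upperAddr, rightAddr] at ht1 ht2 ht5 ht7
    have ht1' : (t1 : ℝ) ≤ 100 * (s : ℝ) ^ 2 + 5 + 10 := by exact_mod_cast ht1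
    have ht2' : (t2 : ℝ) ≤ 100 * (s : ℝ) ^ 2 + 7 + 10 := by exact_mod_cast ht2
    have ht4' : (t4 : ℝ) ≤ 100 * (s : ℝ) ^ 2 + 10 := by exact_mod_cast ht4
    have ht5' : (t5 : ℝ) ≤ 100 * (s : ℝ) ^ 2 + 9 + 10 := by exact_mod_cast ht5
    have ht7' : (t7 : ℝ) ≤ 100 * (s : ℝ) ^ 2 + 7 + 10 := by exact_mod_cast ht7
    push_cast
    linarith

end RealRAM

namespace RealRAM

open Relation

/-! ### Transitive closure by products of blocks: the combinatorics. -/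

section Crossing

variable {E : ℕ → ℕ → Prop}

theorem le_of_reflTransGen (hE : ∀ p r, E p r → p < r) {i j : ℕ} (h : ReflTransGen E i j) :
    i ≤ j := by
  induction h with
  | refl => exact le_rfl
  | tail _ h ih => exact ih.trans (hE _ _ h).le

/-- A path which starts before `m` and ends not before `m` has an edge with this property. -/
theorem exists_crossing (hE : ∀ p r, E p r → p < r) {i j m : ℕ} (h : ReflTransGen E i j)
    (hi : i < m) (hj : m ≤ j) :
    ∃ k l, ReflTransGen E i k ∧ E k l ∧ ReflTransGen E l j ∧ i ≤ k ∧ k < m ∧ m ≤ l ∧ l ≤ j := by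
  induction h with
  | refl => omega
  | @tail x y hx hxy ih =>
    by_cases hm : m ≤ x
    · obtain ⟨k, l, h1, h2, h3, h4, h5, h6, h7⟩ := ih hm
      exact ⟨k, l, h1, h2, h3.tail hxy, h4, h5, h6, h7.trans (hE _ _ hxy).le⟩
    · exact ⟨x, y, hx, hxy, .refl, le_of_reflTransGen hE hx, by omega, hj, le_rfl⟩

/-- The relation which is computed while diagonal blocks of `s` rows are merged, after `q` pairs. -/
def Merged (E : ℕ → ℕ → Prop) (s q i j : ℕ) : Prop :=
  E i j ∨ ReflTransGen E i j ∧ (i / s = j / s ∨ i / (s + s) = j / (s + s) ∧ i / (s + s) < q)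

/-- The matrix is nonnegative and represents a relation. -/
def Represents (X : ℕ → ℝ) (N : ℕ) (R : ℕ → ℕ → Prop) : Prop :=
  ∀ i < N, ∀ j < N, 0 ≤ X (i * N + j) ∧ (0 < X (i * N + j) ↔ R i j)

theorem Represents.congr {X : ℕ → ℝ} {N : ℕ} {R R' : ℕ → ℕ → Prop} (h : Represents X N R)
    (hR : ∀ i < N, ∀ j < N, R i j ↔ R' i j) : Represents X N R' :=
  fun i hi j hj => ⟨(h i hi j hj).1, (h i hi j hj).2.trans (hR i hi j hj)⟩

/-- For nonnegative reals, positivity turns sums into disjunctions and products into conjunctions.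
Entries need not be `0` or `1`, so no normalization is required between products. -/
theorem sum_pos_iff {s : ℕ} {f : ℕ → ℝ} (h : ∀ k < s, 0 ≤ f k) :
    0 < ∑ k ∈ Finset.range s, f k ↔ ∃ k < s, 0 < f k := by
  rw [Finset.sum_pos_iff_of_nonneg fun k hk => h k (Finset.mem_range.1 hk)]
  simp

theorem mul_pos_iff_of_nonneg {x y : ℝ} (hx : 0 ≤ x) (hy : 0 ≤ y) : 0 < x * y ↔ 0 < x ∧ 0 < y := by
  constructor
  · intro h
    exact ⟨pos_of_mul_pos_left h hy, pos_of_mul_pos_right h hx⟩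
  · exact fun h => mul_pos h.1 h.2

theorem div_eq_iff_exists {i s q : ℕ} (hs : 1 ≤ s) : i / s = q ↔ ∃ k < s, i = q * s + k := by
  constructor
  · rintro rfl
    exact ⟨i % s, Nat.mod_lt _ hs, by rw [mul_comm]; exact (Nat.div_add_mod i s).symm⟩
  · rintro ⟨k, hk, rfl⟩
    rw [mul_comm, Nat.mul_add_div hs, Nat.div_eq_of_lt hk, add_zero]

/-- In the pair of blocks with index `q`, the two diagonal blocks hold their closures and the upper
block holds only edges. As `E` increases, a path from the left half to the right half crosses the
border by exactly one edge, so it is counted by the triple product. -/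
theorem Merged.step (hE : ∀ p r, E p r → p < r) {X Y : ℕ → ℝ} {N s q : ℕ} (hs : 1 ≤ s)
    (hq : q * (s + s) + s + s ≤ N) (hX : Represents X N (Merged E s q))
    (hY : ∀ i < s, ∀ j < s, Y ((q * (s + s)) * N + (q * (s + s) + s) + i * N + j) =
        ∑ l ∈ Finset.range s, (∑ k ∈ Finset.range s,
          X ((q * (s + s)) * N + q * (s + s) + i * N + k) *
          X ((q * (s + s)) * N + (q * (s + s) + s) + k * N + l)) *
          X ((q * (s + s) + s) * N + (q * (s + s) + s) + l * N + j))
    (hY' : ∀ x, (∀ i < s, ∀ j < s, x ≠ (q * (s + s)) * N + (q * (s + s) + s) + i * N + j) →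
      Y x = X x) :
    Represents Y N (Merged E s (q + 1)) := by
  set a := q * (s + s) with ha
  have hdiv : ∀ k < s, (a + k) / s = 2 * q := fun k hk =>
    (div_eq_iff_exists hs).2 ⟨k, hk, by rw [ha]; ring⟩
  have hdiv' : ∀ k < s, (a + s + k) / s = 2 * q + 1 := fun k hk =>
    (div_eq_iff_exists hs).2 ⟨k, hk, by rw [ha]; ring⟩
  have hdd : ∀ k < s + s, (a + k) / (s + s) = q := fun k hk =>
    (div_eq_iff_exists (by omega)).2 ⟨k, hk, by rw [ha]⟩
  intro i hi j hj
  by_cases hij : ∃ i' < s, ∃ j' < s, i = a + i' ∧ j = a + s + j'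
  · obtain ⟨i', hi', j', hj', rfl, rfl⟩ := hij
    have hA : ∀ k < s, 0 ≤ X (a * N + a + i' * N + k) ∧
        (0 < X (a * N + a + i' * N + k) ↔ ReflTransGen E (a + i') (a + k)) := by
      intro k hk
      have := hX (a + i') hi (a + k) (by omega)
      rw [show (a + i') * N + (a + k) = a * N + a + i' * N + k by ring] at this
      refine ⟨this.1, this.2.trans ⟨?_, fun h => .inr ⟨h, .inl (by rw [hdiv _ hi', hdiv _ hk])⟩⟩⟩
      rintro (h | h)
      exacts [.single h, h.1]
    -- Between the two halves of the pair `q` nothing but the edges has been entered before.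
    have hB : ∀ k < s, ∀ l < s, 0 ≤ X (a * N + (a + s) + k * N + l) ∧
        (0 < X (a * N + (a + s) + k * N + l) ↔ E (a + k) (a + s + l)) := by
      intro k hk l hl
      have := hX (a + k) (by omega) (a + s + l) (by omega)
      rw [show (a + k) * N + (a + s + l) = a * N + (a + s) + k * N + l by ring] at this
      refine ⟨this.1, this.2.trans ⟨?_, .inl⟩⟩
      rintro (h | ⟨_, h | h⟩)
      · exact h
      · rw [hdiv _ hk, hdiv' _ hl] at h; omega
      · have := hdd k (by omega)
        omega
    have hD : ∀ l < s, 0 ≤ X ((a + s) * N + (a + s) + l * N + j') ∧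
        (0 < X ((a + s) * N + (a + s) + l * N + j') ↔ ReflTransGen E (a + s + l) (a + s + j')) := by
      intro l hl
      have := hX (a + s + l) (by omega) (a + s + j') (by omega)
      rw [show (a + s + l) * N + (a + s + j') = (a + s) * N + (a + s) + l * N + j' by ring] at this
      refine ⟨this.1, this.2.trans ⟨?_, fun h => .inr ⟨h, .inl (by rw [hdiv' _ hl, hdiv' _ hj'])⟩⟩⟩
      rintro (h | h)
      exacts [.single h, h.1]
    have hAB : ∀ l < s, 0 ≤ ∑ k ∈ Finset.range s, X (a * N + a + i' * N + k) *
        X (a * N + (a + s) + k * N + l) := fun l hl => Finset.sum_nonneg fun k hk =>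
      mul_nonneg (hA k (Finset.mem_range.1 hk)).1 (hB k (Finset.mem_range.1 hk) l hl).1
    rw [show (a + i') * N + (a + s + j') = a * N + (a + s) + i' * N + j' by ring, hY i' hi' j' hj']
    have hABD : ∀ l < s, 0 ≤ (∑ k ∈ Finset.range s, X (a * N + a + i' * N + k) *
        X (a * N + (a + s) + k * N + l)) * X ((a + s) * N + (a + s) + l * N + j') :=
      fun l hl => mul_nonneg (hAB l hl) (hD l hl).1
    refine ⟨Finset.sum_nonneg fun l hl => hABD l (Finset.mem_range.1 hl), ?_⟩
    rw [sum_pos_iff hABD]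
    constructor
    · rintro ⟨l, hl, h⟩
      rw [mul_pos_iff_of_nonneg (hAB l hl) (hD l hl).1, sum_pos_iff fun k hk =>
        mul_nonneg (hA k hk).1 (hB k hk l hl).1] at h
      obtain ⟨⟨k, hk, h⟩, h'⟩ := h
      rw [mul_pos_iff_of_nonneg (hA k hk).1 (hB k hk l hl).1] at h
      refine .inr ⟨(((hA k hk).2.1 h.1).tail ((hB k hk l hl).2.1 h.2)).trans ((hD l hl).2.1 h'),
        .inr ?_⟩
      rw [hdd _ (by omega), show a + s + j' = a + (s + j') by ring, hdd _ (by omega)]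
      omega
    · intro h
      have h : ReflTransGen E (a + i') (a + s + j') := by
        rcases h with h | h
        exacts [.single h, h.1]
      -- Paths only ascend; so both ends of the crossing edge lie between `a + i'` and `a + s + j'`,
      -- that is, within the pair of blocks.
      obtain ⟨k, l, h1, h2, h3, h4, h5, h6, h7⟩ :=
        exists_crossing hE h (m := a + s) (by omega) (by omega)
      obtain ⟨k, rfl⟩ := Nat.exists_eq_add_of_le (show a ≤ k by omega)
      obtain ⟨l, rfl⟩ := Nat.exists_eq_add_of_le h6
      have hk : k < s := by omega
      have hl : l < s := by omega
      refine ⟨l, hl, mul_pos ((sum_pos_iff fun k hk =>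
        mul_nonneg (hA k hk).1 (hB k hk l hl).1).2 ⟨k, hk, mul_pos ?_ ?_⟩) ?_⟩
      exacts [(hA k hk).2.2 h1, (hB k hk l hl).2.2 h2, (hD l hl).2.2 h3]
  · rw [hY']
    · refine ⟨(hX i hi j hj).1, (hX i hi j hj).2.trans ?_⟩
      simp only [Merged]
      constructor
      · rintro (h | ⟨h, h' | h'⟩)
        exacts [.inl h, .inr ⟨h, .inl h'⟩, .inr ⟨h, .inr ⟨h'.1, by omega⟩⟩]
      · rintro (h | ⟨h, h' | h'⟩)
        · exact .inl h
        · exact .inr ⟨h, .inl h'⟩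
        · refine .inr ⟨h, ?_⟩
          by_cases h3 : i / (s + s) < q
          · exact .inr ⟨h'.1, h3⟩
          -- Both indices belong to the pair `q`, but not to its upper block; as `i ≤ j`, they lie
          -- in the same half, whose closure is already there.
          left
          have h4 : i / (s + s) = q := by omega
          have h5 : j / (s + s) = q := by omega
          obtain ⟨i', hi', hi2⟩ := (div_eq_iff_exists (by omega)).1 h4
          obtain ⟨j', hj', hj2⟩ := (div_eq_iff_exists (by omega)).1 h5
          rw [← ha] at hi2 hj2
          have := le_of_reflTransGen hE h
          by_cases h6 : i' < s
          · by_cases h7 : j' < s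
            · rw [hi2, hj2, hdiv _ h6, hdiv _ h7]
            · exact absurd ⟨i', h6, j' - s, by omega, hi2, by omega⟩ hij
          · rw [hi2, hj2, show a + i' = a + s + (i' - s) by omega,
              show a + j' = a + s + (j' - s) by omega, hdiv' _ (by omega), hdiv' _ (by omega)]
    · intro i' hi' j' hj' h
      rw [show a * N + (a + s) + i' * N + j' = (a + i') * N + (a + s + j') by ring,
        mul_add_inj hj (by omega)] at h
      exact hij ⟨i', hi', j', hj', h.1, h.2⟩

end Crossing

end RealRAM

/-! ### All levels of merging and their total cost. -/

namespace RealRAM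

open Relation

/-- Merge all pairs of consecutive diagonal blocks of the size in register `1`. -/
def mergeLevel (P : Cmd) : Cmd :=
  block [
    .iset 2 (.const 0),
    .while (.ilt (.reg 2) (.reg 0)) (block [
      mergeBlocks P,
      .iset 2 (.add (.reg 2) (.add (.reg 1) (.reg 1)))])]

/-- Compute the transitive closure of an acyclic relation on the rows of a matrix, whose number is
a power of two. -/
def closure (P : Cmd) : Cmd :=
  block [
    .iset 1 (.const 1),
    .while (.ilt (.reg 1) (.reg 0)) (block [
      mergeLevel P,
      .iset 1 (.add (.reg 1) (.reg 1))])]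

variable {E : ℕ → ℕ → Prop} {P : Cmd} {c C W : ℕ} {τ : ℝ} {σ : Mem}

theorem runs_mergeLevel (hP : Multiplies P c C τ) (hτ : 2 ≤ τ) (hE : ∀ p r, E p r → p < r)
    {N s M : ℕ} (h0 : σ.ireg 0 = N) (h1 : σ.ireg 1 = s) (hs : 1 ≤ s) (hN : N = M * (s + s))
    (hW : (N + 2) ^ 2 ≤ W) (hWc : (N + 2) ^ c ≤ W) (hX : Represents (σ.rarr 0) N (Merged E s 0)) :
    Runs W (mergeLevel P) σ fun ρ t => Represents (ρ.rarr 0) N (Merged E s M) ∧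
      (t : ℝ) ≤ M * ((2 * C + 720) * (s : ℝ) ^ τ) + 6 := by
  have hpow : (1 : ℝ) ≤ (s : ℝ) ^ τ := Real.one_le_rpow (by exact_mod_cast hs) (by linarith)
  have hC : (0 : ℝ) ≤ C := Nat.cast_nonneg _
  have hκ : 0 ≤ (2 * C + 720) * (s : ℝ) ^ τ := by positivity
  have hwr : ∀ l : Loc, l.index < 3 → l ≠ .rarr 0 → (mergeBlocks P).writes l = false :=
    fun l hl h => writes_mergeBlocks P (by omega) h fun x hx _ => by
      rintro rfl; simp [Loc.index] at hl; omega
  simp only [mergeLevel, block_cons_cons, block_single, runs_seq]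
  simp
  refine runs_while (fun ρ t => ∃ q, ρ.ireg 2 = q * (s + s) ∧ q ≤ M ∧
    Represents (ρ.rarr 0) N (Merged E s q) ∧ (t : ℝ) ≤ q * ((2 * C + 720) * (s : ℝ) ^ τ))
    ⌊M * ((2 * C + 720) * (s : ℝ) ^ τ)⌋₊ ⟨0, by simp, by omega, hX, by simp⟩ ?_ ?_
  · rintro ρ t ⟨q, -, hq, -, ht⟩
    refine Nat.le_floor (ht.trans (mul_le_mul_of_nonneg_right ?_ hκ))
    exact_mod_cast hq
  · rintro ρ t hF ⟨q, h2, hq, hXq, ht⟩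
    have h0' : ρ.ireg 0 = N := by
      refine (hF.ireg 0 ?_).trans (by simpa using h0)
      simp [Cmd.writes, hwr (.ireg 0) (by decide) (by simp)]
    have h1' : ρ.ireg 1 = s := by
      refine (hF.ireg 1 ?_).trans (by simpa using h1)
      simp [Cmd.writes, hwr (.ireg 1) (by decide) (by simp)]
    have hqM : q * (s + s) < N ↔ q < M := by
      rw [hN]; exact Nat.mul_lt_mul_right (by omega)
    simp only [BExp.Fits, IExp.Fits, BExp.Holds, IExp.eval, h0', h2, hqM, true_and]
    refine ⟨fun hq' => ?_, fun hq' => ?_⟩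
    · rw [runs_seq]
      have hle : (q + 1) * (s + s) ≤ N := by
        rw [hN]; exact Nat.mul_le_mul_right _ hq'
      have hle' : q * (s + s) + s + s ≤ N := by
        linarith
      have : (s + 2) ^ c ≤ W := (Nat.pow_le_pow_left (by omega) c).trans hWc
      refine (runs_mergeBlocks hP hτ h0' h1' h2 hs hle' hW this).imp fun μ r hF' ⟨hY, hY', hr⟩ => ?_
      have h1'' : μ.ireg 1 = s := (hF'.ireg 1 (hwr _ (by decide) (by simp))).trans h1'
      have h2'' : μ.ireg 2 = q * (s + s) := (hF'.ireg 2 (hwr _ (by decide) (by simp))).trans h2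
      have hNW : N + 2 ≤ W := (Nat.le_self_pow (by omega) _).trans hW
      have hXq' := Merged.step hE hs hle' hXq hY hY'
      simp [h1'', h2'']
      refine ⟨⟨by omega, by omega⟩, q + 1, by ring, hq', hXq', ?_⟩
      push_cast
      linarith
    · have : q = M := by omega
      subst this
      refine ⟨hXq, ?_⟩
      push_cast
      simp
      linarith

/-- Up to lower-order terms, a level with blocks of size `s` costs at most a multiple of `(N / s) *
s ^ τ`, and these costs form a geometric series. The invariant bounds the time by a multiple of `N *
s ^ (τ - 1)`, multiplied by `s` so that only the exponent `τ` occurs. Doubling `s` multiplies the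
right-hand side by at least `4`, while the old time contributes two parts and the new level one. -/
theorem runs_closure (hP : Multiplies P c C τ) (hτ : 2 ≤ τ) (hE : ∀ p r, E p r → p < r)
    {N k : ℕ} (h0 : σ.ireg 0 = N) (hN : N = 2 ^ k)
    (hW : (N + 2) ^ 2 ≤ W) (hWc : (N + 2) ^ c ≤ W)
    (hX : Represents (σ.rarr 0) N fun i j => i = j ∨ E i j) :
    Runs W (closure P) σ fun ρ t => Represents (ρ.rarr 0) N (ReflTransGen E) ∧
      (t : ℝ) ≤ (2 * C + 740) * (N : ℝ) ^ τ := by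
  have hN1 : 1 ≤ N := hN ▸ Nat.one_le_two_pow
  have hC : (0 : ℝ) ≤ C := Nat.cast_nonneg _
  have hwr : ∀ l : Loc, l.index < 2 → l ≠ .rarr 0 → (mergeLevel P).writes l = false := by
    intro l hl h
    have h1 := writes_mergeBlocks P (by omega) h fun x hx _ => by
      rintro rfl; simp [Loc.index] at hl; omega
    have h2 : l ≠ .ireg 2 := by rintro rfl; simp [Loc.index] at hl
    simp [mergeLevel, Cmd.writes, h1, h2]
  simp only [closure, block_cons_cons, block_single, runs_seq]
  simp
  have hN0 : (0 : ℝ) < N := by exact_mod_cast hN1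
  have hpowN : (1 : ℝ) ≤ (N : ℝ) ^ τ := Real.one_le_rpow (by exact_mod_cast hN1) (by linarith)
  have hκN : 0 ≤ (2 * C + 720) * (N : ℝ) * (N : ℝ) ^ τ := by positivity
  refine runs_while (fun ρ t => ∃ l, l ≤ k ∧ ρ.ireg 1 = 2 ^ l ∧
    Represents (ρ.rarr 0) N (Merged E (2 ^ l) 0) ∧
    (t : ℝ) * (2 ^ l : ℕ) ≤ (2 * C + 720) * N * ((2 ^ l : ℕ) : ℝ) ^ τ)
    ⌊(2 * C + 720) * N * (N : ℝ) ^ τ⌋₊ ⟨0, by omega, by simp, ?_, by simp; positivity⟩ ?_ ?_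
  · simp
    refine hX.congr fun i hi j hj => ?_
    simp only [Merged, Nat.div_one]
    constructor
    · rintro (rfl | h)
      exacts [.inr ⟨.refl, .inl rfl⟩, .inl h]
    · rintro (h | ⟨_, h | h⟩)
      exacts [.inr h, .inl h, absurd h.2 (by omega)]
  · rintro ρ t ⟨l, hl, -, -, ht⟩
    have h1 : ((1 : ℕ) : ℝ) ≤ (2 ^ l : ℕ) := Nat.cast_le.2 Nat.one_le_two_pow
    have h2 : ((2 ^ l : ℕ) : ℝ) ≤ N := by
      rw [hN]; exact Nat.cast_le.2 (Nat.pow_le_pow_right (by omega) hl)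
    have h3 : ((2 ^ l : ℕ) : ℝ) ^ τ ≤ (N : ℝ) ^ τ :=
      Real.rpow_le_rpow (by positivity) h2 (by linarith)
    refine Nat.le_floor ?_
    calc (t : ℝ) ≤ t * (2 ^ l : ℕ) := le_mul_of_one_le_right (Nat.cast_nonneg _) (by simpa using h1)
      _ ≤ _ := ht
      _ ≤ _ := mul_le_mul_of_nonneg_left h3 (by positivity)
  · rintro ρ t hF ⟨l, hl, h1, hXl, ht⟩
    have h0' : ρ.ireg 0 = N := by
      refine (hF.ireg 0 ?_).trans (by simpa using h0)
      simp [Cmd.writes, hwr (.ireg 0) (by decide) (by simp)]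
    have hlk : 2 ^ l < N ↔ l < k := by
      rw [hN]; exact Nat.pow_lt_pow_iff_right (by omega)
    simp only [BExp.Fits, IExp.Fits, BExp.Holds, IExp.eval, h0', h1, hlk, true_and]
    have hs : 1 ≤ 2 ^ l := Nat.one_le_two_pow
    set s := 2 ^ l with hsdef
    have hsr : (1 : ℝ) ≤ s := by exact_mod_cast hs
    have hpow : (1 : ℝ) ≤ (s : ℝ) ^ τ := Real.one_le_rpow hsr (by linarith)
    refine ⟨fun hlk' => ?_, fun hlk' => ?_⟩
    · obtain ⟨d, rfl⟩ : ∃ d, k = l + 1 + d := ⟨k - (l + 1), by omega⟩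
      have hNM : N = 2 ^ d * (s + s) := by rw [hN, hsdef]; ring
      rw [runs_seq]
      refine (runs_mergeLevel hP hτ hE h0' h1 hs hNM hW hWc hXl).imp fun μ r hF' ⟨hY, hr⟩ => ?_
      have h1' : μ.ireg 1 = s := (hF'.ireg 1 (hwr _ (by decide) (by simp))).trans h1
      have hNW : N + 2 ≤ W := (Nat.le_self_pow (by omega) _).trans hW
      have hssN : s + s ≤ N := by
        rw [hNM]; exact Nat.le_mul_of_pos_left _ (by positivity)
      have hss : 2 ^ (l + 1) = s + s := by rw [hsdef]; ring
      simp [h1']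
      refine ⟨by omega, l + 1, hlk', hss.symm, ?_, ?_⟩
      · refine hY.congr fun i hi j hj => ?_
        rw [hss]
        simp only [Merged]
        have hi' : i / (s + s) < 2 ^ d := by
          rw [Nat.div_lt_iff_lt_mul (by omega), ← hNM]; exact hi
        constructor
        · rintro (h | ⟨h, h' | h'⟩)
          · exact .inl h
          · refine .inr ⟨h, .inl ?_⟩
            rw [show s + s = s * 2 by ring, ← Nat.div_div_eq_div_mul, h', Nat.div_div_eq_div_mul]
          · exact .inr ⟨h, .inl h'.1⟩
        · rintro (h | ⟨h, h' | h'⟩)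
          exacts [.inl h, .inr ⟨h, .inr ⟨h', hi'⟩⟩, absurd h'.2 (Nat.not_lt_zero _)]
      · have e1 : (2 : ℝ) ^ (l + 1) = s * 2 := by rw [hsdef]; push_cast; ring
        have e2 : (4 : ℝ) * (s : ℝ) ^ τ ≤ ((s : ℝ) * 2) ^ τ := by
          rw [Real.mul_rpow (by positivity) (by positivity), mul_comm]
          refine mul_le_mul_of_nonneg_left ?_ (by positivity)
          calc (4 : ℝ) = 2 ^ (2 : ℝ) := by norm_num
            _ ≤ _ := Real.rpow_le_rpow_of_exponent_le (by norm_num) hτ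
        have e3 : (N : ℝ) = 2 ^ d * (s + s) := by exact_mod_cast hNM
        rw [e1]
        set κ : ℝ := 2 * C + 720 with hκ
        have hκ0 : 720 ≤ κ := by linarith
        have e4 : κ * N * (4 * (s : ℝ) ^ τ) ≤ κ * N * ((s : ℝ) * 2) ^ τ :=
          mul_le_mul_of_nonneg_left e2 (by positivity)
        refine le_trans ?_ e4
        have e5 : (r : ℝ) * (s * 2) ≤ κ * N * (s : ℝ) ^ τ + 12 * s := by
          calc (r : ℝ) * (s * 2) ≤ (2 ^ d * (κ * (s : ℝ) ^ τ) + 6) * (s * 2) :=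
                mul_le_mul_of_nonneg_right (by simpa using hr) (by positivity)
            _ = _ := by rw [e3]; ring
        have e6 : (s : ℝ) ≤ N := by
          have : s ≤ N := by omega
          exact_mod_cast this
        -- The fourth part of `κ * N * s ^ τ` is left over and pays for the constant costs of the
        -- level.
        have e7 : (720 : ℝ) * s * 1 ≤ κ * N * (s : ℝ) ^ τ :=
          mul_le_mul (mul_le_mul hκ0 e6 (by positivity) (by positivity)) hpow (by positivity)
            (by positivity)
        nlinarith
    · have : l = k := by omega
      subst this
      rw [← hN] at hsdef
      rw [hsdef] at hXl ht
      refine ⟨hXl.congr fun i hi j hj => ?_, ?_⟩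
      · simp only [Merged, Nat.div_eq_of_lt hi, Nat.div_eq_of_lt hj, true_or, and_true]
        exact ⟨fun h => h.elim .single id, .inr⟩
      · have : (t : ℝ) ≤ (2 * C + 720) * (N : ℝ) ^ τ := by
          refine le_of_mul_le_mul_right (ht.trans (le_of_eq ?_)) hN0
          ring
        push_cast
        simp
        nlinarith

end RealRAM

namespace APSP

open RealRAM Relation

/-! ## The transitive closure of the graph -/

/-- The memory holds, for every number `v < n`, the list of all `p` with `E p v`. -/
structure Tails (E : ℕ → ℕ → Prop) (n m : ℕ) (σ : Mem) : Prop where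
  n_eq : σ.ireg 0 = n
  m_eq : σ.ireg 1 = m
  deg_le : ∀ v < n, σ.iarr 3 (v + 1) ≤ n
  mem_iff : ∀ v < n, ∀ p,
    E p v ↔ ∃ s < σ.iarr 3 (v + 1), σ.iarr 4 (cell n (v + 1) (s + 1)) = p + 1
  tail_pos : ∀ v < n, ∀ s < σ.iarr 3 (v + 1), 1 ≤ σ.iarr 4 (cell n (v + 1) (s + 1))
  sum_deg : ∑ v ∈ Finset.range n, σ.iarr 3 (v + 1) = m

variable {E : ℕ → ℕ → Prop} {n m N W : ℕ} {σ τ : Mem}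

theorem Tails.congr (h : Tails E n m σ) (h0 : τ.ireg 0 = σ.ireg 0) (h1 : τ.ireg 1 = σ.ireg 1)
    (h3 : τ.iarr 3 = σ.iarr 3) (h4 : τ.iarr 4 = σ.iarr 4) : Tails E n m τ := by
  obtain ⟨a, b, c, d, e, f⟩ := h
  exact ⟨h0.trans a, h1.trans b, by rwa [h3], by rwa [h3, h4], by rwa [h3, h4], by rwa [h3]⟩

/-- Compute a power of two that is not less than the number of vertices. -/
def powerOfTwo : Cmd :=
  block [
    .iset 10 (.const 1),
    .while (.ilt (.reg 10) (.reg 0)) (.iset 10 (.add (.reg 10) (.reg 10)))]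

theorem runs_powerOfTwo (hn : σ.ireg 0 = n) (hW : 2 * n + 1 < W) :
    Runs W powerOfTwo σ fun τ t => (∃ k, τ.ireg 10 = 2 ^ k) ∧ n ≤ τ.ireg 10 ∧
      τ.ireg 10 ≤ 2 * n + 1 ∧ t ≤ 20 * (n + 1) := by
  simp only [powerOfTwo, block_cons_cons, block_single, runs_seq]
  simp
  -- The bound is `2 * n + 1` instead of `2 * n` on account of `n = 0`, where the power is `1`.
  refine runs_while (fun τ t => (∃ k, τ.ireg 10 = 2 ^ k) ∧ τ.ireg 10 ≤ 2 * n + 1 ∧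
    t + 8 ≤ 8 * τ.ireg 10) (8 * (2 * n + 1)) ⟨⟨0, by simp⟩, by simp, by simp⟩ (by omega) ?_
  rintro τ t hF ⟨⟨k, hk⟩, h1, h2⟩
  have hn' : τ.ireg 0 = n := (hF.ireg 0 rfl).trans (by simpa using hn)
  simp [hn']
  refine ⟨fun h => ⟨by omega, ⟨k + 1, by rw [hk]; ring⟩, by omega, by omega⟩, fun h =>
    ⟨⟨k, hk⟩, h, h1, by omega⟩⟩

/-- Fill the array `60` with the identity matrix. -/
def clearMatrix : Cmd :=
  block [
    .iset 11 (.const 0),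
    .while (.ilt (.reg 11) (.reg 10)) (block [
      .iset 12 (.const 0),
      .while (.ilt (.reg 12) (.reg 10)) (block [
        .rstore 60 (.add (.mul (.reg 11) (.reg 10)) (.reg 12)) (.const 0),
        incr 12]),
      .rstore 60 (.add (.mul (.reg 11) (.reg 10)) (.reg 11)) (.const 1),
      incr 11])]

theorem matrix_fits (hW : (N + 2) ^ 2 ≤ W) {i j : ℕ} (hi : i < N) (hj : j < N) :
    i * N < W ∧ i * N + j < W ∧ i + 1 < W ∧ j + 1 < W := by
  have := square_fits hW hi hj
  have := square_fits hW hj hj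
  omega

theorem runs_clearMatrix (hW : (N + 2) ^ 2 ≤ W) (hN : σ.ireg 10 = N) :
    Runs W clearMatrix σ fun τ t =>
      (∀ i < N, ∀ j < N, τ.rarr 60 (i * N + j) = if i = j then 1 else 0) ∧
      t ≤ 80 * (N + 1) ^ 2 := by
  simp only [clearMatrix, block_cons_cons, block_single, runs_seq]
  simp
  refine runs_below 11 0 N (fun i τ t =>
    (∀ i' < i, ∀ j < N, τ.rarr 60 (i' * N + j) = if i' = j then 1 else 0) ∧
    t ≤ i * (60 * (N + 1))) (by omega) (by simp) ⟨by omega, by omega⟩ ?_ ?_ ?_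
  · intro i τ t _ _ hF _
    exact ⟨trivial, (hF.ireg 10 rfl).trans (by simpa using hN)⟩
  · rintro i τ t - i2 hF hi ⟨hJ1, hJ2⟩
    have hN' : τ.ireg 10 = N := (hF.ireg 10 rfl).trans (by simpa using hN)
    simp
    refine runs_below 12 0 N (fun j ρ s =>
      (∀ i' < i, ∀ j < N, ρ.rarr 60 (i' * N + j) = if i' = j then 1 else 0) ∧
      (∀ j' < j, ρ.rarr 60 (i * N + j') = 0) ∧ s ≤ j * 30)
      (by omega) (by simp) ⟨hJ1, by omega, by omega⟩ ?_ ?_ ?_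
    · intro i τ t _ _ hF _
      exact ⟨trivial, (hF.ireg 10 rfl).trans (by simpa using hN')⟩
    · rintro j ρ s - j2 hF' hj ⟨hK1, hK2, hK3⟩
      have hN'' : ρ.ireg 10 = N := (hF'.ireg 10 rfl).trans (by simpa using hN')
      have hi' : ρ.ireg 11 = i := (hF'.ireg 11 rfl).trans (by simpa using hi)
      simp [hN'', hi', hj, matrix_fits hW i2 j2]
      refine ⟨fun i' h1 j' h2 => ?_, fun j' h1 => ?_, by omega⟩
      · rw [if_neg, hK1 i' h1 j' h2]
        rw [mul_add_inj h2 j2]; omega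
      · intro h2
        exact hK2 j' (by omega)
    · rintro ρ s hF' hj ⟨hK1, hK2, hK3⟩
      have hN'' : ρ.ireg 10 = N := (hF'.ireg 10 rfl).trans (by simpa using hN')
      have hi' : ρ.ireg 11 = i := (hF'.ireg 11 rfl).trans (by simpa using hi)
      simp [hN'', hi', matrix_fits hW i2 i2]
      refine ⟨fun i' h1 j h2 => ?_, ?_⟩
      · rcases Nat.lt_or_eq_of_le h1 with h | h
        · rw [if_neg, hK1 i' h j h2]
          rw [mul_add_inj h2 i2]; omega
        · subst h
          rw [hK2 j h2]
          exact if_congr (by omega) rfl rfl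
      · have : (i + 1) * (60 * (N + 1)) = i * (60 * (N + 1)) + 60 * (N + 1) := by ring
        omega
  · rintro τ t hF hi ⟨hJ1, hJ2⟩
    refine ⟨hJ1, ?_⟩
    simp; nlinarith

/-- Enter the edges into the matrix. -/
def enterEdges : Cmd :=
  block [
    .iset 11 (.const 0),
    .while (.ilt (.reg 11) (.reg 0)) (block [
      .iset 12 (.const 0),
      .while (.ilt (.reg 12) (.arr 3 (.add (.reg 11) (.const 1)))) (block [
        .rstore 60 (.add (.mul (.sub (.arr 4 (cellE (.add (.reg 11) (.const 1))
          (.add (.reg 12) (.const 1)))) (.const 1)) (.reg 10)) (.reg 11)) (.const 1),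
        incr 12]),
      incr 11])]

theorem runs_enterEdges (hW : (N + 2) ^ 2 ≤ W) (hN : σ.ireg 10 = N) (hn : n ≤ N)
    (hE : ∀ p r, E p r → p < r) (hEn : ∀ p r, E p r → r < n) (hT : Tails E n m σ)
    (hX : ∀ i < N, ∀ j < N, σ.rarr 60 (i * N + j) = if i = j then 1 else 0) :
    Runs W enterEdges σ fun τ t => Represents (τ.rarr 60) N (fun i j => i = j ∨ E i j) ∧
      t ≤ 80 * (n + 1) ^ 2 := by
  have hWn : (n + 2) ^ 2 ≤ W := (Nat.pow_le_pow_left (by omega) 2).trans hW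
  simp only [enterEdges, block_cons_cons, block_single, runs_seq]
  simp
  refine runs_below 11 0 n (fun v τ t =>
    Represents (τ.rarr 60) N (fun i j => i = j ∨ E i j ∧ j < v) ∧
    t ≤ v * (60 * (n + 1))) (by omega) (by simp) ⟨?_, by omega⟩ ?_ ?_ ?_
  · intro i hi j hj
    simp [hX i hi j hj]
    split_ifs <;> simp [*]
  · intro i τ t _ _ hF _
    exact ⟨trivial, (hF.ireg 0 rfl).trans (by simpa using hT.n_eq)⟩
  · rintro v τ t - v2 hF hv ⟨hJ1, hJ2⟩
    have hTτ : Tails E n m τ :=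
      hT.congr (hF.ireg 0 rfl) (hF.ireg 1 rfl) (hF.iarr 3 rfl) (hF.iarr 4 rfl)
    have hN' : τ.ireg 10 = N := (hF.ireg 10 rfl).trans (by simpa using hN)
    have hd := hTτ.deg_le v v2
    have hv1 : v + 1 < W := lt_word hWn (by omega)
    simp
    refine runs_below 12 0 (τ.iarr 3 (v + 1)) (fun k ρ s =>
      Represents (ρ.rarr 60) N (fun i j => i = j ∨ E i j ∧ j < v ∨
        j = v ∧ ∃ s < k, τ.iarr 4 (cell n (v + 1) (s + 1)) = i + 1) ∧ s ≤ k * 50)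
      (by omega) (by simp) ⟨?_, by omega⟩ ?_ ?_ ?_
    · refine hJ1.congr fun i _ j _ => by simp
    · intro k ρ s _ _ hF' _
      have hv' : ρ.ireg 11 = v := (hF'.ireg 11 rfl).trans (by simpa using hv)
      have e3 : ρ.iarr 3 = τ.iarr 3 := hF'.iarr 3 rfl
      simp [hv', e3, hv1]
    · rintro k ρ s - k2 hF' hk ⟨hK1, hK2⟩
      have hv' : ρ.ireg 11 = v := (hF'.ireg 11 rfl).trans (by simpa using hv)
      have hN'' : ρ.ireg 10 = N := (hF'.ireg 10 rfl).trans (by simpa using hN')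
      have hn' : ρ.ireg 0 = n := (hF'.ireg 0 rfl).trans (by simpa using hTτ.n_eq)
      have e4 : ρ.iarr 4 = τ.iarr 4 := hF'.iarr 4 rfl
      obtain ⟨p, hp⟩ := Nat.exists_eq_add_of_le' (hTτ.tail_pos v v2 k k2)
      have hpv : E p v := (hTτ.mem_iff v v2 p).2 ⟨k, k2, hp⟩
      have hpN : p < N := by have := hE p v hpv; omega
      have hvN : v < N := by omega
      simp [hv', hN'', hn', hk, e4, hp, hv1, CellFits.mk hWn (show v + 1 ≤ n by omega)
        (show k + 1 ≤ n + 1 by omega), lt_word hWn (show k + 1 ≤ n + 3 by omega),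
        matrix_fits hW hpN hvN]
      refine ⟨fun i hi j hj => ?_, by omega⟩
      simp only [Mem.setRArr_rarr, mul_add_inj hj hvN, true_and]
      by_cases hij : i = p ∧ j = v
      · obtain ⟨rfl, rfl⟩ := hij
        simp only [and_self, if_true]
        refine ⟨zero_le_one, iff_of_true zero_lt_one (.inr (.inr ⟨trivial, k, le_rfl, hp⟩))⟩
      · rw [if_neg hij]
        refine ⟨(hK1 i hi j hj).1, (hK1 i hi j hj).2.trans ?_⟩
        refine or_congr Iff.rfl (or_congr Iff.rfl (and_congr_right fun hj => ?_))
        constructor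
        · rintro ⟨s, h1, h2⟩; exact ⟨s, by omega, h2⟩
        · rintro ⟨s, h1, h2⟩
          refine ⟨s, ?_, h2⟩
          rcases Nat.lt_or_eq_of_le h1 with h | h
          · exact h
          · subst h; omega
    · rintro ρ s hF' hk ⟨hK1, hK2⟩
      have hv' : ρ.ireg 11 = v := (hF'.ireg 11 rfl).trans (by simpa using hv)
      simp [hv', hv1]
      refine ⟨hK1.congr fun i hi j hj => ?_, ?_⟩
      · refine or_congr Iff.rfl ?_
        constructor
        · rintro (h | ⟨rfl, h⟩)
          · exact ⟨h.1, by omega⟩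
          · exact ⟨(hTτ.mem_iff _ v2 i).2 h, by omega⟩
        · rintro ⟨h, h'⟩
          rcases Nat.lt_or_eq_of_le h' with h' | rfl
          · exact .inl ⟨h, h'⟩
          · exact .inr ⟨rfl, (hTτ.mem_iff _ v2 i).1 h⟩
      · have : (v + 1) * (60 * (n + 1)) = v * (60 * (n + 1)) + 60 * (n + 1) := by ring
        omega
  · rintro τ t hF hv ⟨hJ1, hJ2⟩
    refine ⟨hJ1.congr fun i _ j _ => ?_, by simp; nlinarith⟩
    exact or_congr Iff.rfl ⟨fun h => h.1, fun h => ⟨h, hEn i j h⟩⟩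

end APSP

/-! ### Transitive closure column by column, along the edges. -/

namespace APSP

open RealRAM Relation

variable {E : ℕ → ℕ → Prop} {n m N W : ℕ} {σ τ : Mem}

/-- Clear a column of the matrix, except for the entry on the diagonal. -/
def clearColumn : Cmd :=
  block [
    .iset 13 (.const 0),
    .while (.ilt (.reg 13) (.reg 0)) (block [
      .rstore 60 (.add (.mul (.reg 13) (.reg 10)) (.reg 11)) (.const 0),
      incr 13]),
    .rstore 60 (.add (.mul (.reg 11) (.reg 10)) (.reg 11)) (.const 1)]

/-- Add the column in register `14` to the column in register `11`. -/
def addColumn : Cmd :=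
  block [
    .iset 13 (.const 0),
    .while (.ilt (.reg 13) (.reg 0)) (block [
      .ite (.rlt (.const 0) (.arr 60 (.add (.mul (.reg 13) (.reg 10)) (.reg 14))))
        (.rstore 60 (.add (.mul (.reg 13) (.reg 10)) (.reg 11)) (.const 1))
        .skip,
      incr 13])]

/-- Compute the transitive closure column by column. -/
def propagate : Cmd :=
  block [
    .iset 11 (.const 0),
    .while (.ilt (.reg 11) (.reg 0)) (block [
      clearColumn,
      .iset 12 (.const 0),
      .while (.ilt (.reg 12) (.arr 3 (.add (.reg 11) (.const 1)))) (block [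
        .iset 14 (.sub (.arr 4 (cellE (.add (.reg 11) (.const 1))
          (.add (.reg 12) (.const 1)))) (.const 1)),
        addColumn,
        incr 12]),
      incr 11])]

theorem runs_clearColumn (hW : (N + 2) ^ 2 ≤ W) (hN : σ.ireg 10 = N) (hn : n ≤ N)
    (h0 : σ.ireg 0 = n) {v : ℕ} (h11 : σ.ireg 11 = v) (hv : v < n) :
    Runs W clearColumn σ fun τ t =>
      (∀ p < n, τ.rarr 60 (p * N + v) = if p = v then 1 else 0) ∧
      (∀ p < n, ∀ r < v, τ.rarr 60 (p * N + r) = σ.rarr 60 (p * N + r)) ∧ t ≤ 40 * (n + 1) := by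
  simp only [clearColumn, block_cons_cons, block_single, runs_seq]
  simp
  refine runs_below 13 0 n (fun q τ t =>
    (∀ p < q, τ.rarr 60 (p * N + v) = 0) ∧
    (∀ p < n, ∀ r < v, τ.rarr 60 (p * N + r) = σ.rarr 60 (p * N + r)) ∧ t ≤ q * 30)
    (by omega) (by simp) ⟨by omega, by simp, by omega⟩ ?_ ?_ ?_
  · intro i τ t _ _ hF _
    exact ⟨trivial, (hF.ireg 0 rfl).trans (by simpa using h0)⟩
  · rintro q τ t - q2 hF hq ⟨hJ1, hJ2, hJ3⟩
    have h10' : τ.ireg 10 = N := (hF.ireg 10 rfl).trans (by simpa using hN)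
    have h11' : τ.ireg 11 = v := (hF.ireg 11 rfl).trans (by simpa using h11)
    simp [h10', h11', hq, matrix_fits hW (show q < N by omega) (show v < N by omega)]
    refine ⟨fun p hp h _ => hJ1 p (by omega), fun p hp r hr => ?_, by omega⟩
    rw [if_neg, hJ2 p hp r hr]
    rw [mul_add_inj (by omega) (by omega)]; omega
  · rintro τ t hF hq ⟨hJ1, hJ2, hJ3⟩
    have h10' : τ.ireg 10 = N := (hF.ireg 10 rfl).trans (by simpa using hN)
    have h11' : τ.ireg 11 = v := (hF.ireg 11 rfl).trans (by simpa using h11)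
    simp [h10', h11', matrix_fits hW (show v < N by omega) (show v < N by omega)]
    refine ⟨fun p hp => ?_, fun p hp r hr => ?_, by omega⟩
    · rw [hJ1 p hp]
      exact if_congr (by omega) rfl rfl
    · rw [if_neg, hJ2 p hp r hr]
      rw [mul_add_inj (by omega) (by omega)]; omega

theorem runs_addColumn (hW : (N + 2) ^ 2 ≤ W) (hN : σ.ireg 10 = N) (hn : n ≤ N)
    (h0 : σ.ireg 0 = n) {u v : ℕ} (h11 : σ.ireg 11 = v) (hv : v < n) (h14 : σ.ireg 14 = u)
    (hu : u < v) :
    Runs W addColumn σ fun τ t =>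
      (∀ p < n, 0 < τ.rarr 60 (p * N + v) ↔ 0 < σ.rarr 60 (p * N + v) ∨
        0 < σ.rarr 60 (p * N + u)) ∧
      (∀ p < n, ∀ r < v, τ.rarr 60 (p * N + r) = σ.rarr 60 (p * N + r)) ∧ t ≤ 50 * (n + 1) := by
  simp only [addColumn, block_cons_cons, block_single, runs_seq]
  simp
  refine runs_below 13 0 n (fun q τ t =>
    (∀ p < n, 0 < τ.rarr 60 (p * N + v) ↔ 0 < σ.rarr 60 (p * N + v) ∨
        p < q ∧ 0 < σ.rarr 60 (p * N + u)) ∧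
    (∀ p < n, ∀ r < v, τ.rarr 60 (p * N + r) = σ.rarr 60 (p * N + r)) ∧ t ≤ q * 45)
    (by omega) (by simp) ⟨by simp, by simp, by omega⟩ ?_ ?_ ?_
  · intro i τ t _ _ hF _
    exact ⟨trivial, (hF.ireg 0 rfl).trans (by simpa using h0)⟩
  · rintro q τ t - q2 hF hq ⟨hJ1, hJ2, hJ3⟩
    have h10' : τ.ireg 10 = N := (hF.ireg 10 rfl).trans (by simpa using hN)
    have h11' : τ.ireg 11 = v := (hF.ireg 11 rfl).trans (by simpa using h11)
    have h14' : τ.ireg 14 = u := (hF.ireg 14 rfl).trans (by simpa using h14)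
    have hqu : τ.rarr 60 (q * N + u) = σ.rarr 60 (q * N + u) := hJ2 q q2 u hu
    have f1 := matrix_fits hW (show q < N by omega) (show v < N by omega)
    have f2 := matrix_fits hW (show q < N by omega) (show u < N by omega)
    simp only [runs_seq, runs_ite]
    simp [h10', h11', h14', hq, f1, f2, hqu]
    refine ⟨fun hpos => ⟨fun p hp => ?_, fun p hp r hr => ?_, by omega⟩,
      fun hpos => ⟨fun p hp => ?_, hJ2, by omega⟩⟩
    · by_cases hpq : p = q
      · subst hpq; simp [hpos]
      · rw [if_neg, hJ1 p hp]
        · exact or_congr Iff.rfl (and_congr (by omega) Iff.rfl)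
        · omega
    · rw [if_neg, hJ2 p hp r hr]
      rw [mul_add_inj (by omega) (by omega)]; omega
    · rw [hJ1 p hp]
      refine or_congr Iff.rfl ⟨fun h => ⟨by omega, h.2⟩, fun h => ⟨?_, h.2⟩⟩
      rcases Nat.lt_or_eq_of_le h.1 with h' | h'
      · exact h'
      · subst h'; exact absurd h.2 (not_lt.2 hpos)
  · rintro τ t hF hq ⟨hJ1, hJ2, hJ3⟩
    refine ⟨fun p hp => ?_, hJ2, by simp; omega⟩
    rw [hJ1 p hp]
    simp [hp]

/-- By the last edge of a path, `p` reaches `v` if and only if `p = v` or `p` reaches a direct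
ancestor of `v`, and the columns of these are complete before that of `v`. Each vertex and each edge
costs one pass over `n` rows. Nothing is assumed about the contents of the matrix, because the
limited program may have stopped at any point; therefore every column is cleared first. -/
theorem runs_propagate (hW : (N + 2) ^ 2 ≤ W) (hN : σ.ireg 10 = N) (hn : n ≤ N)
    (hE : ∀ p r, E p r → p < r) (hT : Tails E n m σ) :
    Runs W propagate σ fun τ t =>
      (∀ p < n, ∀ r < n, 0 < τ.rarr 60 (p * N + r) ↔ ReflTransGen E p r) ∧
      t ≤ 200 * (n + 1) * (n + m + 1) := by
  have hWn : (n + 2) ^ 2 ≤ W := (Nat.pow_le_pow_left (by omega) 2).trans hW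
  simp only [propagate, block_cons_cons, block_single, runs_seq]
  simp
  refine runs_below 11 0 n (fun v τ t =>
    (∀ p < n, ∀ r < v, 0 < τ.rarr 60 (p * N + r) ↔ ReflTransGen E p r) ∧
    t ≤ 100 * (n + 1) * (∑ v' ∈ Finset.range v, σ.iarr 3 (v' + 1) + v))
    (by omega) (by simp) ⟨by omega, by omega⟩ ?_ ?_ ?_
  · intro i τ t _ _ hF _
    exact ⟨trivial, (hF.ireg 0 rfl).trans (by simpa using hT.n_eq)⟩
  · rintro v τ t - v2 hF hv ⟨hJ1, hJ2⟩
    have hTτ : Tails E n m τ :=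
      hT.congr (hF.ireg 0 rfl) (hF.ireg 1 rfl) (hF.iarr 3 rfl) (hF.iarr 4 rfl)
    have hdeg : τ.iarr 3 = σ.iarr 3 := hF.iarr 3 rfl
    have hN' : τ.ireg 10 = N := (hF.ireg 10 rfl).trans (by simpa using hN)
    have hd := hTτ.deg_le v v2
    have hv1 : v + 1 < W := lt_word hWn (by omega)
    simp only [runs_seq]
    refine (runs_clearColumn hW hN' hn hTτ.n_eq hv v2).imp fun τ₁ t₁ hF₁ ⟨hA, hA', ht₁⟩ => ?_
    have hT₁ : Tails E n m τ₁ :=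
      hTτ.congr (hF₁.ireg 0 rfl) (hF₁.ireg 1 rfl) (hF₁.iarr 3 rfl) (hF₁.iarr 4 rfl)
    have hdeg₁ : τ₁.iarr 3 = τ.iarr 3 := hF₁.iarr 3 rfl
    have hN₁ : τ₁.ireg 10 = N := (hF₁.ireg 10 rfl).trans hN'
    have hv₁ : τ₁.ireg 11 = v := (hF₁.ireg 11 rfl).trans hv
    simp
    refine runs_below 12 0 (τ₁.iarr 3 (v + 1)) (fun k ρ s =>
      (∀ p < n, ∀ r < v, 0 < ρ.rarr 60 (p * N + r) ↔ ReflTransGen E p r) ∧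
      (∀ p < n, 0 < ρ.rarr 60 (p * N + v) ↔ p = v ∨
        ∃ s < k, ∃ u, τ₁.iarr 4 (cell n (v + 1) (s + 1)) = u + 1 ∧ ReflTransGen E p u) ∧
      s ≤ k * (90 * (n + 1)))
      (by omega) (by simp) ⟨?_, ?_, by omega⟩ ?_ ?_ ?_
    · intro p hp r hr
      simp [hA' p hp r hr, hJ1 p hp r hr]
    · intro p hp
      simp [hA p hp]
      split_ifs <;> simp [*]
    · intro k ρ s _ _ hF' _
      have hv' : ρ.ireg 11 = v := (hF'.ireg 11 rfl).trans (by simpa using hv₁)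
      have e3 : ρ.iarr 3 = τ₁.iarr 3 := hF'.iarr 3 rfl
      simp [hv', e3, hv1]
    · rintro k ρ s - k2 hF' hk ⟨hK1, hK2, hK3⟩
      have hv' : ρ.ireg 11 = v := (hF'.ireg 11 rfl).trans (by simpa using hv₁)
      have hN'' : ρ.ireg 10 = N := (hF'.ireg 10 rfl).trans (by simpa using hN₁)
      have hn' : ρ.ireg 0 = n := (hF'.ireg 0 rfl).trans (by simpa using hT₁.n_eq)
      have e4 : ρ.iarr 4 = τ₁.iarr 4 := hF'.iarr 4 rfl
      obtain ⟨u, hu⟩ := Nat.exists_eq_add_of_le' (hT₁.tail_pos v v2 k k2)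
      have huv : u < v := hE _ _ ((hT₁.mem_iff v v2 u).2 ⟨k, k2, hu⟩)
      have hkn : k + 1 ≤ n := by rw [hdeg₁] at k2; omega
      simp only [runs_seq, runs_iset]
      simp [hv', hn', hk, e4, hu, hv1, CellFits.mk hWn (show v + 1 ≤ n by omega)
        (show k + 1 ≤ n + 1 by omega), lt_word hWn (show k + 1 ≤ n + 3 by omega)]
      refine (runs_addColumn (u := u) hW (by simpa using hN'') hn (by simpa using hn')
        (by simpa using hv') v2 (by simp) huv).imp fun μ r hF'' ⟨hB, hB', hr⟩ => ?_
      have hk' : μ.ireg 12 = k := (hF''.ireg 12 rfl).trans (by simpa using hk)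
      simp at hB hB'
      simp [hk', lt_word hWn (show k + 1 ≤ n + 3 by omega)]
      refine ⟨fun p hp r hr => by rw [hB' p hp r hr, hK1 p hp r hr], fun p hp => ?_, ?_⟩
      · rw [hB p hp, hK2 p hp, hK1 p hp u huv]
        constructor
        · rintro ((h | ⟨s, h1, h2⟩) | h)
          · exact .inl h
          · exact .inr ⟨s, by omega, h2⟩
          · exact .inr ⟨k, le_rfl, u, hu, h⟩
        · rintro (h | ⟨s, h1, w, h2, h3⟩)
          · exact .inl (.inl h)
          · rcases Nat.lt_or_eq_of_le h1 with h | rfl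
            · exact .inl (.inr ⟨s, h, w, h2, h3⟩)
            · obtain rfl : u = w := by omega
              exact .inr h3
      · have : (k + 1) * (90 * (n + 1)) = k * (90 * (n + 1)) + 90 * (n + 1) := by ring
        omega
    · rintro ρ s hF' hk ⟨hK1, hK2, hK3⟩
      have hv' : ρ.ireg 11 = v := (hF'.ireg 11 rfl).trans (by simpa using hv₁)
      simp [hv', hv1]
      refine ⟨fun p hp r hr => ?_, ?_⟩
      · rcases Nat.lt_or_eq_of_le hr with h | rfl
        · exact hK1 p hp r h
        · rw [hK2 p hp, ReflTransGen.cases_tail_iff]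
          refine or_congr eq_comm ?_
          constructor
          · rintro ⟨s, h1, u, h2, h3⟩
            exact ⟨u, h3, (hT₁.mem_iff r v2 u).2 ⟨s, h1, h2⟩⟩
          · rintro ⟨u, h3, h4⟩
            obtain ⟨s, h1, h2⟩ := (hT₁.mem_iff r v2 u).1 h4
            exact ⟨s, h1, u, h2, h3⟩
      · rw [Finset.sum_range_succ]
        rw [hdeg₁, hdeg] at hK3
        nlinarith
  · rintro τ t hF hv ⟨hJ1, hJ2⟩
    refine ⟨hJ1, ?_⟩
    rw [hT.sum_deg] at hJ2
    simp
    nlinarith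

end APSP

/-! ### The lists of ancestors, read off from the matrix. -/

namespace APSP

open RealRAM WDigraph Relation

variable {n m N W : ℕ} {G : WDigraph n m} {π : Fin n ≃ Fin n} {σ τ : Mem}

/-- The increasing list of the numbers below `k` with the property `A`. -/
def Increasing (A : ℕ → Prop) (k : ℕ) (l : List ℕ) : Prop :=
  l.Pairwise (· < ·) ∧ ∀ p, p ∈ l ↔ p < k ∧ A p

theorem Increasing.length_le {A : ℕ → Prop} {k : ℕ} {l : List ℕ} (h : Increasing A k l) :
    l.length ≤ k := by
  have h1 : l.toFinset ⊆ Finset.range k := fun p hp => by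
    simpa using ((h.2 p).1 (by simpa using hp)).1
  have h2 := Finset.card_le_card h1
  rwa [List.toFinset_card_of_nodup (h.1.imp ne_of_lt), Finset.card_range] at h2

theorem Increasing.append {A : ℕ → Prop} {k : ℕ} {l : List ℕ} (h : Increasing A k l) (hk : A k) :
    Increasing A (k + 1) (l ++ [k]) := by
  refine ⟨List.pairwise_append.2 ⟨h.1, by simp, fun a ha b hb => ?_⟩, fun p => ?_⟩
  · rw [List.mem_singleton.1 hb]
    exact ((h.2 a).1 ha).1
  · rw [List.mem_append, h.2, List.mem_singleton]
    constructor
    · rintro (h1 | rfl)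
      exacts [⟨by omega, h1.2⟩, ⟨by omega, hk⟩]
    · rintro ⟨h1, h2⟩
      rcases Nat.lt_succ_iff_lt_or_eq.1 h1 with h1 | h1
      exacts [.inl ⟨h1, h2⟩, .inr h1]

theorem Increasing.skip {A : ℕ → Prop} {k : ℕ} {l : List ℕ} (h : Increasing A k l) (hk : ¬ A k) :
    Increasing A (k + 1) l := by
  refine ⟨h.1, fun p => ?_⟩
  rw [h.2]
  constructor
  · rintro ⟨h1, h2⟩; exact ⟨by omega, h2⟩
  · rintro ⟨h1, h2⟩
    rcases Nat.lt_succ_iff_lt_or_eq.1 h1 with h1 | rfl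
    exacts [⟨h1, h2⟩, absurd h2 hk]

/-- List the positive entries above the diagonal of the matrix, for each column. -/
def listAncestors : Cmd :=
  block [
    .iset 11 (.const 0),
    .while (.ilt (.reg 11) (.reg 0)) (block [
      .iset 12 (.const 0),
      .iset 13 (.const 0),
      .while (.ilt (.reg 13) (.reg 11)) (block [
        .ite (.rlt (.const 0) (.arr 60 (.add (.mul (.reg 13) (.reg 10)) (.reg 11))))
          (block [
            incr 12,
            .istore 6 (cellE (.add (.reg 11) (.const 1)) (.reg 12))
              (.add (.reg 13) (.const 1))])
          .skip,
        incr 13]),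
      .istore 5 (.add (.reg 11) (.const 1)) (.reg 12),
      incr 11])]

/-- Ancestors have lower numbers, so it suffices to scan each column strictly above the diagonal.
This yields increasing order and leaves out the vertex itself, for which a reflexive relation would
be positive. -/
theorem runs_listAncestors (hW : (N + 2) ^ 2 ≤ W) (hN : σ.ireg 10 = N) (hn : n ≤ N)
    (h0 : σ.ireg 0 = n) {A : ℕ → ℕ → Prop}
    (hX : ∀ p < n, ∀ r < n, 0 < σ.rarr 60 (p * N + r) ↔ A p r) :
    Runs W listAncestors σ fun τ t =>
      (∀ v < n, ∃ l, Increasing (A · v) v l ∧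
        Row n (τ.iarr 5 (v + 1)) (τ.iarr 6) (v + 1) (fun p => p + 1) l) ∧
      t ≤ 100 * (n + 1) ^ 2 := by
  have hWn : (n + 2) ^ 2 ≤ W := (Nat.pow_le_pow_left (by omega) 2).trans hW
  simp only [listAncestors, block_cons_cons, block_single, runs_seq]
  simp
  refine runs_below 11 0 n (fun v τ t => (∀ v' < v, ∃ l, Increasing (A · v') v' l ∧
        Row n (τ.iarr 5 (v' + 1)) (τ.iarr 6) (v' + 1) (fun p => p + 1) l) ∧
      t ≤ v * (90 * (n + 1))) (by omega) (by simp) ⟨by omega, by omega⟩ ?_ ?_ ?_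
  · intro i τ t _ _ hF _
    exact ⟨trivial, (hF.ireg 0 rfl).trans (by simpa using h0)⟩
  · rintro v τ t - v2 hF hv ⟨hJ1, hJ2⟩
    have h0' : τ.ireg 0 = n := (hF.ireg 0 rfl).trans (by simpa using h0)
    have hN' : τ.ireg 10 = N := (hF.ireg 10 rfl).trans (by simpa using hN)
    have hX' : τ.rarr 60 = σ.rarr 60 := hF.rarr 60 rfl
    have hv1 : v + 1 < W := lt_word hWn (by omega)
    simp
    refine runs_below 13 0 v (fun k ρ s => (∀ v' < v, ∃ l, Increasing (A · v') v' l ∧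
        Row n (ρ.iarr 5 (v' + 1)) (ρ.iarr 6) (v' + 1) (fun p => p + 1) l) ∧
        (∃ l, Increasing (A · v) k l ∧ Row n (ρ.ireg 12) (ρ.iarr 6) (v + 1) (fun p => p + 1) l) ∧
      s ≤ k * 80) (by omega) (by simp)
      ⟨hJ1, ⟨[], by simp [Increasing], by simp, by simp⟩, by omega⟩ ?_ ?_ ?_
    · intro i τ t _ _ hF _
      exact ⟨trivial, (hF.ireg 11 rfl).trans (by simpa using hv)⟩
    · rintro k ρ s - k2 hF' hk ⟨hK1, ⟨l, hl, hr⟩, hK3⟩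
      have h0'' : ρ.ireg 0 = n := (hF'.ireg 0 rfl).trans (by simpa using h0')
      have hN'' : ρ.ireg 10 = N := (hF'.ireg 10 rfl).trans (by simpa using hN')
      have hv' : ρ.ireg 11 = v := (hF'.ireg 11 rfl).trans (by simpa using hv)
      have hX'' : ρ.rarr 60 = σ.rarr 60 := (hF'.rarr 60 rfl).trans hX'
      have hlen := hl.length_le
      have h12 : ρ.ireg 12 = l.length := hr.1
      have f1 := matrix_fits hW (show k < N by omega) (show v < N by omega)
      simp only [runs_seq, runs_ite]
      simp [h0'', hN'', hv', hX'', hk, h12, f1, hX k (by omega) v v2,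
        CellFits.mk hWn (show v + 1 ≤ n by omega) (show l.length + 1 ≤ n + 1 by omega),
        lt_word hWn (show l.length + 1 ≤ n + 3 by omega)]
      refine ⟨fun hA => ⟨fun v' hv' => ?_, ⟨l ++ [k], ?_, ?_⟩, by omega⟩,
        fun hA => ⟨hK1, ⟨l, ?_, rfl, hr.2⟩, by omega⟩⟩
      · obtain ⟨l', hl', hr'⟩ := hK1 v' hv'
        refine ⟨l', hl', hr'.congr (hl'.length_le.trans (by omega)) fun s hs => ?_⟩
        simp only [Mem.setIArr_iarr, cell_inj hs (show l.length + 1 ≤ n by omega)]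
        rw [if_neg (by omega)]
        rfl
      · simpa using hl.append hA
      · refine Row.append ⟨rfl, hr.2⟩ (by omega) ?_ ?_
        · simp
        · intro s hs hne
          simp [cell_inj hs (show l.length + 1 ≤ n by omega), hne]
      · simpa using hl.skip hA
    · rintro ρ s hF' hk ⟨hK1, ⟨l, hl, hr⟩, hK3⟩
      have hv' : ρ.ireg 11 = v := (hF'.ireg 11 rfl).trans (by simpa using hv)
      simp [hv', hv1]
      refine ⟨fun v' hv' => ?_, by nlinarith⟩
      rcases Nat.lt_or_eq_of_le hv' with h | rfl
      · obtain ⟨l', hl', hr'⟩ := hK1 v' h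
        exact ⟨l', hl', by rw [if_neg (by omega)]; exact hr'⟩
      · exact ⟨l, hl, by rw [if_pos rfl]; exact hr⟩
  · rintro τ t hF hv ⟨hJ1, hJ2⟩
    exact ⟨hJ1, by simp; nlinarith⟩

/-! ## The ancestors of all vertices -/

/-- The edges between the numbers of the vertices. -/
def numAdj (G : WDigraph n m) (π : Fin n ≃ Fin n) (p r : ℕ) : Prop :=
  ∃ u v, (π u : ℕ) = p ∧ (π v : ℕ) = r ∧ G.Adj u v

theorem numAdj_lt (hπ : G.IsNumbering π) {p r : ℕ} (h : numAdj G π p r) : p < r := by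
  obtain ⟨u, v, rfl, rfl, h⟩ := h
  exact hπ.topological u v h

theorem numAdj_lt_card {p r : ℕ} (h : numAdj G π p r) : r < n := by
  obtain ⟨u, v, rfl, rfl, h⟩ := h
  exact (π v).2

theorem numAdj_iff {u v : Fin n} : numAdj G π (π u) (π v) ↔ G.Adj u v := by
  constructor
  · rintro ⟨x, y, h1, h2, h⟩
    rwa [π.injective (Fin.ext h1), π.injective (Fin.ext h2)] at h
  · exact fun h => ⟨u, v, rfl, rfl, h⟩

/-- Passing to numbers is an isomorphism of graphs. In the induction the end vertex is generalized,
because an intermediate number must first be recognized as that of a vertex. -/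
theorem transGen_numAdj {u v : Fin n} : TransGen (numAdj G π) (π u) (π v) ↔ G.Ancestor u v := by
  constructor
  · intro h
    generalize hr : (π v : ℕ) = r at h
    induction h generalizing v with
    | single h =>
      subst hr
      exact .single (numAdj_iff.1 h)
    | tail h h' ih =>
      subst hr
      obtain ⟨x, y, rfl, h2, h3⟩ := h'
      rw [π.injective (Fin.ext h2)] at h3
      exact .tail (ih rfl) h3
  · exact fun h => TransGen.lift (p := numAdj G π) (fun u : Fin n => (π u : ℕ))
      (fun _ _ => numAdj_iff.2) u v h

theorem Numbered.tails (hσ : Numbered G π σ) : Tails (numAdj G π) n m σ := by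
  have hv : ∀ v < n, ∃ x : Fin n, (π x : ℕ) = v := fun v hv => ⟨π.symm ⟨v, hv⟩, by simp⟩
  refine ⟨hσ.loaded.n_eq, hσ.loaded.m_eq, ?_, ?_, ?_, ?_⟩
  · intro v hvn
    obtain ⟨x, rfl⟩ := hv v hvn
    obtain ⟨d, f, hL⟩ := hσ.exists_inList x
    exact hL.deg.trans_le hL.le
  · intro v hvn p
    obtain ⟨x, rfl⟩ := hv v hvn
    obtain ⟨d, f, hL⟩ := hσ.exists_inList x
    have hd : σ.iarr 3 (π x + 1) = d := hL.deg
    have ht : ∀ s : Fin d, σ.iarr 4 (cell n (π x + 1) (s + 1)) = π (G.src (f s)) + 1 := hL.tail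
    rw [hd]
    constructor
    · rintro ⟨u, y, rfl, h2, e, he, he'⟩
      rw [π.injective (Fin.ext h2)] at he'
      obtain ⟨s, rfl⟩ : e ∈ Set.range f := by rw [hL.range]; exact he'
      exact ⟨s, s.2, by rw [ht s, he]⟩
    · rintro ⟨s, hs, h⟩
      rw [ht ⟨s, hs⟩] at h
      have : f ⟨s, hs⟩ ∈ {e | G.tgt e = x} := by rw [← hL.range]; exact ⟨_, rfl⟩
      exact ⟨G.src (f ⟨s, hs⟩), x, by omega, rfl, _, rfl, this⟩
  · intro v hvn s hs
    obtain ⟨x, rfl⟩ := hv v hvn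
    obtain ⟨d, f, hL⟩ := hσ.exists_inList x
    have hd : σ.iarr 3 (π x + 1) = d := hL.deg
    have ht := hL.tail ⟨s, by omega⟩
    simp only [aInTail] at ht
    omega
  · rw [Finset.sum_range (fun v => σ.iarr 3 (v + 1)), ← G.sum_indeg, ← Equiv.sum_comp π]
    refine Finset.sum_congr rfl fun x _ => ?_
    obtain ⟨d, f, hL⟩ := hσ.exists_inList x
    rw [hL.indeg_eq]
    exact hL.deg

theorem Numbered.congr (h : Numbered G π σ) (h0 : τ.ireg 0 = σ.ireg 0)
    (h1 : τ.ireg 1 = σ.ireg 1) (h2 : τ.ireg 2 = σ.ireg 2)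
    (ha : ∀ a < 5, τ.iarr a = σ.iarr a) (hr : ∀ a < 2, τ.rarr a = σ.rarr a) :
    Numbered G π τ := by
  obtain ⟨⟨a1, a2, a3, a4, a5⟩, b1, b2, b3⟩ := h
  refine ⟨⟨h0.trans a1, h1.trans a2, ?_, ?_, ?_⟩, ?_, h2.trans b2, ?_⟩
  · rwa [ha 0 (by omega)]
  · rwa [ha 1 (by omega)]
  · rwa [hr 0 (by omega)]
  · rwa [ha 2 (by omega)]
  · rwa [ha 3 (by omega), ha 4 (by omega), hr 1 (by omega)]

theorem exists_ancestors (hπ : G.IsNumbering π) {v : Fin n} {len : ℕ} {tab : ℕ → ℕ} {l : List ℕ}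
    (hl : Increasing (ReflTransGen (numAdj G π) · (π v)) (π v) l)
    (hr : Row n len tab (π v + 1) (fun p => p + 1) l) :
    ∃ (a : ℕ) (f : Fin a → Fin n), StrictMono (fun s => π (f s)) ∧
      Set.range f = {u | G.Ancestor u v} ∧ len = a ∧
      ∀ s : Fin a, tab (cell n (π v + 1) (s + 1)) = π (f s) + 1 := by
  have hlt : ∀ s : Fin l.length, l[s] < n := fun s =>
    ((hl.2 _).1 (List.getElem_mem s.2)).1.trans (π v).2
  refine ⟨l.length, fun s => π.symm ⟨l[s], hlt s⟩, fun s s' h => ?_, ?_, hr.1, fun s => ?_⟩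
  · simp only [Equiv.apply_symm_apply, Fin.mk_lt_mk]
    exact List.pairwise_iff_getElem.1 hl.1 _ _ s.2 s'.2 h
  · ext u
    simp only [Set.mem_range, Set.mem_ofPred_eq, ← transGen_numAdj (G := G) (π := π)]
    constructor
    · rintro ⟨s, rfl⟩
      obtain ⟨h1, h2⟩ := (hl.2 _).1 (List.getElem_mem s.2)
      rw [Equiv.apply_symm_apply]
      exact (reflTransGen_iff_eq_or_transGen.1 h2).resolve_left (ne_of_gt h1)
    · intro h
      have hlt := Fin.lt_def.1 (hπ.lt_of_ancestor (transGen_numAdj.1 h))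
      obtain ⟨s, hs, hs'⟩ := List.getElem_of_mem ((hl.2 _).2 ⟨hlt, h.to_reflTransGen⟩)
      exact ⟨⟨s, hs⟩, π.injective (by simp [hs'])⟩
  · simpa using hr.2 s s.2

end APSP

/-! ### The ancestors program: limited matrix multiplication with a fallback. -/

namespace APSP

open RealRAM WDigraph Relation

variable {n m W : ℕ} {G : WDigraph n m} {π : Fin n ≃ Fin n} {σ τ : Mem}

/-- Enter the edges into a matrix whose number of rows is a power of two. -/
def buildMatrix : Cmd :=
  block [powerOfTwo, clearMatrix, enterEdges]

/-- Compute the transitive closure by matrix multiplication, or by traversing the graph if that does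
not take longer. -/
def closeMatrix (P : Cmd) : Cmd :=
  block [
    .iset 60 (.reg 10),
    .iset 40 (.add (.mul (.reg 0) (.add (.reg 0) (.reg 1))) (.const 1)),
    (closure P).limit 60,
    .ite (.ieq (.reg 40) (.const 0)) propagate .skip]

/-- Compute the ancestors of all vertices. -/
def findAncestors (P : Cmd) : Cmd :=
  block [buildMatrix, closeMatrix P, listAncestors]

section Matrix

variable {E : ℕ → ℕ → Prop}

theorem runs_buildMatrix (hE : ∀ p r, E p r → p < r) (hEn : ∀ p r, E p r → r < n)
    (hT : Tails E n m σ) (hW : (2 * n + 3) ^ 2 ≤ W) :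
    Runs W buildMatrix σ fun τ t => ∃ k N, N = 2 ^ k ∧ τ.ireg 10 = N ∧ n ≤ N ∧ N ≤ 2 * n + 1 ∧
      Represents (τ.rarr 60) N (fun i j => i = j ∨ E i j) ∧ t ≤ 500 * (n + 1) ^ 2 := by
  simp only [buildMatrix, block_cons_cons, block_single, runs_seq]
  have hW1 : 2 * n + 1 < W := by nlinarith
  refine (runs_powerOfTwo hT.n_eq hW1).imp fun τ₁ t₁ hF₁ ⟨⟨k, hk⟩, hnN, hNn, ht₁⟩ => ?_
  generalize hN₁ : τ₁.ireg 10 = N at hk hnN hNn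
  have hWN : (N + 2) ^ 2 ≤ W := (Nat.pow_le_pow_left (by omega) 2).trans hW
  have hT₁ : Tails E n m τ₁ :=
    hT.congr (hF₁.ireg 0 rfl) (hF₁.ireg 1 rfl) (hF₁.iarr 3 rfl) (hF₁.iarr 4 rfl)
  refine (runs_clearMatrix hWN hN₁).imp fun τ₂ t₂ hF₂ ⟨hX₂, ht₂⟩ => ?_
  have hN₂ : τ₂.ireg 10 = N := (hF₂.ireg 10 rfl).trans hN₁
  have hT₂ : Tails E n m τ₂ :=
    hT₁.congr (hF₂.ireg 0 rfl) (hF₂.ireg 1 rfl) (hF₂.iarr 3 rfl) (hF₂.iarr 4 rfl)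
  refine (runs_enterEdges hWN hN₂ hnN hE hEn hT₂ hX₂).imp fun τ₃ t₃ hF₃ ⟨hX₃, ht₃⟩ => ?_
  refine ⟨k, N, hk, (hF₃.ireg 10 rfl).trans hN₂, hnN, hNn, hX₃, ?_⟩
  have hN1 : (N + 1) ^ 2 ≤ (2 * n + 2) ^ 2 := Nat.pow_le_pow_left (by omega) 2
  have h2 : (2 * n + 2) ^ 2 = 4 * (n + 1) ^ 2 := by ring
  have h3 : n + 1 ≤ (n + 1) ^ 2 := Nat.le_self_pow (by omega) _
  omega

/-- The fallback costs a constant multiple of the fuel that has been used up in vain, so trying the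
fast method first loses only a constant factor. For `n = 0` there are no edges. -/
theorem propagate_time (hm : m ≤ n * n) :
    (n + 1) * (n + m + 1) ≤ 4 * (n * (n + m) + 1) := by
  rcases Nat.eq_zero_or_pos n with rfl | hn
  · simp at hm; subst hm; simp
  · have h1 : n ≤ n * n := Nat.le_mul_of_pos_left n hn
    have h2 : m ≤ n * m := Nat.le_mul_of_pos_left m hn
    have h3 : (n + 1) * (n + m + 1) = n * n + n * m + 2 * n + m + 1 := by ring
    have h4 : n * (n + m) = n * n + n * m := by ring
    omega

/-- The amount of fuel can be of order `n ^ 3`, for which the square of `n + 2` would be too small a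
word bound. -/
theorem fuel_lt (hm : m ≤ n * n) (hW : (n + 2) ^ 4 ≤ W) : n + m < W ∧ n * (n + m) + 1 < W := by
  have h1 : n * (n + m) ≤ n * (n + n * n) := by gcongr
  have h2 : (n + 2) ^ 4 = n * (n + n * n) + (n ^ 4 + 7 * n ^ 3 + 23 * n ^ 2 + 32 * n + 16) := by
    ring
  have h3 : n ^ 2 = n * n := by ring
  omega

/-- Let `s` be the time that the closure program would need without a limit. If fuel is left, the
matrix is complete; otherwise the amount of fuel is at most `s`, and the fallback costs as much
again up to a constant. The minimum of the two bounds arises without the program knowing `s` or `θ`.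
-/
theorem runs_closeMatrix {P : Cmd} {c C N k : ℕ} {θ : ℝ} (hP : Multiplies P c C θ) (hθ : 2 ≤ θ)
    (hm : m ≤ n * n) (hW : (n + 2) ^ 4 ≤ W) (hWN : (N + 2) ^ 2 ≤ W) (hWNc : (N + 2) ^ c ≤ W)
    (hE : ∀ p r, E p r → p < r) (hT : Tails E n m σ) (hN : σ.ireg 10 = N) (hk : N = 2 ^ k)
    (hn : n ≤ N) (hX : Represents (σ.rarr 60) N (fun i j => i = j ∨ E i j)) :
    Runs W (closeMatrix P) σ fun τ t =>
      (∀ p < n, ∀ r < n, 0 < τ.rarr 60 (p * N + r) ↔ ReflTransGen E p r) ∧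
      ∃ s : ℕ, (s : ℝ) ≤ (2 * C + 740) * (N : ℝ) ^ θ ∧
        t ≤ ((closure P).overhead + 1000) * (min s (n * (n + m) + 1) + 1) := by
  simp only [closeMatrix, block_cons_cons, block_single, runs_seq, runs_iset]
  refine ⟨trivial, ?_, ?_⟩
  · simp [hT.n_eq, hT.m_eq, fuel_lt hm hW]
    have := (fuel_lt hm hW).2
    omega
  set τ₄ := (σ.setIReg 60 (IExp.eval σ (.reg 10))).setIReg 40
    (IExp.eval (σ.setIReg 60 (IExp.eval σ (.reg 10)))
      (.add (.mul (.reg 0) (.add (.reg 0) (.reg 1))) (.const 1))) with hτ₄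
  have hf₄ : τ₄.ireg 40 = n * (n + m) + 1 := by simp [hτ₄, hT.n_eq, hT.m_eq]
  have hN₄ : τ₄.ireg 10 = N := by simp [hτ₄, hN]
  have hT₄ : Tails E n m τ₄ :=
    hT.congr (by simp [hτ₄]) (by simp [hτ₄]) (by simp [hτ₄]) (by simp [hτ₄])
  -- Register `60` and real array `60` play the roles of register `0` and real array `0` for the
  -- renumbered closure program.
  have hcl := runs_closure (σ := τ₄.view 60) hP hθ hE (k := k)
    (by simp [Mem.view, hτ₄, hN]) hk hWN hWNc (by simpa [Mem.view, hτ₄] using hX)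
  refine (hcl.limit (by omega)).imp fun τ₅ t₅ hF₅ ⟨s, ht₅, hs, hok, _, _, hsN⟩ => ?_
  rw [rFuel, hf₄] at ht₅ hs
  have hw : ∀ l : Loc, l.index < 60 → l ≠ .ireg 40 → l ≠ .ireg 41 →
      ((closure P).limit 60).writes l = false := fun l h1 h2 h3 => Cmd.writes_limit _ h1 h2 h3
  have hN₅ : τ₅.ireg 10 = N :=
    (hF₅.ireg 10 (hw _ (by decide) (by decide) (by decide))).trans hN₄
  have hT₅ : Tails E n m τ₅ :=
    hT₄.congr (hF₅.ireg 0 (hw _ (by decide) (by decide) (by decide)))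
      (hF₅.ireg 1 (hw _ (by decide) (by decide) (by decide)))
      (hF₅.iarr 3 (hw _ (by decide) (by decide) (by decide)))
      (hF₅.iarr 4 (hw _ (by decide) (by decide) (by decide)))
  rw [runs_ite]
  refine ⟨by simp, fun h => ?_, fun h => ?_⟩
  · have hs := hs (by simpa using h)
    refine (runs_propagate hWN hN₅ hn hE hT₅).imp fun τ t _ ⟨h1, h2⟩ => ⟨h1, s, hsN, ?_⟩
    rw [min_eq_right hs] at ht₅ ⊢
    have := propagate_time hm
    rw [mul_assoc] at h2
    simp
    linarith
  · simp at h
    rw [runs_skip]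
    refine ⟨fun p hp r hr => ?_, s, hsN, ?_⟩
    · exact ((hok (by simp; omega)).1 p (by omega) r (by omega)).2
    · generalize min s (n * (n + m) + 1) = x at ht₅ ⊢
      simp
      linarith [Nat.zero_le x]

end Matrix

theorem runs_findAncestors {P : Cmd} {c C : ℕ} {θ : ℝ} (hP : Multiplies P c C θ) (hθ : 2 ≤ θ)
    (hW : (n + 2) ^ (2 * c + 4) ≤ W) (hπ : G.IsNumbering π) (hσ : Numbered G π σ) :
    Runs W (findAncestors P) σ fun τ t => AncestorsListed G π τ ∧
      ∃ s N : ℕ, N ≤ 2 * n + 1 ∧ (s : ℝ) ≤ (2 * C + 740) * (N : ℝ) ^ θ ∧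
        t ≤ 1000 * (n + 1) ^ 2 +
          ((closure P).overhead + 1000) * (min s (n * (n + m) + 1) + 1) := by
  have hW4 : (n + 2) ^ 4 ≤ W := (Nat.pow_le_pow_right (by omega) (by omega)).trans hW
  have hWc : (n + 2) ^ (2 * c) ≤ W := (Nat.pow_le_pow_right (by omega) (by omega)).trans hW
  have hT := hσ.tails
  have hm := G.edges_le
  have hn2 : 2 * n + 3 ≤ (n + 2) ^ 2 := by nlinarith
  have hWn : (2 * n + 3) ^ 2 ≤ W := by
    refine (Nat.pow_le_pow_left hn2 2).trans (le_trans (le_of_eq ?_) hW4); ring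
  simp only [findAncestors, block_cons_cons, block_single, runs_seq]
  refine (runs_buildMatrix (fun _ _ => numAdj_lt hπ) (fun _ _ => numAdj_lt_card) hT hWn).imp
    fun τ₁ t₁ hF₁ ⟨k, N, hk, hN₁, hnN, hNn, hX₁, ht₁⟩ => ?_
  have hT₁ : Tails (numAdj G π) n m τ₁ :=
    hT.congr (hF₁.ireg 0 rfl) (hF₁.ireg 1 rfl) (hF₁.iarr 3 rfl) (hF₁.iarr 4 rfl)
  -- The matrix has up to `2 * n + 1` rows. Squaring `n + 2` covers this enlargement for every
  -- exponent, which explains the summand `2 * c` in the exponent of the word bound.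
  have hN2 : N + 2 ≤ (n + 2) ^ 2 := by omega
  have hWN : (N + 2) ^ 2 ≤ W := by
    refine (Nat.pow_le_pow_left hN2 2).trans (le_trans (le_of_eq ?_) hW4); ring
  have hWNc : (N + 2) ^ c ≤ W := by
    refine (Nat.pow_le_pow_left hN2 c).trans (le_trans (le_of_eq ?_) hWc)
    rw [← pow_mul]
  refine (runs_closeMatrix hP hθ hm hW4 hWN hWNc (fun _ _ => numAdj_lt hπ) hT₁ hN₁ hk hnN
    hX₁).imp fun τ₂ t₂ hF₂ ⟨hX₂, s, hs, ht₂⟩ => ?_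
  have hw₁ : ∀ a < 60, buildMatrix.writes (.rarr a) = false := fun a ha => by
    simp [buildMatrix, powerOfTwo, clearMatrix, enterEdges, Cmd.writes]; omega
  have hw₂ : ∀ l : Loc, l.index < 11 ∨ (∃ a < 60, l = .iarr a) ∨ (∃ a < 60, l = .rarr a) →
      (closeMatrix P).writes l = false := by
    intro l hl
    have h1 : l.index < 60 := by
      rcases hl with h | ⟨a, h, rfl⟩ | ⟨a, h, rfl⟩
      exacts [by omega, h, h]
    have h2 : ∀ x, 11 ≤ x → l ≠ .ireg x := by
      rintro x hx rfl
      simp [Loc.index] at hl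
      omega
    have h3 : l ≠ .rarr 60 := by rintro rfl; simp [Loc.index] at h1
    simp [closeMatrix, propagate, clearColumn, addColumn, Cmd.writes, h2, h3,
      Cmd.writes_limit _ h1 (h2 40 (by omega)) (h2 41 (by omega))]
  have hN₂ : τ₂.ireg 10 = N := (hF₂.ireg 10 (hw₂ _ (.inl (by decide)))).trans hN₁
  have h0₂ : τ₂.ireg 0 = n := (hF₂.ireg 0 (hw₂ _ (.inl (by decide)))).trans hT₁.n_eq
  refine (runs_listAncestors hWN hN₂ hnN h0₂ hX₂).imp fun τ₃ t₃ hF₃ ⟨hl, ht₃⟩ => ?_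
  refine ⟨⟨hσ.congr ?_ ?_ ?_ ?_ ?_, fun v => ?_⟩, s, N, hNn, hs, by omega⟩
  · rw [hF₃.ireg 0 rfl, h0₂, hT.n_eq]
  · rw [hF₃.ireg 1 rfl, hF₂.ireg 1 (hw₂ _ (.inl (by decide))), hF₁.ireg 1 rfl]
  · rw [hF₃.ireg 2 rfl, hF₂.ireg 2 (hw₂ _ (.inl (by decide))), hF₁.ireg 2 rfl]
  · intro a ha
    have h3 : listAncestors.writes (.iarr a) = false := by
      simp [listAncestors, Cmd.writes]; omega
    rw [hF₃.iarr a h3, hF₂.iarr a (hw₂ _ (.inr (.inl ⟨a, by omega, rfl⟩))), hF₁.iarr a rfl]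
  · intro a ha
    rw [hF₃.rarr a rfl, hF₂.rarr a (hw₂ _ (.inr (.inr ⟨a, by omega, rfl⟩))),
      hF₁.rarr a (hw₁ a (by omega))]
  · obtain ⟨l, hl1, hl2⟩ := hl (π v) (π v).2
    exact exists_ancestors hπ hl1 hl2

/-- The running time of `findAncestors`, without the constant factor. -/
theorem findAncestors_time (hm : m ≤ n * n) {θ θ' : ℝ} (hθ : 2 ≤ θ) (hθ' : θ ≤ θ') {A B : ℕ}
    {s N t : ℕ} (hN : N ≤ 2 * n + 1) (hs : (s : ℝ) ≤ A * (N : ℝ) ^ θ)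
    (ht : t ≤ 1000 * (n + 1) ^ 2 + B * (min s (n * (n + m) + 1) + 1)) :
    (t : ℝ) ≤ (6000 + B * (A * ⌈(3 : ℝ) ^ θ⌉₊ + 5)) *
      (1 + min ((n : ℝ) ^ θ') ((n : ℝ) * m + (n : ℝ) ^ 2 * Real.log n)) ∧
    ((n : ℝ) + 1) ^ 2 ≤
      6 * (1 + min ((n : ℝ) ^ θ') ((n : ℝ) * m + (n : ℝ) ^ 2 * Real.log n)) := by
  set M := 1 + min ((n : ℝ) ^ θ') ((n : ℝ) * m + (n : ℝ) ^ 2 * Real.log n) with hM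
  have hA : (0 : ℝ) ≤ A := Nat.cast_nonneg _
  have hB : (0 : ℝ) ≤ B := Nat.cast_nonneg _
  have hlog : 0 ≤ Real.log n := Real.log_natCast_nonneg n
  have hpow : 0 ≤ (n : ℝ) ^ θ' := by positivity
  have hM1 : 1 ≤ M := by
    rw [hM]
    have : 0 ≤ min ((n : ℝ) ^ θ') ((n : ℝ) * m + (n : ℝ) ^ 2 * Real.log n) :=
      le_min hpow (by positivity)
    linarith
  -- An upper bound by the minimum is proved by bounding by each of its two arguments.
  have key : ∀ κ x : ℝ, 0 ≤ κ → x ≤ κ * (1 + (n : ℝ) ^ θ') →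
      x ≤ κ * (1 + ((n : ℝ) * m + (n : ℝ) ^ 2 * Real.log n)) → x ≤ κ * M := by
    intro κ x hκ h1 h2
    rw [hM]
    rcases min_choice ((n : ℝ) ^ θ') ((n : ℝ) * m + (n : ℝ) ^ 2 * Real.log n) with h | h <;>
      rw [h] <;> assumption
  -- For `n ≤ 1` the summand `1` suffices although the logarithm vanishes; for larger `n` one uses
  -- `log 2 > 1 / 2`.
  have hnlog : (n : ℝ) ^ 2 ≤ 2 * (1 + (n : ℝ) ^ 2 * Real.log n) := by
    rcases Nat.lt_or_ge n 2 with hn | hn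
    · have : (n : ℝ) ≤ 1 := by exact_mod_cast (by omega : n ≤ 1)
      nlinarith [mul_nonneg (sq_nonneg (n : ℝ)) hlog, (Nat.cast_nonneg n : (0 : ℝ) ≤ n)]
    · have h2 : Real.log 2 ≤ Real.log n :=
        Real.log_le_log (by norm_num) (by exact_mod_cast hn)
      have := Real.log_two_gt_d9
      nlinarith [sq_nonneg (n : ℝ)]
  have hnθ : ∀ η : ℝ, 2 ≤ η → (n : ℝ) ^ 2 ≤ (n : ℝ) ^ η := by
    intro η hη
    rcases Nat.eq_zero_or_pos n with rfl | hn
    · simp [Real.zero_rpow (by linarith : η ≠ 0)]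
    · rw [← Real.rpow_two]
      exact Real.rpow_le_rpow_of_exponent_le (by exact_mod_cast hn) hη
  have hnm : 0 ≤ (n : ℝ) * m := by positivity
  have hsq : (n : ℝ) ^ 2 ≤ 2 * M := by
    refine key 2 _ (by norm_num) ?_ ?_
    · have := hnθ θ' (hθ.trans hθ')
      linarith
    · linarith
  have hsq1 : ((n : ℝ) + 1) ^ 2 ≤ 6 * M := by nlinarith [sq_nonneg ((n : ℝ) - 1)]
  refine ⟨?_, hsq1⟩
  -- For `n ≥ 1` the padded size is at most `3 * n`, which costs a factor `3 ^ θ`. It is rounded up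
  -- because the final constant must be a natural number.
  set D : ℝ := (⌈(3 : ℝ) ^ θ⌉₊ : ℝ) with hD
  have hD3 : (3 : ℝ) ^ θ ≤ D := Nat.le_ceil _
  have hD0 : 0 ≤ D := Nat.cast_nonneg _
  have hNθ : (N : ℝ) ^ θ ≤ D * (1 + (n : ℝ) ^ θ') := by
    rcases Nat.eq_zero_or_pos n with rfl | hn
    · have h1 : (N : ℝ) ≤ 3 := by exact_mod_cast (by omega : N ≤ 3)
      have h2 : (N : ℝ) ^ θ ≤ 3 ^ θ := Real.rpow_le_rpow (by positivity) h1 (by linarith)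
      nlinarith
    · have h1 : (N : ℝ) ≤ 3 * n := by exact_mod_cast (by omega : N ≤ 3 * n)
      have h2 : (N : ℝ) ^ θ ≤ (3 * n) ^ θ := Real.rpow_le_rpow (by positivity) h1 (by linarith)
      rw [Real.mul_rpow (by norm_num) (by positivity)] at h2
      have h3 : (n : ℝ) ^ θ ≤ (n : ℝ) ^ θ' :=
        Real.rpow_le_rpow_of_exponent_le (by exact_mod_cast hn) hθ'
      have h4 : (3 : ℝ) ^ θ * (n : ℝ) ^ θ ≤ D * (n : ℝ) ^ θ' :=
        mul_le_mul hD3 h3 (by positivity) hD0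
      nlinarith
  have hmin : ((min s (n * (n + m) + 1) : ℕ) : ℝ) ≤ (A * D + 4) * M := by
    refine key _ _ (by positivity) ?_ ?_
    · have h1 : ((min s (n * (n + m) + 1) : ℕ) : ℝ) ≤ s := by exact_mod_cast min_le_left _ _
      have h2 : (A : ℝ) * (N : ℝ) ^ θ ≤ A * (D * (1 + (n : ℝ) ^ θ')) :=
        mul_le_mul_of_nonneg_left hNθ hA
      linarith
    · have h1 : ((min s (n * (n + m) + 1) : ℕ) : ℝ) ≤ ((n * (n + m) + 1 : ℕ) : ℝ) := by
        exact_mod_cast min_le_right _ _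
      push_cast at h1
      have h2 : 0 ≤ A * D * (1 + ((n : ℝ) * m + (n : ℝ) ^ 2 * Real.log n)) := by positivity
      push_cast
      nlinarith
  have ht' : (t : ℝ) ≤ 1000 * ((n : ℝ) + 1) ^ 2 +
      B * (((min s (n * (n + m) + 1) : ℕ) : ℝ) + 1) := by exact_mod_cast ht
  have : (B : ℝ) * (((min s (n * (n + m) + 1) : ℕ) : ℝ) + 1) ≤ B * ((A * D + 5) * M) :=
    mul_le_mul_of_nonneg_left (by linarith) hB
  calc (t : ℝ) ≤ 1000 * (6 * M) + B * ((A * D + 5) * M) := by linarith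
    _ = _ := by ring

end APSP

/-- Let `τ` be an exponent of matrix multiplication or any real number greater than `ω`.  With
suitable programs for the numbering of the vertices and for the sets of ancestors, the algorithm
solves the all-pairs shortest paths problem in every acyclic graph within the stated time.  This
holds for the whole algorithm, and it holds for the part after the numbering with respect to
every admissible numbering of the vertices. -/
theorem theorem2 (τ : ℝ) (hτ : RealRAM.IsMatMulExponent τ ∨ RealRAM.omega < τ) :
    ∃ (numbering ancestors : RealRAM.Cmd) (c C : ℕ),
      ∀ (n m : ℕ) (G : WDigraph n m), G.IsAcyclic →
        (∀ σ : RealRAM.Mem, APSP.Loaded G σ →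
          ∃ (π : Fin n ≃ Fin n) (σ' : RealRAM.Mem) (t : ℕ), G.IsNumbering π ∧
            RealRAM.Exec ((n + 2) ^ c) numbering σ σ' t ∧
            APSP.Numbered G π σ' ∧
            t ≤ C * (1 + n + m)) ∧
        (∀ (π : Fin n ≃ Fin n) (σ : RealRAM.Mem), G.IsNumbering π → APSP.Numbered G π σ →
          ∃ (σ' : RealRAM.Mem) (t : ℕ),
            RealRAM.Exec ((n + 2) ^ c) ancestors σ σ' t ∧
            APSP.AncestorsListed G π σ' ∧
            (t : ℝ) ≤ C * (1 + min ((n : ℝ) ^ τ) ((n : ℝ) * m + (n : ℝ) ^ 2 * Real.log n))) ∧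
        (∀ (π : Fin n ≃ Fin n) (σ : RealRAM.Mem), G.IsNumbering π → APSP.Numbered G π σ →
          ∃ (σ' : RealRAM.Mem) (t : ℕ),
            RealRAM.Exec ((n + 2) ^ c) (APSP.afterNumbering ancestors) σ σ' t ∧
            APSP.Output G π σ' ∧
            (t : ℝ) ≤ C * APSP.timeBound G π τ) ∧
        (∀ σ : RealRAM.Mem, APSP.Loaded G σ →
          ∃ (π : Fin n ≃ Fin n) (σ' : RealRAM.Mem) (t : ℕ), G.IsNumbering π ∧
            RealRAM.Exec ((n + 2) ^ c) (APSP.algorithm numbering ancestors) σ σ' t ∧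
            APSP.Output G π σ' ∧
            (t : ℝ) ≤ C * APSP.timeBound G π τ) := by
  obtain ⟨θ, hθτ, hθ⟩ := RealRAM.exists_isMatMulExponent_le hτ
  have hθ2 := hθ.two_le
  obtain ⟨P, c, C, hP⟩ := hθ.exists_multiplies
  let B := (RealRAM.closure P).overhead + 1000
  let D := 6000 + B * ((2 * C + 740) * ⌈(3 : ℝ) ^ θ⌉₊ + 5)
  have hD : ((6000 + B * (((2 * C + 740 : ℕ) : ℝ) * ⌈(3 : ℝ) ^ θ⌉₊ + 5) : ℝ)) = D := by
    simp only [D]; push_cast; ring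
  refine ⟨APSP.numbering, APSP.findAncestors P, 2 * c + 4, D + 20000, fun n m G hG => ?_⟩
  have hW2 : (n + 2) ^ 2 ≤ (n + 2) ^ (2 * c + 4) := Nat.pow_le_pow_right (by omega) (by omega)
  set M := 1 + min ((n : ℝ) ^ τ) ((n : ℝ) * m + (n : ℝ) ^ 2 * Real.log n) with hM
  -- Only the second half of the conclusion is wanted, so trivial values are inserted for the
  -- parameters of the first.
  have hsq : ((n : ℝ) + 1) ^ 2 ≤ 6 * M :=
    (APSP.findAncestors_time (A := 0) (B := 0) (s := 0) (N := 0) (t := 0) G.edges_le hθ2 hθτ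
      (by omega) (by simp) (by simp)).2
  have hM0 : 0 ≤ M := by nlinarith [sq_nonneg ((n : ℝ) + 1)]
  have hanc : ∀ (π : Fin n ≃ Fin n) (σ : RealRAM.Mem), G.IsNumbering π → APSP.Numbered G π σ →
      RealRAM.Runs ((n + 2) ^ (2 * c + 4)) (APSP.findAncestors P) σ fun σ' t =>
        APSP.AncestorsListed G π σ' ∧ (t : ℝ) ≤ D * M := by
    intro π σ hπ hσ
    refine (APSP.runs_findAncestors hP hθ2 le_rfl hπ hσ).imp fun σ' t _ ⟨h1, s, N, hN, hs, ht⟩ =>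
      ⟨h1, ?_⟩
    have := (APSP.findAncestors_time (A := 2 * C + 740) (B := B) G.edges_le hθ2 hθτ hN
      (by push_cast; exact hs) ht).1
    rwa [hD, ← hM] at this
  have hafter : ∀ (π : Fin n ≃ Fin n) (σ : RealRAM.Mem), G.IsNumbering π → APSP.Numbered G π σ →
      RealRAM.Runs ((n + 2) ^ (2 * c + 4)) (APSP.afterNumbering (APSP.findAncestors P)) σ
        fun σ' t => APSP.Output G π σ' ∧ (t : ℝ) ≤ (D + 7000) * APSP.timeBound G π τ := by
    intro π σ hπ hσ
    refine (APSP.runs_afterNumbering hW2 hG hπ (hanc π σ hπ hσ)).imp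
      fun σ' t _ ⟨h1, s, hs, ht⟩ => ⟨h1, ?_⟩
    have ht' : (t : ℝ) ≤ s + 1100 * ((n : ℝ) + 1) ^ 2 + 120 * (G.leafSum π : ℝ) := by
      exact_mod_cast ht
    have hL : (0 : ℝ) ≤ G.leafSum π := Nat.cast_nonneg _
    have hD0 : (0 : ℝ) ≤ D := Nat.cast_nonneg _
    have : APSP.timeBound G π τ = M + G.leafSum π := rfl
    rw [this]
    nlinarith [mul_nonneg hD0 hL]
  refine ⟨fun σ hσ => ?_, fun π σ hπ hσ => ?_, fun π σ hπ hσ => ?_, fun σ hσ => ?_⟩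
  · obtain ⟨σ', t, he, π, hπ, h1, h2⟩ := APSP.runs_numbering hW2 hG hσ
    exact ⟨π, σ', t, hπ, he, h1, h2.trans (Nat.mul_le_mul_right _ (by omega))⟩
  · obtain ⟨σ', t, he, h1, h2⟩ := hanc π σ hπ hσ
    refine ⟨σ', t, he, h1, h2.trans (mul_le_mul_of_nonneg_right ?_ hM0)⟩
    push_cast; linarith
  · obtain ⟨σ', t, he, h1, h2⟩ := hafter π σ hπ hσ
    refine ⟨σ', t, he, h1, h2.trans (mul_le_mul_of_nonneg_right ?_ ?_)⟩
    · push_cast; linarith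
    · exact add_nonneg hM0 (Nat.cast_nonneg _)
  · obtain ⟨σ₁, t₁, he₁, π, hπ, h1, h2⟩ := APSP.runs_numbering hW2 hG hσ
    obtain ⟨σ₂, t₂, he₂, h3, h4⟩ := hafter π σ₁ hπ h1
    refine ⟨π, σ₂, t₁ + t₂, hπ, .seq he₁ he₂, h3, ?_⟩
    have hm : (m : ℝ) ≤ n * n := by exact_mod_cast G.edges_le
    have h2' : (t₁ : ℝ) ≤ 1000 * (1 + n + m) := by exact_mod_cast h2
    have hn0 : (0 : ℝ) ≤ n := Nat.cast_nonneg _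
    have hL : (0 : ℝ) ≤ G.leafSum π := Nat.cast_nonneg _
    have hT : APSP.timeBound G π τ = M + G.leafSum π := rfl
    -- Since `m ≤ n ^ 2`, the time for the numbering is at most a multiple of `(n + 1) ^ 2`, hence
    -- of `M`.
    have h5 : (t₁ : ℝ) ≤ 6000 * M := by nlinarith
    push_cast
    rw [hT] at h4 ⊢
    linarith
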